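/- Let $\mathbf k$ be a field of characteristic $0$ and $H$ a cocommutative Hopf algebra over $\mathbf k$. For a left $H$-module $M$, $H^{\otimes n}\otimes_H M$ is formed with $H$ acting on $H^{\otimes n}$ from the right through the iterated coproduct (the counit if $n=0$). For left $H$-modules $L,M$ let $C^p(L,M)$ be the space of $H^{\otimes p}$-linear maps $f:L^{\otimes p}\to H^{\otimes p}\otimes_H M$ that are skew-symmetric, $f(x_1,\dots,x_p)=(-1)^\sigma(\sigma\otimes_H\mathrm{id})f(x_{\sigma(1)},\dots,x_{\sigma(p)})$ for $\sigma\in S_p$, where $\sigma\otimes_H\mathrm{id}$ moves the $i$-th tensor factor to position $\sigma(i)$. Pseudo-operations are composed in the usual way, the coproduct being applied to the factor of the slot into which one inserts. A Lie pseudobracket on $L$ is a skew-symmetric $[\cdot*\cdot]\in C^2(L,L)$ with $[x*[y*z]]=[[x*y]*z]+((12)\otimes_H\mathrm{id})[y*[x*z]]$. A representation of $L$ on $M$ is an $H^{\otimes2}$-linear map $\rho:L\otimes M\to H^{\otimes 2}\otimes_H M$ with $\rho([x*y],v)=\rho(x,\rho(y,v))-((12)\otimes_H\mathrm{id})\rho(y,\rho(x,v))$.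 Let $(\mathfrak G,\mathfrak g,\mathfrak h)$ be a quasi-twilled Lie pseudoalgebra: $\mathfrak G=\mathfrak g\boxplus\mathfrak h$ is a direct sum of left $H$-modules with a Lie pseudobracket $\Omega$ for which $\mathfrak h$ is a subpseudoalgebra. Let $\pi:\mathfrak g\otimes\mathfrak g\to H^{\otimes2}\otimes_H\mathfrak g$, $\theta:\mathfrak g\otimes\mathfrak g\to H^{\otimes2}\otimes_H\mathfrak h$, $\eta:\mathfrak g\otimes\mathfrak h\to H^{\otimes2}\otimes_H\mathfrak g$, $\rho:\mathfrak g\otimes\mathfrak h\to H^{\otimes2}\otimes_H\mathfrak h$, $\mu:\mathfrak h\otimes\mathfrak h\to H^{\otimes2}\otimes_H\mathfrak h$ be the components of $\Omega$. Let $D:\mathfrak g\to\mathfrak h$ be a deformation map of type I, i.e. an $H$-linear map with $$(\mathrm{id}\otimes_H D)\big(\pi(x,y)+\eta(x,Dy)-((12)\otimes_H\mathrm{id})\eta(y,Dx)\big)=\mu(Dx,Dy)+\rho(x,Dy)-((12)\otimes_H\mathrm{id})\rho(y,Dx)+\theta(x,y)$$ for all $x,y\in\mathfrak g$. Put $$\pi^D(x,y)=\pi(x,y)+\eta(x,Dy)-((12)\otimes_H\mathrm{id})\eta(y,Dx),\qquad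 \rho^D(x,v)=\rho(x,v)+\mu(Dx,v)-(\mathrm{id}\otimes_H D)\eta(x,v).$$ For operations $f$ of $p$ and $g$ of $q$ variables on $\mathfrak G$ let $(f\circledcirc g)(x_1,\dots,x_{p+q-1})=\sum_\sigma(-1)^\sigma(\sigma\otimes_H\mathrm{id})f(g(x_{\sigma(1)},\dots,x_{\sigma(q)}),x_{\sigma(q+1)},\dots,x_{\sigma(p+q-1)})$, summed over the $(q,p-1)$-shuffles (the sum is $0$ if $p=0$), and $[f,g]_{NR}=f\circledcirc g-(-1)^{(p-1)(q-1)}g\circledcirc f$. Operations between $\mathfrak g$ and $\mathfrak h$ are identified with their lifts to $\mathfrak G$; explicitly, $f\in C^p(\mathfrak g,\mathfrak h)$ lifts to $((x_1,u_1),\dots,(x_p,u_p))\mapsto(0,f(x_1,\dots,x_p))$, and $\kappa\in\{\rho,\eta\}$ lifts to $((x,u),(y,v))\mapsto\kappa(x,v)-((12)\otimes_H\mathrm{id})\kappa(y,u)$. Let $l_1(f)$ and $l_2(f,f')$ be the components in $C^*(\mathfrak g,\mathfrak h)$ of $[\pi+\rho,f]_{NR}$ and $[[\mu+\eta,f]_{NR},f']_{NR}$,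 and let $l_1^D(f)=l_1(f)+l_2(D,f)$ be the twisted differential. Let $d^D_{CE}:C^p(\mathfrak g,\mathfrak h)\to C^{p+1}(\mathfrak g,\mathfrak h)$ be the Chevalley–Eilenberg operator $$d^D_{CE}(f)(x_1,\dots,x_{p+1})=\sum_{i}(-1)^{i+1}\rho^D\big(x_i,f(x_1,\dots,\hat{x_i},\dots,x_{p+1})\big)+\sum_{i<j}(-1)^{i+j}f\big(\pi^D(x_i,x_j),x_1,\dots,\hat{x_i},\dots,\hat{x_j},\dots,x_{p+1}\big),$$ where the tensor factors of each term are permuted into the order $x_1,\dots,x_{p+1}$. In degree $0$, $u\in C^0(\mathfrak g,\mathfrak h)=\mathfrak h$ is treated as the operation $1\otimes_H u$ without variables, so that $(d^D_{CE}u)(x)=(\mathrm{id}\otimes\varepsilon\otimes_H\mathrm{id})\rho^D(x,u)$, where $\varepsilon$ is the counit. Then: 1. $(\mathfrak g,\pi^D)$ is a Lie pseudoalgebra and $\rho^D$ is a representation of it on $\mathfrak h$. 2. For all $p\ge0$ and $f\in C^p(\mathfrak g,\mathfrak h)$ the brackets $[\pi+\rho,f]_{NR}$ and $[[\mu+\eta,D]_{NR},f]_{NR}$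 are lifts of operations from $\mathfrak g$ to $\mathfrak h$, so that they equal $l_1(f)$ and $l_2(D,f)$, and $$l_1^D(f)=(-1)^{p-1}d^D_{CE}(f).$$ 3. $d^D_{CE}$ maps $C^p(\mathfrak g,\mathfrak h)$ to $C^{p+1}(\mathfrak g,\mathfrak h)$ and $d^D_{CE}\circ d^D_{CE}=0$. The complex $C^*(D)$, with $C^0(D)=0$, $C^1(D)=\mathfrak h$ and $C^n(D)=C^{n-1}(\mathfrak g,\mathfrak h)$ for $n\ge2$, has with the differential $l_1^D$ the same cocycles and coboundaries, hence the same cohomology, in every degree as with $d^D_{CE}$. Thus the cohomology of $D$ is the Chevalley–Eilenberg cohomology of $(\mathfrak g,\pi^D)$ with coefficients in $(\mathfrak h,\rho^D)$, shifted by one degree. -/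

import Mathlib

open TensorProduct
noncomputable section
set_option linter.unusedSectionVars false
namespace LiePseudo

lemma prod_ofFn_mul {S : Type*} [Monoid S] : ∀ {n : ℕ} (a b : Fin n → S),
    (∀ i j, i ≠ j → Commute (a i) (b j)) →
    (List.ofFn fun i => a i * b i).prod = (List.ofFn a).prod * (List.ofFn b).prod
  | 0, _, _, _ => by simp
  | n + 1, a, b, h => by
    have ih := prod_ofFn_mul (fun i => a i.succ) (fun i => b i.succ)
      (fun i j hij => h _ _ (fun e => hij (Fin.succ_injective _ e)))
    have hc : Commute (List.ofFn fun i : Fin n => a i.succ).prod (b 0) := by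
      refine Commute.list_prod_left _ _ fun x hx => ?_
      obtain ⟨i, rfl⟩ := (List.mem_ofFn' _ _).1 hx
      exact h _ _ (Fin.succ_ne_zero i)
    simp only [List.ofFn_succ, List.prod_cons, ih]
    rw [mul_assoc, mul_assoc, ← mul_assoc (b 0), ← hc.eq, mul_assoc]

lemma prod_ofFn_single {S : Type*} [Monoid S] : ∀ {n : ℕ} (i : Fin n) (c : Fin n → S),
    (∀ j, j ≠ i → c j = 1) → (List.ofFn c).prod = c i
  | 0, i, _, _ => i.elim0
  | n + 1, i, c, h => by
    simp only [List.ofFn_succ, List.prod_cons]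
    induction i using Fin.cases with
    | zero =>
      have : (List.ofFn fun i : Fin n => c i.succ).prod = 1 :=
        List.prod_eq_one fun x hx => by
          obtain ⟨j, rfl⟩ := (List.mem_ofFn' _ _).1 hx
          exact h _ (Fin.succ_ne_zero j)
      rw [this, mul_one]
    | succ i =>
      rw [h 0 (Fin.succ_ne_zero i).symm, one_mul]
      exact prod_ofFn_single i (fun j => c j.succ)
        (fun j hj => h _ (fun e => hj (Fin.succ_injective _ e)))

section HopfPowers
variable (k H : Type*) [Field k] [Ring H] [HopfAlgebra k H]

/-- The tensor power `H^{⊗ n}` over `k`, with its factorwise algebra structure. -/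
abbrev TPow (n : ℕ) := ⨂[k] (_ : Fin n), H

variable {k H}

/-- `1 ⊗ ⋯ ⊗ h ⊗ ⋯ ⊗ 1`, with `h` in position `i`. -/
def single {n : ℕ} (i : Fin n) : H →ₐ[k] TPow k H n :=
  PiTensorProduct.singleAlgHom (R := k) (A := fun _ : Fin n => H) i

lemma single_commute {n : ℕ} {i j : Fin n} (hij : i ≠ j) (a b : H) :
    Commute (single (k := k) i a) (single j b) := by
  refine PiTensorProduct.tprod_mul_tprod _ _ |>.trans ?_ |>.trans
    (PiTensorProduct.tprod_mul_tprod _ _).symm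
  congr 1
  exact Pi.mulSingle_commute (f := fun _ : Fin n => H) hij a b

lemma hom_ext {n : ℕ} {S : Type*} [Semiring S] [Algebra k S]
    {f g : TPow k H n →ₐ[k] S} (h : ∀ i a, f (single i a) = g (single i a)) : f = g :=
  PiTensorProduct.algHom_ext fun i => AlgHom.ext fun a => h i a

/-- The universal property of `H^{⊗ n}`: algebra maps `φ i : H → S` with pairwise commuting images
give the algebra map `h₁ ⊗ ⋯ ⊗ hₙ ↦ φ₁(h₁) ⋯ φₙ(hₙ)`. -/
def lift {n : ℕ} {S : Type*} [Semiring S] [Algebra k S] (φ : Fin n → H →ₐ[k] S)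
    (hφ : ∀ i j, i ≠ j → ∀ a b, Commute (φ i a) (φ j b)) : TPow k H n →ₐ[k] S :=
  PiTensorProduct.liftAlgHom
    ((MultilinearMap.mkPiAlgebraFin k n S).compLinearMap fun i => (φ i).toLinearMap)
    (by simp)
    (fun x y => by
      simpa using prod_ofFn_mul (fun i => φ i (x i)) (fun i => φ i (y i))
        (fun i j hij => hφ i j hij _ _))

@[simp] lemma lift_tprod {n : ℕ} {S : Type*} [Semiring S] [Algebra k S] (φ : Fin n → H →ₐ[k] S)
    (hφ : ∀ i j, i ≠ j → ∀ a b, Commute (φ i a) (φ j b)) (h : Fin n → H) :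
    lift φ hφ (PiTensorProduct.tprod k h) = (List.ofFn fun i => φ i (h i)).prod := by
  simp [lift]

@[simp] lemma lift_single {n : ℕ} {S : Type*} [Semiring S] [Algebra k S] (φ : Fin n → H →ₐ[k] S)
    (hφ : ∀ i j, i ≠ j → ∀ a b, Commute (φ i a) (φ j b)) (i : Fin n) (a : H) :
    lift φ hφ (single i a) = φ i a := by
  have := lift_tprod φ hφ (Pi.mulSingle i a)
  refine this.trans ((prod_ofFn_single i _ fun j hj => ?_).trans ?_)
  · simp [Pi.mulSingle_eq_of_ne hj]
  · simp

/-- Elements of `H^{⊗ n}` commute with everything the factors commute with. -/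
lemma commute_of_single {n : ℕ} {S : Type*} [Semiring S] [Algebra k S] (f : TPow k H n →ₐ[k] S)
    (s : S) (h : ∀ i a, Commute (f (single i a)) s) (x : TPow k H n) : Commute (f x) s := by
  induction x using PiTensorProduct.induction_on with
  | smul_tprod r a =>
    rw [map_smul]
    refine Commute.smul_left ?_ r
    have hc : ∀ i j : Fin n, i ≠ j → ∀ a b,
        Commute ((f.comp (single i)) a) ((f.comp (single j)) b) :=
      fun i j hij a b => (single_commute hij a b).map f
    have hf : f = lift (fun i => f.comp (single i)) hc := hom_ext fun i a => by
      rw [lift_single]; rfl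
    rw [hf, lift_tprod]
    refine Commute.list_prod_left _ _ fun x hx => ?_
    obtain ⟨i, rfl⟩ := (List.mem_ofFn' _ _).1 hx
    exact h _ _
  | add x y hx hy => rw [map_add]; exact hx.add_left hy

/-- For an injection `j`, the algebra map `H^{⊗ q} → H^{⊗ n}` that puts the `i`-th factor in
position `j i`, and `1` in the positions that `j` misses. -/
def emb {q n : ℕ} (j : Fin q → Fin n) (hj : Function.Injective j) :
    TPow k H q →ₐ[k] TPow k H n :=
  lift (fun i => single (j i)) fun _ _ h a b => single_commute (hj.ne h) a b

@[simp] lemma emb_single {q n : ℕ} (j : Fin q → Fin n) (hj : Function.Injective j) (i : Fin q)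
    (a : H) : emb (k := k) j hj (single i a) = single (j i) a := by simp [emb]

/-- `H ⊗ H^{⊗ n} → H^{⊗ (n + 1)}`. -/
def cons (n : ℕ) : H ⊗[k] TPow k H n →ₐ[k] TPow k H (n + 1) :=
  Algebra.TensorProduct.lift (single 0) (emb Fin.succ (Fin.succ_injective n)) fun a x =>
    (commute_of_single _ _ (fun i b => by
      rw [emb_single]; exact single_commute (Fin.succ_ne_zero i) b a) x).symm

/-- The iterated coproduct `Δ^{(n - 1)} : H → H^{⊗ n}`, `h ↦ h₍₁₎ ⊗ ⋯ ⊗ h₍ₙ₎`; it is the counit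
for `n = 0` and the identity for `n = 1`. -/
def coprod : ∀ n : ℕ, H →ₐ[k] TPow k H n
  | 0 => (Algebra.ofId k (TPow k H 0)).comp (Bialgebra.counitAlgHom k H)
  | n + 1 => (cons n).comp
      ((Algebra.TensorProduct.map (AlgHom.id k H) (coprod n)).comp (Bialgebra.comulAlgHom k H))

/-- Position `i` of the first block of `q` out of `n = q + p` positions. -/
def blockL {q p n : ℕ} (hn : q + p = n) (i : Fin q) : Fin n := ⟨i, by omega⟩

/-- Position `i` of the second block, of `p` out of `n = q + p` positions. -/
def blockR {q p n : ℕ} (hn : q + p = n) (i : Fin p) : Fin n := ⟨q + i, by omega⟩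

lemma blockL_injective {q p n : ℕ} (hn : q + p = n) : Function.Injective (blockL hn) :=
  fun i j h => by simpa [blockL, Fin.ext_iff] using h

lemma blockR_injective {q p n : ℕ} (hn : q + p = n) : Function.Injective (blockR hn) :=
  fun i j h => by simpa [blockR, Fin.ext_iff] using h

lemma blockL_ne_blockR {q p n : ℕ} (hn : q + p = n) (i : Fin q) (j : Fin p) :
    blockL hn i ≠ blockR hn j := by
  intro h
  have := Fin.ext_iff.1 h
  simp only [blockL, blockR] at this
  omega

lemma commute_embL {q p n : ℕ} (hn : q + p = n) (x : TPow k H q) (i : Fin p) (a : H) :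
    Commute (emb (k := k) (blockL hn) (blockL_injective hn) x) (single (blockR hn i) a) :=
  commute_of_single _ _ (fun j b => by
    rw [emb_single]; exact single_commute (blockL_ne_blockR hn j i) b a) x

/-- `Δ^{(q - 1)} ⊗ id^{⊗ p} : H^{⊗ (p + 1)} → H^{⊗ (q + p)}`. -/
def expandL {q p n : ℕ} (hn : q + p = n) : TPow k H (p + 1) →ₐ[k] TPow k H n :=
  lift (Fin.cases ((emb (blockL hn) (blockL_injective hn)).comp (coprod q))
      fun i => single (blockR hn i)) (by
    intro i j hij a b
    induction i using Fin.cases with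
    | zero =>
      induction j using Fin.cases with
      | zero => exact absurd rfl hij
      | succ j => exact commute_embL hn _ _ _
    | succ i =>
      induction j using Fin.cases with
      | zero => exact (commute_embL hn _ _ _).symm
      | succ j => exact single_commute ((blockR_injective hn).ne fun e => hij (congrArg Fin.succ e)) _ _)

/-- `id ⊗ Δ^{(q - 1)} : H ⊗ H → H^{⊗ (q + 1)}`. -/
def expandR (q : ℕ) : TPow k H 2 →ₐ[k] TPow k H (q + 1) :=
  lift (Fin.cases (single 0) fun _ => (emb Fin.succ (Fin.succ_injective q)).comp (coprod q)) (by
    have key : ∀ (x : TPow k H q) (a : H), Commute (emb Fin.succ (Fin.succ_injective q) x)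
        (single (k := k) 0 a) := fun x a => commute_of_single _ _ (fun j b => by
      rw [emb_single]; exact single_commute (Fin.succ_ne_zero j) b a) x
    intro i j hij a b
    induction i using Fin.cases with
    | zero =>
      induction j using Fin.cases with
      | zero => exact absurd rfl hij
      | succ j => exact (key _ _).symm
    | succ i =>
      induction j using Fin.cases with
      | zero => exact key _ _
      | succ j => exact absurd (by rw [Subsingleton.elim i j]) hij)

/-- The permutation of tensor factors `h₁ ⊗ ⋯ ⊗ hₙ ↦ h_{σ⁻¹(1)} ⊗ ⋯ ⊗ h_{σ⁻¹(n)}`: the `i`-th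
factor moves to position `σ i`. -/
def permPow {n : ℕ} (σ : Equiv.Perm (Fin n)) : TPow k H n →ₐ[k] TPow k H n :=
  emb σ σ.injective

lemma permPow_single {n : ℕ} (σ : Equiv.Perm (Fin n)) (i : Fin n) (a : H) :
    permPow (k := k) σ (single i a) = single (σ i) a := emb_single _ _ _ _

lemma permPow_mul {n : ℕ} (σ τ : Equiv.Perm (Fin n)) (x : TPow k H n) :
    permPow (σ * τ) x = permPow σ (permPow τ x) :=
  DFunLike.congr_fun (f := permPow (σ * τ)) (g := (permPow σ).comp (permPow τ))
    (hom_ext fun i a => by simp [permPow_single]) x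

/-- An algebra map, seen in the convolution algebra of linear maps. -/
def cv {S : Type*} [Semiring S] [Algebra k S] (f : H →ₐ[k] S) : WithConv (H →ₗ[k] S) :=
  WithConv.toConv f.toLinearMap

lemma cv_inj {S : Type*} [Semiring S] [Algebra k S] {f g : H →ₐ[k] S} (h : cv f = cv g) :
    f = g := AlgHom.toLinearMap_injective (WithConv.toConv_injective h)

lemma cv_comp {S S' : Type*} [Semiring S] [Algebra k S] [Semiring S'] [Algebra k S']
    (g : S →ₐ[k] S') {f a b : H →ₐ[k] S} (h : cv f = cv a * cv b) :
    cv (g.comp f) = cv (g.comp a) * cv (g.comp b) := by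
  have h2 : f.toLinearMap = (cv a * cv b).ofConv := congrArg WithConv.ofConv h
  have := LinearMap.algHom_comp_convMul_distrib g (cv a) (cv b)
  rw [← h2] at this
  exact congrArg WithConv.toConv this

lemma cv_coprod_succ (n : ℕ) : cv (coprod (k := k) (H := H) (n + 1)) =
    cv (single 0) * cv ((emb Fin.succ (Fin.succ_injective n)).comp (coprod n)) := by
  apply WithConv.ofConv_injective
  ext h
  simp only [cv, LinearMap.convMul_def, coprod]
  simp only [AlgHom.toLinearMap_apply, AlgHom.comp_apply, LinearMap.comp_apply,
    Bialgebra.comulAlgHom_apply]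
  generalize (Coalgebra.comul (R := k) h) = z
  induction z with
  | zero => simp
  | tmul x y => rfl
  | add x y hx hy => simp only [map_add, hx, hy]

lemma cv_ofId {S : Type*} [Semiring S] [Algebra k S] :
    cv ((Algebra.ofId k S).comp (Bialgebra.counitAlgHom k H)) = 1 := rfl

lemma coprod_one : coprod (k := k) (H := H) 1 = single 0 := by
  apply cv_inj
  rw [cv_coprod_succ]
  have : ((emb Fin.succ (Fin.succ_injective 0)).comp (coprod 0) : H →ₐ[k] TPow k H 1) =
      (Algebra.ofId k _).comp (Bialgebra.counitAlgHom k H) := by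
    ext h; simp [coprod, Algebra.ofId_apply]
  rw [this, cv_ofId, mul_one]

lemma cv_coprod_block : ∀ {q p n : ℕ} (hn : q + p = n),
    cv (coprod (k := k) (H := H) n) =
      cv ((emb (blockL hn) (blockL_injective hn)).comp (coprod q)) *
      cv ((emb (blockR hn) (blockR_injective hn)).comp (coprod p))
  | 0, p, n, hn => by
    obtain rfl : p = n := by omega
    have h1 : ((emb (blockL hn) (blockL_injective hn)).comp (coprod 0) : H →ₐ[k] TPow k H p) =
        (Algebra.ofId k _).comp (Bialgebra.counitAlgHom k H) := by
      ext h; simp [coprod, Algebra.ofId_apply]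
    have h2 : emb (k := k) (H := H) (blockR hn) (blockR_injective hn) = AlgHom.id k _ :=
      hom_ext fun i a => by
        rw [emb_single, AlgHom.id_apply]; congr 1; simp [blockR]
    rw [h1, h2, cv_ofId, one_mul, AlgHom.id_comp]
  | q + 1, p, 0, hn => by omega
  | q + 1, p, n + 1, hn => by
    have hn' : q + p = n := by omega
    rw [cv_comp _ (cv_coprod_succ q), cv_coprod_succ n, cv_comp _ (cv_coprod_block hn'), mul_assoc]
    congr 1
    · congr 1
      ext a
      simp only [AlgHom.comp_apply, emb_single]
      congr 1
    · congr 2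
      · simp only [← AlgHom.comp_assoc]
        congr 1
        refine hom_ext fun i a => ?_
        simp only [AlgHom.comp_apply, emb_single]
        congr 1
      · simp only [← AlgHom.comp_assoc]
        congr 1
        refine hom_ext fun i a => ?_
        simp only [AlgHom.comp_apply, emb_single]
        congr 1
        refine congrArg single (Fin.ext ?_)
        simp only [blockR, Fin.val_succ]
        omega

lemma expandL_coprod {q p n : ℕ} (hn : q + p = n) (h : H) :
    expandL (k := k) hn (coprod (p + 1) h) = coprod n h := by
  refine DFunLike.congr_fun (f := (expandL hn).comp (coprod (p + 1))) (g := coprod n) (cv_inj ?_) h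
  rw [cv_comp _ (cv_coprod_succ p), cv_coprod_block hn]
  congr 2
  · ext a; simp [expandL]
  · rw [← AlgHom.comp_assoc]
    congr 1
    exact hom_ext fun i a => by simp [expandL]

lemma expandR_coprod (q : ℕ) (h : H) :
    expandR (k := k) q (coprod 2 h) = coprod (q + 1) h := by
  refine DFunLike.congr_fun (f := (expandR q).comp (coprod 2)) (g := coprod (q + 1))
    (cv_inj ?_) h
  rw [cv_comp _ (cv_coprod_succ 1), cv_coprod_succ q, coprod_one]
  congr 2
  · ext a; simp [expandR]
  · ext a
    simp only [AlgHom.comp_apply, emb_single, expandR, lift_single]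
    rfl

/-- The iterated coproduct of a cocommutative coalgebra is symmetric. -/
lemma permPow_coprod [Coalgebra.IsCocomm k H] : ∀ {n : ℕ} (σ : Equiv.Perm (Fin n)) (h : H),
    permPow (k := k) σ (coprod n h) = coprod n h
  | 0, σ, h => by simp [coprod, Algebra.ofId_apply]
  | n + 1, σ, h => by
    have hswap : ∀ {n : ℕ} (i : Fin n), (permPow (k := k) (H := H)
        (Equiv.swap i.castSucc i.succ)).comp (coprod (n + 1)) = coprod (n + 1) := by
      intro n
      induction n with
      | zero => exact fun i => i.elim0
      | succ n ih =>
        intro i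
        apply cv_inj
        induction i using Fin.cases with
        | zero =>
          have key : cv (coprod (k := k) (H := H) (n + 2)) = cv (single 0) *
              cv (single 1) * cv ((emb Fin.succ (Fin.succ_injective (n + 1))).comp
                ((emb Fin.succ (Fin.succ_injective n)).comp (coprod n))) := by
            rw [cv_coprod_succ, cv_comp _ (cv_coprod_succ n), ← mul_assoc]
            congr 3
            ext a
            simp
          have hcomm : cv (single (k := k) (H := H) (1 : Fin (n + 2))) * cv (single 0) =
              cv (single 0) * cv (single 1) := by
            apply WithConv.ofConv_injective
            ext h
            have aux : ∀ z : H ⊗[k] H, LinearMap.mul' k (TPow k H (n + 2))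
                (TensorProduct.map (single 1).toLinearMap (single 0).toLinearMap z) =
                LinearMap.mul' k (TPow k H (n + 2)) (TensorProduct.map (single 0).toLinearMap
                  (single 1).toLinearMap (TensorProduct.comm k H H z)) := by
              intro z
              induction z with
              | zero => simp
              | tmul x y => exact (single_commute (by simp) x y).eq
              | add x y hx hy => simp only [map_add, hx, hy]
            refine (aux _).trans ?_
            rw [Coalgebra.comm_comul]
            rfl
          have h2 : cv (((permPow (k := k) (H := H) (Equiv.swap (Fin.castSucc 0)
              (Fin.succ (0 : Fin (n + 1))))).comp (coprod (n + 2)))) = cv (single 1) *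
              cv (single 0) * cv ((emb Fin.succ (Fin.succ_injective (n + 1))).comp
                ((emb Fin.succ (Fin.succ_injective n)).comp (coprod n))) := by
            rw [cv_comp _ (cv_coprod_succ _), cv_comp _ (cv_comp _ (cv_coprod_succ n)), ← mul_assoc]
            refine congrArg₂ (· * ·) (congrArg₂ (· * ·) (congrArg cv ?_) (congrArg cv ?_))
              (congrArg cv ?_)
            · ext a
              simp [permPow_single]
            · ext a
              simp [permPow_single]
            · simp only [← AlgHom.comp_assoc]
              congr 1
              refine hom_ext fun j a => ?_
              simp only [AlgHom.comp_apply, permPow_single, emb_single]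
              congr 1
          rw [h2, hcomm, key]
        | succ i =>
          rw [cv_comp _ (cv_coprod_succ _), cv_coprod_succ]
          congr 2
          · ext a
            simp only [AlgHom.comp_apply, permPow_single]
            congr 1
          · conv_rhs => rw [← ih i]
            simp only [← AlgHom.comp_assoc]
            congr 1
            refine hom_ext fun j a => ?_
            simp only [AlgHom.comp_apply, permPow_single, emb_single]
            congr 1
            exact congrArg single ((Fin.succ_injective (n + 1)).map_swap i.castSucc i.succ j).symm
    have hmem : σ ∈ Submonoid.closure
        (Set.range fun i : Fin n => Equiv.swap i.castSucc i.succ) := by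
      rw [Equiv.Perm.mclosure_swap_castSucc_succ]; trivial
    induction hmem using Submonoid.closure_induction with
    | mem x hx =>
      obtain ⟨i, rfl⟩ := hx
      exact DFunLike.congr_fun (hswap i) h
    | one =>
      have : permPow (k := k) (H := H) (1 : Equiv.Perm (Fin (n + 1))) = AlgHom.id k _ :=
        hom_ext fun i a => by simp [permPow_single]
      rw [this]; rfl
    | mul x y _ _ hx hy => rw [permPow_mul, hy, hx]

end HopfPowers

section PseudoTensor
variable (k H : Type*) [Field k] [Ring H] [HopfAlgebra k H]

/-- The relations `a Δ^{(n - 1)}(h) ⊗ m = a ⊗ h m` in `H^{⊗ n} ⊗ M`. -/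
def balanced (n : ℕ) (M : Type*) [AddCommGroup M] [Module k M] [Module H M] :
    Submodule (TPow k H n) (TPow k H n ⊗[k] M) :=
  Submodule.span _ (Set.range fun z : H × M =>
    (coprod n z.1 : TPow k H n) ⊗ₜ[k] z.2 - (1 : TPow k H n) ⊗ₜ[k] (z.1 • z.2))

/-- The left `H^{⊗ n}`-module `H^{⊗ n} ⊗_H M`, where `H` acts on `H^{⊗ n}` from the right through
the iterated coproduct. -/
def PT (n : ℕ) (M : Type*) [AddCommGroup M] [Module k M] [Module H M] : Type _ :=
  (TPow k H n ⊗[k] M) ⧸ balanced k H n M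

namespace PT
variable (n : ℕ) (M : Type*) [AddCommGroup M] [Module k M] [Module H M]

instance : AddCommGroup (PT k H n M) :=
  inferInstanceAs (AddCommGroup ((TPow k H n ⊗[k] M) ⧸ balanced k H n M))

instance : Module (TPow k H n) (PT k H n M) :=
  inferInstanceAs (Module (TPow k H n) ((TPow k H n ⊗[k] M) ⧸ balanced k H n M))

instance : Module k (PT k H n M) :=
  inferInstanceAs (Module k ((TPow k H n ⊗[k] M) ⧸ balanced k H n M))

instance : IsScalarTower k (TPow k H n) (PT k H n M) :=
  inferInstanceAs (IsScalarTower k (TPow k H n) ((TPow k H n ⊗[k] M) ⧸ balanced k H n M))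

variable {k H n M}

/-- The element `a ⊗_H m`. -/
def mk (a : TPow k H n) (m : M) : PT k H n M :=
  Submodule.Quotient.mk (p := balanced k H n M) (a ⊗ₜ[k] m)

lemma smul_mk (b a : TPow k H n) (m : M) : b • mk a m = mk (b * a) m := rfl

lemma mk_coprod (a : TPow k H n) (h : H) (m : M) : mk (a * coprod n h) m = mk a (h • m) := by
  have h1 : mk (coprod n h : TPow k H n) m = mk 1 (h • m) :=
    (Submodule.Quotient.eq _).2 (Submodule.subset_span ⟨(h, m), rfl⟩)
  rw [← smul_mk, h1, smul_mk, mul_one]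

lemma mk_add_left (a b : TPow k H n) (m : M) : mk (a + b) m = mk a m + mk b m :=
  congrArg (Submodule.Quotient.mk (p := balanced k H n M)) (TensorProduct.add_tmul a b m)

lemma mk_add_right (a : TPow k H n) (m m' : M) : mk a (m + m') = mk a m + mk a m' :=
  congrArg (Submodule.Quotient.mk (p := balanced k H n M)) (TensorProduct.tmul_add a m m')

lemma mk_smul_left (c : k) (a : TPow k H n) (m : M) : mk (c • a) m = c • mk a m :=
  congrArg (Submodule.Quotient.mk (p := balanced k H n M)) (TensorProduct.smul_tmul' c a m).symm

lemma mk_smul_right (c : k) (a : TPow k H n) (m : M) : mk a (c • m) = c • mk a m :=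
  congrArg (Submodule.Quotient.mk (p := balanced k H n M)) (TensorProduct.tmul_smul c a m)

lemma induction {P : PT k H n M → Prop} (hmk : ∀ a m, P (mk a m))
    (hadd : ∀ z w, P z → P w → P (z + w)) (z : PT k H n M) : P z := by
  obtain ⟨z, rfl⟩ := Submodule.Quotient.mk_surjective _ z
  induction z with
  | zero => simpa [mk] using hmk 0 0
  | tmul a m => exact hmk a m
  | add z w hz hw => exact hadd _ _ hz hw

/-- The universal property of `H^{⊗ n} ⊗_H M`. -/
def lift {X : Type*} [AddCommGroup X] [Module k X] (φ : TPow k H n →ₗ[k] M →ₗ[k] X)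
    (hφ : ∀ a h m, φ (a * coprod n h) m = φ a (h • m)) : PT k H n M →ₗ[k] X :=
  ((balanced k H n M).restrictScalars k).liftQ (TensorProduct.lift φ) (by
    intro z hz
    have key : ∀ b : TPow k H n, TensorProduct.lift φ (b • z) = 0 := by
      have hz' : z ∈ balanced k H n M := hz
      clear hz
      unfold balanced at hz'
      induction hz' using Submodule.span_induction with
      | mem z hz =>
        obtain ⟨⟨h, m⟩, rfl⟩ := hz
        intro b
        simp [smul_sub, TensorProduct.smul_tmul', hφ]
      | zero => simp
      | add z w _ _ hz hw => intro b; rw [smul_add, map_add, hz, hw, add_zero]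
      | smul a z _ hz => intro b; rw [← mul_smul]; exact hz _
    simpa using key 1)

@[simp] lemma lift_mk {X : Type*} [AddCommGroup X] [Module k X] (φ : TPow k H n →ₗ[k] M →ₗ[k] X)
    (hφ : ∀ a h m, φ (a * coprod n h) m = φ a (h • m)) (a : TPow k H n) (m : M) :
    lift φ hφ (mk a m) = φ a m := rfl

/-- `a ⊗_H m ↦ e(a) ⊗_H m`, for an algebra map `e` that is compatible with the coproducts. -/
def pull {n' : ℕ} (e : TPow k H n →ₐ[k] TPow k H n') (he : ∀ h, e (coprod n h) = coprod n' h) :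
    PT k H n M →ₗ[k] PT k H n' M :=
  lift (LinearMap.mk₂ k (fun a m => mk (e a) m) (fun a b m => by rw [map_add, mk_add_left])
    (fun c a m => by rw [map_smul, mk_smul_left]) (fun a m m' => mk_add_right _ _ _)
    (fun c a m => mk_smul_right _ _ _))
    (fun a h m => by simp only [LinearMap.mk₂_apply, map_mul, he, mk_coprod])

@[simp] lemma pull_mk {n' : ℕ} (e : TPow k H n →ₐ[k] TPow k H n')
    (he : ∀ h, e (coprod n h) = coprod n' h) (a : TPow k H n) (m : M) :
    pull e he (mk a m) = mk (e a) m := rfl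

lemma pull_smul {n' : ℕ} (e : TPow k H n →ₐ[k] TPow k H n')
    (he : ∀ h, e (coprod n h) = coprod n' h) (b : TPow k H n) (z : PT k H n M) :
    pull e he (b • z) = e b • pull e he z := by
  induction z using induction with
  | hmk a m => simp [smul_mk]
  | hadd z w hz hw => rw [smul_add, map_add, hz, hw, map_add, smul_add]

/-- `σ ⊗_H id`, which moves the `i`-th tensor factor to position `σ i`. -/
def perm [Coalgebra.IsCocomm k H] (σ : Equiv.Perm (Fin n)) : PT k H n M →ₗ[k] PT k H n M :=
  pull (permPow σ) (permPow_coprod σ)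

/-- `id ⊗_H u`, for an `H`-linear map `u`. -/
def map {N : Type*} [AddCommGroup N] [Module k N] [Module H N] [IsScalarTower k H M]
    [IsScalarTower k H N] (u : M →ₗ[H] N) : PT k H n M →ₗ[k] PT k H n N :=
  lift (LinearMap.mk₂ k (fun a m => mk a (u m)) (fun a b m => mk_add_left _ _ _)
    (fun c a m => mk_smul_left _ _ _) (fun a m m' => by rw [map_add, mk_add_right])
    (fun c a m => by rw [LinearMap.map_smul_of_tower, mk_smul_right]))
    (fun a h m => by simp only [LinearMap.mk₂_apply, mk_coprod, map_smul])

@[simp] lemma map_mk {N : Type*} [AddCommGroup N] [Module k N] [Module H N] [IsScalarTower k H M]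
    [IsScalarTower k H N] (u : M →ₗ[H] N) (a : TPow k H n) (m : M) :
    map u (mk a m) = mk a (u m) := rfl

lemma map_smul' {N : Type*} [AddCommGroup N] [Module k N] [Module H N] [IsScalarTower k H M]
    [IsScalarTower k H N] (u : M →ₗ[H] N) (b : TPow k H n) (z : PT k H n M) :
    map u (b • z) = b • map u z := by
  induction z using induction with
  | hmk a m => rfl
  | hadd z w hz hw => rw [smul_add, _root_.map_add, hz, hw, _root_.map_add, smul_add]

/-- Insertion of pseudotensors into one slot of an `H`-linear operation. Here `F : M → H^{⊗ m} ⊗_H N`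
is the operation as a function of its entry in slot `s`; the map `c` puts the coefficients of the
inserted element in their positions, and `e` applies the coproduct to the factor in slot `s`:
`a ⊗_H x ↦ (c(a) e(b)) ⊗_H y` if `F x = b ⊗_H y`. -/
def insert {N : Type*} [AddCommGroup N] [Module k N] [Module H N] {q m : ℕ} (s : Fin m)
    (c : TPow k H q →ₐ[k] TPow k H n) (e : TPow k H m →ₐ[k] TPow k H n)
    (he : ∀ h, e (coprod m h) = coprod n h) (hs : ∀ h, e (single s h) = c (coprod q h))
    (F : M →ₗ[k] PT k H m N) (hF : ∀ (h : H) x, F (h • x) = single (k := k) s h • F x) :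
    PT k H q M →ₗ[k] PT k H n N :=
  lift (LinearMap.mk₂ k (fun a x => c a • pull e he (F x))
    (fun a b x => by rw [map_add, add_smul])
    (fun r a x => by rw [map_smul, smul_assoc])
    (fun a x y => by rw [map_add, map_add, smul_add])
    (fun r a x => by rw [map_smul, map_smul, smul_algebra_smul_comm]))
    (fun a h x => by
      simp only [LinearMap.mk₂_apply, hF, pull_smul, hs, map_mul, mul_smul])

end PT
end PseudoTensor


section Operations
variable (k H : Type*) [Field k] [Ring H] [HopfAlgebra k H]

/-- The space of `H^{⊗ p}`-linear maps `L^{⊗ p} → H^{⊗ p} ⊗_H M`, i.e. of maps of `p` variables in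
`L` that are additive and `H`-linear in each variable; for `p = 0` it is `k ⊗_H M`. -/
def pHomSubmodule (p : ℕ) (L M : Type*) [AddCommGroup L] [Module H L]
    [AddCommGroup M] [Module k M] [Module H M] : Submodule k ((Fin p → L) → PT k H p M) where
  carrier := {f | (∀ x i y z, f (Function.update x i (y + z)) =
      f (Function.update x i y) + f (Function.update x i z)) ∧
    ∀ x i (h : H) y, f (Function.update x i (h • y)) =
      single (k := k) i h • f (Function.update x i y)}
  add_mem' := by
    rintro f g ⟨hf, hf'⟩ ⟨hg, hg'⟩
    refine ⟨fun x i y z => ?_, fun x i h y => ?_⟩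
    · simp only [Pi.add_apply, hf, hg]; abel
    · simp only [Pi.add_apply, hf', hg', smul_add]
  zero_mem' := ⟨by simp, by simp⟩
  smul_mem' := by
    rintro c f ⟨hf, hf'⟩
    refine ⟨fun x i y z => ?_, fun x i h y => ?_⟩
    · simp only [Pi.smul_apply, hf, smul_add]
    · simp only [Pi.smul_apply, hf', smul_algebra_smul_comm]

/-- The type of `H^{⊗ p}`-linear maps `L^{⊗ p} → H^{⊗ p} ⊗_H M`. -/
@[ext]
structure PHom (p : ℕ) (L M : Type*) [AddCommGroup L] [Module H L]
    [AddCommGroup M] [Module k M] [Module H M] where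
  /-- The underlying function. -/
  toFun : (Fin p → L) → PT k H p M
  mem : toFun ∈ pHomSubmodule k H p L M

namespace PHom
variable (p : ℕ) (L M : Type*) [AddCommGroup L] [Module H L]
    [AddCommGroup M] [Module k M] [Module H M]

/-- `PHom` is the type of elements of `pHomSubmodule`. -/
def equiv : PHom k H p L M ≃ pHomSubmodule k H p L M where
  toFun f := ⟨f.1, f.2⟩
  invFun f := ⟨f.1, f.2⟩

instance : AddCommGroup (PHom k H p L M) := (equiv k H p L M).addCommGroup

instance : Module k (PHom k H p L M) := (equiv k H p L M).module k

variable {k H p L M}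

lemma add_apply (f g : PHom k H p L M) (x : Fin p → L) : (f + g).1 x = f.1 x + g.1 x := rfl

lemma sub_apply (f g : PHom k H p L M) (x : Fin p → L) : (f - g).1 x = f.1 x - g.1 x := rfl

lemma neg_apply (f : PHom k H p L M) (x : Fin p → L) : (-f).1 x = -f.1 x := rfl

lemma zero_apply (x : Fin p → L) : (0 : PHom k H p L M).1 x = 0 := rfl

lemma smul_apply (c : k) (f : PHom k H p L M) (x : Fin p → L) : (c • f).1 x = c • f.1 x := rfl

end PHom

/-- The space of `H^{⊗ 2}`-linear maps `A ⊗ B → H^{⊗ 2} ⊗_H N`. -/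
def pBilSubmodule (A B N : Type*) [AddCommGroup A] [Module H A] [AddCommGroup B] [Module H B]
    [AddCommGroup N] [Module k N] [Module H N] : Submodule k (A → B → PT k H 2 N) where
  carrier := {β | (∀ a a' b, β (a + a') b = β a b + β a' b) ∧
    (∀ a b b', β a (b + b') = β a b + β a b') ∧
    (∀ (h : H) a b, β (h • a) b = single (k := k) (0 : Fin 2) h • β a b) ∧
    ∀ (h : H) a b, β a (h • b) = single (k := k) (1 : Fin 2) h • β a b}
  add_mem' := by
    rintro f g ⟨f1, f2, f3, f4⟩ ⟨g1, g2, g3, g4⟩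
    refine ⟨fun a a' b => ?_, fun a b b' => ?_, fun h a b => ?_, fun h a b => ?_⟩
    · simp only [Pi.add_apply, f1, g1]; abel
    · simp only [Pi.add_apply, f2, g2]; abel
    · exact (congrArg₂ _ (f3 h a b) (g3 h a b)).trans (smul_add _ _ _).symm
    · exact (congrArg₂ _ (f4 h a b) (g4 h a b)).trans (smul_add _ _ _).symm
  zero_mem' := ⟨by simp, by simp, fun _ _ _ => (smul_zero _).symm, fun _ _ _ => (smul_zero _).symm⟩
  smul_mem' := by
    rintro c f ⟨f1, f2, f3, f4⟩
    refine ⟨fun a a' b => ?_, fun a b b' => ?_, fun h a b => ?_, fun h a b => ?_⟩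
    · simp only [Pi.smul_apply, f1, smul_add]
    · simp only [Pi.smul_apply, f2, smul_add]
    · exact (congrArg (c • ·) (f3 h a b)).trans (smul_algebra_smul_comm _ _ _).symm
    · exact (congrArg (c • ·) (f4 h a b)).trans (smul_algebra_smul_comm _ _ _).symm

/-- The type of `H^{⊗ 2}`-linear maps `A ⊗ B → H^{⊗ 2} ⊗_H N`. -/
@[ext]
structure PBil (A B N : Type*) [AddCommGroup A] [Module H A] [AddCommGroup B] [Module H B]
    [AddCommGroup N] [Module k N] [Module H N] where
  /-- The underlying function. -/
  toFun : A → B → PT k H 2 N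
  mem : toFun ∈ pBilSubmodule k H A B N

namespace PBil
variable (A B N : Type*) [AddCommGroup A] [Module H A] [AddCommGroup B] [Module H B]
    [AddCommGroup N] [Module k N] [Module H N]

/-- `PBil` is the type of elements of `pBilSubmodule`. -/
def equiv : PBil k H A B N ≃ pBilSubmodule k H A B N where
  toFun f := ⟨f.1, f.2⟩
  invFun f := ⟨f.1, f.2⟩

instance : AddCommGroup (PBil k H A B N) := (equiv k H A B N).addCommGroup

instance : Module k (PBil k H A B N) := (equiv k H A B N).module k

variable {k H A B N}

lemma add_apply (f g : PBil k H A B N) (a : A) (b : B) : (f + g).1 a b = f.1 a b + g.1 a b := rfl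

lemma sub_apply (f g : PBil k H A B N) (a : A) (b : B) : (f - g).1 a b = f.1 a b - g.1 a b := rfl

lemma neg_apply (f : PBil k H A B N) (a : A) (b : B) : (-f).1 a b = -f.1 a b := rfl

lemma zero_apply (a : A) (b : B) : (0 : PBil k H A B N).1 a b = 0 := rfl

lemma smul_apply (c : k) (f : PBil k H A B N) (a : A) (b : B) : (c • f).1 a b = c • f.1 a b := rfl

end PBil

variable {k H}
variable {L M A B N : Type*} [AddCommGroup L] [Module k L] [Module H L] [IsScalarTower k H L]
  [AddCommGroup M] [Module k M] [Module H M] [IsScalarTower k H M]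
  [AddCommGroup A] [Module k A] [Module H A] [IsScalarTower k H A]
  [AddCommGroup B] [Module k B] [Module H B] [IsScalarTower k H B]
  [AddCommGroup N] [Module k N] [Module H N] [IsScalarTower k H N]

lemma single_algebraMap_smul {n : ℕ} (i : Fin n) (c : k) (z : PT k H n M) :
    single (k := k) i (algebraMap k H c) • z = c • z := by
  rw [AlgHom.commutes, algebraMap_smul]

namespace PHom

lemma map_add {p : ℕ} (f : PHom k H p L M) (x : Fin p → L) (i : Fin p) (y z : L) :
    f.1 (Function.update x i (y + z)) =
      f.1 (Function.update x i y) + f.1 (Function.update x i z) := f.2.1 x i y z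

lemma map_smul {p : ℕ} (f : PHom k H p L M) (x : Fin p → L) (i : Fin p) (h : H) (y : L) :
    f.1 (Function.update x i (h • y)) = single (k := k) i h • f.1 (Function.update x i y) :=
  f.2.2 x i h y

/-- `f` as a function of its first variable. -/
def slot {p : ℕ} (f : PHom k H (p + 1) L M) (x : Fin p → L) : L →ₗ[k] PT k H (p + 1) M where
  toFun y := f.1 (Fin.cons y x)
  map_add' y z := by
    simpa [Fin.update_cons_zero] using f.map_add (Fin.cons 0 x) 0 y z
  map_smul' c y := by
    have := f.map_smul (Fin.cons 0 x) 0 (algebraMap k H c) y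
    rw [single_algebraMap_smul, algebraMap_smul] at this
    simpa [Fin.update_cons_zero] using this

lemma slot_smul {p : ℕ} (f : PHom k H (p + 1) L M) (x : Fin p → L) (h : H) (y : L) :
    f.slot x (h • y) = single (k := k) (0 : Fin (p + 1)) h • f.slot x y := by
  simpa [slot, Fin.update_cons_zero] using f.map_smul (Fin.cons 0 x) 0 h y

/-- `z ↦ f(z, x₁, …, x_p)` for `z` in `H^{⊗ q} ⊗_H L`:
`f(a ⊗_H y, x) = (a ⊗ 1)(Δ^{(q - 1)} ⊗ id)(f(y, x))`. -/
def insL {q p n : ℕ} (hn : q + p = n) (f : PHom k H (p + 1) L M) (x : Fin p → L) :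
    PT k H q L →ₗ[k] PT k H n M :=
  PT.insert 0 (emb (blockL hn) (blockL_injective hn)) (expandL hn) (expandL_coprod hn)
    (fun h => by simp [expandL]) (f.slot x) (f.slot_smul x)

lemma insL_mk {q p n : ℕ} (hn : q + p = n) (f : PHom k H (p + 1) L M) (x : Fin p → L)
    (a : TPow k H q) (y : L) : f.insL hn x (PT.mk a y) =
      emb (blockL hn) (blockL_injective hn) a •
        PT.pull (expandL hn) (expandL_coprod hn) (f.1 (Fin.cons y x)) := rfl

lemma insL_smul {q p n : ℕ} (hn : q + p = n) (f : PHom k H (p + 1) L M) (x : Fin p → L)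
    (b : TPow k H q) (z : PT k H q L) : f.insL hn x (b • z) =
      emb (blockL hn) (blockL_injective hn) b • f.insL hn x z := by
  induction z using PT.induction with
  | hmk a y => rw [PT.smul_mk, insL_mk, insL_mk, _root_.map_mul, mul_smul]
  | hadd z w hz hw => rw [smul_add, _root_.map_add, hz, hw, _root_.map_add, smul_add]

lemma insL_update_add {q p n : ℕ} (hn : q + p = n) (f : PHom k H (p + 1) L M) (x : Fin p → L)
    (i : Fin p) (u v : L) (z : PT k H q L) : f.insL hn (Function.update x i (u + v)) z =
      f.insL hn (Function.update x i u) z + f.insL hn (Function.update x i v) z := by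
  induction z using PT.induction with
  | hmk a y =>
    simp only [insL_mk, Fin.cons_update, f.map_add, _root_.map_add, smul_add]
  | hadd z w hz hw => simp only [_root_.map_add, hz, hw]; abel

lemma insL_update_smul {q p n : ℕ} (hn : q + p = n) (f : PHom k H (p + 1) L M) (x : Fin p → L)
    (i : Fin p) (h : H) (u : L) (z : PT k H q L) : f.insL hn (Function.update x i (h • u)) z =
      single (k := k) (blockR hn i) h • f.insL hn (Function.update x i u) z := by
  induction z using PT.induction with
  | hmk a y =>
    simp only [insL_mk, Fin.cons_update, f.map_smul, PT.pull_smul]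
    rw [← mul_smul, ← mul_smul, ← (commute_embL hn a i h).eq]
    simp [expandL]
  | hadd z w hz hw => simp only [_root_.map_add, hz, hw, smul_add]

/-- The action of a permutation, `(σ ⊗_H id) f(x_{σ(1)}, …, x_{σ(p)})`. -/
def permAct [Coalgebra.IsCocomm k H] {p : ℕ} (σ : Equiv.Perm (Fin p)) :
    PHom k H p L M →ₗ[k] PHom k H p L M where
  toFun f := ⟨fun x => PT.perm σ (f.1 (x ∘ σ)), by
    have key : ∀ (x : Fin p → L) (i : Fin p) (y : L), Function.update x i y ∘ σ =
        Function.update (x ∘ σ) (σ.symm i) y := fun x i y => by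
      rw [Function.update_comp_equiv]
    refine ⟨fun x i y z => ?_, fun x i h y => ?_⟩
    · simp only [key, f.map_add, _root_.map_add]
    · simp only [key, f.map_smul, PT.perm, PT.pull_smul, permPow_single, Equiv.apply_symm_apply]⟩
  map_add' f g := PHom.ext (funext fun x => _root_.map_add (PT.perm σ) _ _)
  map_smul' c f := PHom.ext (funext fun x => _root_.map_smul (PT.perm σ) _ _)

lemma update_blockL {q p n : ℕ} (hn : q + p = n) (x : Fin n → L) (i : Fin q) (y : L) :
    (fun j => Function.update x (blockL hn i) y (blockL hn j)) =
      Function.update (fun j => x (blockL hn j)) i y :=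
  Function.update_comp_eq_of_injective x (blockL_injective hn) i y

lemma update_blockR {q p n : ℕ} (hn : q + p = n) (x : Fin n → L) (i : Fin p) (y : L) :
    (fun j => Function.update x (blockR hn i) y (blockR hn j)) =
      Function.update (fun j => x (blockR hn j)) i y :=
  Function.update_comp_eq_of_injective x (blockR_injective hn) i y

lemma update_blockL_R {q p n : ℕ} (hn : q + p = n) (x : Fin n → L) (i : Fin q) (y : L) :
    (fun j => Function.update x (blockL hn i) y (blockR hn j)) = fun j => x (blockR hn j) :=
  funext fun j => Function.update_of_ne (blockL_ne_blockR hn i j).symm _ _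

lemma update_blockR_L {q p n : ℕ} (hn : q + p = n) (x : Fin n → L) (i : Fin p) (y : L) :
    (fun j => Function.update x (blockR hn i) y (blockL hn j)) = fun j => x (blockL hn j) :=
  funext fun j => Function.update_of_ne (blockL_ne_blockR hn j i) _ _

lemma block_cases {q p n : ℕ} (hn : q + p = n) (i : Fin n) :
    (∃ j, i = blockL hn j) ∨ ∃ j, i = blockR hn j := by
  by_cases h : (i : ℕ) < q
  · exact Or.inl ⟨⟨i, h⟩, rfl⟩
  · exact Or.inr ⟨⟨i - q, by omega⟩, Fin.ext (by simp only [blockR]; omega)⟩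

/-- The composition `f(g(x₁, …, x_q), x_{q+1}, …, x_{q+p})`. -/
def compL {q p n : ℕ} (hn : q + p = n) :
    PHom k H (p + 1) L M →ₗ[k] PHom k H q L L →ₗ[k] PHom k H n L M :=
  LinearMap.mk₂ k (fun f g => ⟨fun x => f.insL hn (fun j => x (blockR hn j))
      (g.1 fun j => x (blockL hn j)), by
    refine ⟨fun x i y z => ?_, fun x i h y => ?_⟩
    · obtain ⟨j, rfl⟩ | ⟨j, rfl⟩ := block_cases hn i
      · simp only [update_blockL, update_blockL_R, g.map_add, _root_.map_add]
      · simp only [update_blockR, update_blockR_L, insL_update_add]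
    · obtain ⟨j, rfl⟩ | ⟨j, rfl⟩ := block_cases hn i
      · simp only [update_blockL, update_blockL_R, g.map_smul, insL_smul, emb_single]
      · simp only [update_blockR, update_blockR_L, insL_update_smul]⟩)
    (fun f f' g => by
      refine PHom.ext (funext fun x => ?_)
      change insL hn (f + f') _ _ = insL hn f _ _ + insL hn f' _ _
      generalize (g.1 fun j => x (blockL hn j)) = z
      induction z using PT.induction with
      | hmk a y =>
        have : (f + f').1 (Fin.cons y fun j => x (blockR hn j)) = f.1 _ + f'.1 _ := rfl
        simp only [insL_mk, this, _root_.map_add, smul_add]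
      | hadd z w hz hw => simp only [_root_.map_add, hz, hw]; abel)
    (fun c f g => by
      refine PHom.ext (funext fun x => ?_)
      change insL hn (c • f) _ _ = c • insL hn f _ _
      generalize (g.1 fun j => x (blockL hn j)) = z
      induction z using PT.induction with
      | hmk a y =>
        have : (c • f).1 (Fin.cons y fun j => x (blockR hn j)) = c • f.1 _ := rfl
        simp only [insL_mk, this, _root_.map_smul, smul_algebra_smul_comm]
      | hadd z w hz hw => simp only [_root_.map_add, hz, hw, smul_add])
    (fun f g g' => PHom.ext (funext fun x => _root_.map_add (insL hn f _) _ _))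
    (fun c f g => PHom.ext (funext fun x => _root_.map_smul (insL hn f _) _ _))

end PHom

namespace PBil

lemma add_left (β : PBil k H A B N) (a a' : A) (b : B) : β.1 (a + a') b = β.1 a b + β.1 a' b :=
  β.2.1 a a' b

lemma add_right (β : PBil k H A B N) (a : A) (b b' : B) : β.1 a (b + b') = β.1 a b + β.1 a b' :=
  β.2.2.1 a b b'

lemma smul_left (β : PBil k H A B N) (h : H) (a : A) (b : B) :
    β.1 (h • a) b = single (k := k) (0 : Fin 2) h • β.1 a b := β.2.2.2.1 h a b

lemma smul_right (β : PBil k H A B N) (h : H) (a : A) (b : B) :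
    β.1 a (h • b) = single (k := k) (1 : Fin 2) h • β.1 a b := β.2.2.2.2 h a b

/-- `y ↦ β(x, y)`. -/
def right (β : PBil k H A B N) (x : A) : B →ₗ[k] PT k H 2 N where
  toFun y := β.1 x y
  map_add' y z := β.add_right x y z
  map_smul' c y := by
    have := β.smul_right (algebraMap k H c) x y
    rwa [single_algebraMap_smul, algebraMap_smul] at this

/-- `x ↦ β(x, y)`. -/
def left (β : PBil k H A B N) (y : B) : A →ₗ[k] PT k H 2 N where
  toFun x := β.1 x y
  map_add' x z := β.add_left x z y
  map_smul' c x := by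
    have := β.smul_left (algebraMap k H c) x y
    rwa [single_algebraMap_smul, algebraMap_smul] at this

/-- `z ↦ β(x, z)` for `z` in `H^{⊗ q} ⊗_H B`:
`β(x, a ⊗_H y) = (1 ⊗ a)(id ⊗ Δ^{(q - 1)})(β(x, y))`. -/
def insR {q : ℕ} (β : PBil k H A B N) (x : A) : PT k H q B →ₗ[k] PT k H (q + 1) N :=
  PT.insert 1 (emb Fin.succ (Fin.succ_injective q)) (expandR q) (expandR_coprod q)
    (fun h => by rw [expandR, lift_single]; rfl) (β.right x) (fun h y => β.smul_right h x y)

/-- `z ↦ β(z, y)` for `z` in `H^{⊗ q} ⊗_H A`: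
`β(a ⊗_H x, y) = (a ⊗ 1)(Δ^{(q - 1)} ⊗ id)(β(x, y))`. -/
def insL {q : ℕ} (β : PBil k H A B N) (y : B) : PT k H q A →ₗ[k] PT k H (q + 1) N :=
  PT.insert 0 (emb (blockL rfl) (blockL_injective rfl)) (expandL rfl) (expandL_coprod rfl)
    (fun h => by simp [expandL]) (β.left y) (fun h x => β.smul_left h x y)

lemma insR_mk {q : ℕ} (β : PBil k H A B N) (x : A) (a : TPow k H q) (y : B) :
    β.insR x (PT.mk a y) = emb Fin.succ (Fin.succ_injective q) a •
      PT.pull (expandR q) (expandR_coprod q) (β.1 x y) := rfl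

lemma insL_mk {q : ℕ} (β : PBil k H A B N) (y : B) (a : TPow k H q) (x : A) :
    β.insL y (PT.mk a x) =
      emb (blockL (p := 1) (n := q + 1) rfl) (blockL_injective rfl) a •
        PT.pull (expandL (p := 1) rfl) (expandL_coprod (p := 1) rfl) (β.1 x y) := rfl

/-- The composition `β(x₁, f(x₂, …, x_{q+1}))`. -/
def compR {q : ℕ} (β : PBil k H A B N) : PHom k H q A B →ₗ[k] PHom k H (q + 1) A N where
  toFun f := ⟨fun x => β.insR (x 0) (f.1 (Fin.tail x)), by
    have h1 : ∀ (b : TPow k H q) (x : A) (z : PT k H q B), β.insR x (b • z) =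
        emb Fin.succ (Fin.succ_injective q) b • β.insR x z := by
      intro b x z
      induction z using PT.induction with
      | hmk a y => rw [PT.smul_mk, insR_mk, insR_mk, map_mul, mul_smul]
      | hadd z w hz hw => rw [smul_add, map_add, hz, hw, map_add, smul_add]
    have h2 : ∀ (x x' : A) (z : PT k H q B), β.insR (x + x') z = β.insR x z + β.insR x' z := by
      intro x x' z
      induction z using PT.induction with
      | hmk a y => simp only [insR_mk, β.add_left, map_add, smul_add]
      | hadd z w hz hw => simp only [map_add, hz, hw]; abel
    have h3 : ∀ (h : H) (x : A) (z : PT k H q B), β.insR (h • x) z =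
        single (k := k) (0 : Fin (q + 1)) h • β.insR x z := by
      intro h x z
      induction z using PT.induction with
      | hmk a y =>
        have hc : Commute (emb Fin.succ (Fin.succ_injective q) a) (single (k := k) (0 : Fin (q + 1)) h) :=
          commute_of_single _ _ (fun j b => by
            rw [emb_single]; exact single_commute (Fin.succ_ne_zero j) b h) a
        simp only [insR_mk, β.smul_left, PT.pull_smul]
        rw [← mul_smul, ← mul_smul, ← hc.eq]
        simp [expandR]
      | hadd z w hz hw => simp only [map_add, hz, hw, smul_add]
    refine ⟨fun x i y z => ?_, fun x i h y => ?_⟩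
    · induction i using Fin.cases with
      | zero => simp only [Fin.tail_update_zero, Function.update_self, h2]
      | succ i =>
        simp only [Fin.tail_update_succ, f.map_add, map_add,
          Function.update_of_ne (Fin.succ_ne_zero i).symm]
    · induction i using Fin.cases with
      | zero => simp only [Fin.tail_update_zero, Function.update_self, h3]
      | succ i =>
        simp only [Fin.tail_update_succ, f.map_smul, h1, emb_single,
          Function.update_of_ne (Fin.succ_ne_zero i).symm]⟩
  map_add' f g := PHom.ext (funext fun x => map_add (β.insR (x 0)) _ _)
  map_smul' c f := PHom.ext (funext fun x => map_smul (β.insR (x 0)) _ _)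

/-- The opposite operation `(b, a) ↦ ((12) ⊗_H id) β(a, b)`. -/
def flip [Coalgebra.IsCocomm k H] (β : PBil k H A B N) : PBil k H B A N :=
  ⟨fun b a => PT.perm (Equiv.swap 0 1) (β.1 a b), by
    refine ⟨fun a a' b => ?_, fun a b b' => ?_, fun h a b => ?_, fun h a b => ?_⟩
    · simp only [β.add_right, map_add]
    · simp only [β.add_left, map_add]
    · simp only
      rw [β.smul_right, PT.perm, PT.pull_smul, permPow_single, Equiv.swap_apply_right]
    · simp only
      rw [β.smul_left, PT.perm, PT.pull_smul, permPow_single, Equiv.swap_apply_left]⟩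

/-- `(a', b') ↦ (id ⊗_H w) β(u a', v b')`, for `H`-linear maps `u`, `v`, `w`. -/
def comp {A' B' N' : Type*} [AddCommGroup A'] [Module H A'] [AddCommGroup B'] [Module H B']
    [AddCommGroup N'] [Module k N'] [Module H N'] [IsScalarTower k H N'] (β : PBil k H A B N)
    (u : A' →ₗ[H] A) (v : B' →ₗ[H] B) (w : N →ₗ[H] N') : PBil k H A' B' N' :=
  ⟨fun a b => PT.map w (β.1 (u a) (v b)), by
    refine ⟨fun a a' b => ?_, fun a b b' => ?_, fun h a b => ?_, fun h a b => ?_⟩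
    · simp only [map_add, β.add_left]
    · simp only [map_add, β.add_right]
    · simp only [map_smul, β.smul_left, PT.map_smul']
    · simp only [map_smul, β.smul_right, PT.map_smul']⟩

/-- An operation on a single module, as a function of a pair of variables. -/
def toPHom (β : PBil k H A A N) : PHom k H 2 A N :=
  ⟨fun x => β.1 (x 0) (x 1), by
    refine ⟨fun x i y z => ?_, fun x i h y => ?_⟩
    · fin_cases i
      · simp [β.add_left]
      · simp [β.add_right]
    · fin_cases i
      · simp [β.smul_left]
      · simp [β.smul_right]⟩

end PBil

end Operations

section Operations
variable {k H : Type*} [Field k] [Ring H] [HopfAlgebra k H]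
variable {L M L' M' : Type*} [AddCommGroup L] [Module k L] [Module H L] [IsScalarTower k H L]
  [AddCommGroup M] [Module k M] [Module H M] [IsScalarTower k H M]
  [AddCommGroup L'] [Module k L'] [Module H L'] [IsScalarTower k H L']
  [AddCommGroup M'] [Module k M'] [Module H M'] [IsScalarTower k H M']

namespace PHom

/-- `(id ⊗_H w) f(u x₁, …, u x_p)`, for `H`-linear maps `u` and `w`. -/
def comp {p : ℕ} (u : L' →ₗ[H] L) (w : M →ₗ[H] M') : PHom k H p L M →ₗ[k] PHom k H p L' M' where
  toFun f := ⟨fun x => PT.map w (f.1 fun i => u (x i)), by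
    have key : ∀ (x : Fin p → L') (i : Fin p) (y : L'), (fun j => u (Function.update x i y j)) =
        Function.update (fun j => u (x j)) i (u y) :=
      fun x i y => Function.comp_update u x i y
    refine ⟨fun x i y z => ?_, fun x i h y => ?_⟩
    · simp only [key, _root_.map_add, f.map_add]
    · simp only [key, _root_.map_smul, f.map_smul, PT.map_smul']⟩
  map_add' f g := PHom.ext (funext fun x => _root_.map_add (PT.map w) _ _)
  map_smul' c f := PHom.ext (funext fun x => _root_.map_smul (PT.map w) _ _)

/-- An `H`-linear map `L → M`, seen as an operation of one variable with values in
`H ⊗_H M = M`. -/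
def ofLinearMap (u : L →ₗ[H] M) : PHom k H 1 L M :=
  ⟨fun x => PT.mk 1 (u (x 0)), by
    refine ⟨fun x i y z => ?_, fun x i h y => ?_⟩
    · obtain rfl : i = 0 := Subsingleton.elim _ _
      simp only [Function.update_self, _root_.map_add, PT.mk_add_right]
    · obtain rfl : i = 0 := Subsingleton.elim _ _
      simp only [Function.update_self, _root_.map_smul]
      rw [← PT.mk_coprod, coprod_one, PT.smul_mk, one_mul, mul_one]⟩

variable (k H L M) in
/-- An element `u` of `M`, seen as the operation `1 ⊗_H u` of no variables. -/
def ofElem : M →ₗ[k] PHom k H 0 L M where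
  toFun u := ⟨fun _ => PT.mk 1 u, ⟨fun _ i => i.elim0, fun _ i => i.elim0⟩⟩
  map_add' u v := PHom.ext (funext fun _ => PT.mk_add_right 1 u v)
  map_smul' c u := PHom.ext (funext fun _ => PT.mk_smul_right c 1 u)

end PHom

variable [Coalgebra.IsCocomm k H]

variable (k H) in
/-- The space `C^p(L, M)` of skew-symmetric operations,
`f(x₁, …, x_p) = (-1)^σ (σ ⊗_H id) f(x_{σ(1)}, …, x_{σ(p)})`. -/
def Alt (p : ℕ) (L M : Type*) [AddCommGroup L] [Module k L] [Module H L] [IsScalarTower k H L]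
    [AddCommGroup M] [Module k M] [Module H M] [IsScalarTower k H M] :
    Submodule k (PHom k H p L M) where
  carrier := {f | ∀ σ : Equiv.Perm (Fin p),
    f = (Equiv.Perm.sign σ : ℤ) • PHom.permAct σ f}
  add_mem' {f g} hf hg := fun σ => by
    rw [map_add, smul_add, ← hf σ, ← hg σ]
  zero_mem' := fun σ => by rw [map_zero, smul_zero]
  smul_mem' c f hf := fun σ => by
    rw [map_smul, smul_comm, ← hf σ]

/-- `β` is a Lie pseudobracket on `L`: it is skew-symmetric and satisfies the Jacobi identity
`[x * [y * z]] = [[x * y] * z] + ((12) ⊗_H id) [y * [x * z]]` in `H^{⊗ 3} ⊗_H L`. -/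
structure IsLieBracket (β : PBil k H L L L) : Prop where
  skew : ∀ x y, β.1 x y = -PT.perm (Equiv.swap 0 1) (β.1 y x)
  jacobi : ∀ x y z, β.insR x (β.1 y z) = β.insL z (β.1 x y) +
    PT.perm (Equiv.swap (0 : Fin 3) 1) (β.insR y (β.1 x z))

/-- `ρ` is a representation on `M` of the pseudobracket `β` on `L`:
`[x * y] * v = x * (y * v) - ((12) ⊗_H id) (y * (x * v))` in `H^{⊗ 3} ⊗_H M`. -/
def IsRep (β : PBil k H L L L) (ρ : PBil k H L M M) : Prop :=
  ∀ x y v, ρ.insL v (β.1 x y) = ρ.insR x (ρ.1 y v) -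
    PT.perm (Equiv.swap (0 : Fin 3) 1) (ρ.insR y (ρ.1 x v))

/-- `σ(1) < ⋯ < σ(q)` and `σ(q + 1) < ⋯ < σ(n)`. -/
def IsShuffle {n : ℕ} (q : ℕ) (σ : Equiv.Perm (Fin n)) : Prop :=
  ∀ i j : Fin n, i < j → ((j : ℕ) < q ∨ q ≤ (i : ℕ)) → σ i < σ j

instance {n : ℕ} (q : ℕ) : DecidablePred (IsShuffle (n := n) q) :=
  fun _ => inferInstanceAs (Decidable (∀ _ _, _ → _ → _))

/-- The circle product of `f` of `p` and `g` of `q` variables, of `n = p + q - 1` variables: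
the sum of `(-1)^σ (σ ⊗_H id) f(g(x_{σ(1)}, …, x_{σ(q)}), x_{σ(q+1)}, …, x_{σ(n)})` over the
`(q, p - 1)`-shuffles `σ`. There are none of these if `p = 0`. -/
def circ : ∀ {p q n : ℕ} (_ : n + 1 = p + q),
    PHom k H p L L →ₗ[k] PHom k H q L L →ₗ[k] PHom k H n L L
  | 0, _, _, _ => 0
  | p + 1, q, n, hn => ∑ σ : Equiv.Perm (Fin n) with IsShuffle q σ,
      (Equiv.Perm.sign σ : ℤ) • (PHom.compL (k := k) (H := H) (L := L) (M := L) (q := q) (p := p)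
        (n := n) (by omega)).compr₂ (PHom.permAct σ)

/-- The Nijenhuis–Richardson bracket `f ⊚ g - (-1)^{(p - 1)(q - 1)} g ⊚ f`. -/
def nr {p q n : ℕ} (hn : n + 1 = p + q) :
    PHom k H p L L →ₗ[k] PHom k H q L L →ₗ[k] PHom k H n L L :=
  circ hn - (-1 : ℤ) ^ ((p + 1) * (q + 1)) •
    (circ (k := k) (H := H) (L := L) (hn.trans (Nat.add_comm p q))).flip

/-- The Chevalley–Eilenberg operator of a pseudobracket `β` on `L` with coefficients in `(M, ρ)`:
`(d f)(x₁, …, x_{p+1}) = ∑ᵢ (-1)^{i+1} ρ(xᵢ, f(x₁, …, x̂ᵢ, …, x_{p+1}))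
  + ∑_{i<j} (-1)^{i+j} f(β(xᵢ, xⱼ), x₁, …, x̂ᵢ, …, x̂ⱼ, …, x_{p+1})`,
where the tensor factors of each term are permuted into the order `x₁, …, x_{p+1}`.
In the code the positions count from `0`, and the pair is `xᵢ, x_{j+1}` with `i ≤ j`; the
permutation `(cycleRange i)⁻¹` lists the positions in the order `i, 0, 1, …` without repetition. -/
def ceDiff (β : PBil k H L L L) (ρ : PBil k H L M M) : ∀ p : ℕ,
    PHom k H p L M →ₗ[k] PHom k H (p + 1) L M
  | 0 => ρ.compR
  | p + 1 =>
    ∑ i : Fin (p + 2), (-1 : ℤ) ^ (i : ℕ) •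
      (PHom.permAct (Fin.cycleRange i)⁻¹ ∘ₗ ρ.compR) +
    ∑ i : Fin (p + 2), ∑ j : Fin (p + 1), if i ≤ j.castSucc then
      (-1 : ℤ) ^ ((i : ℕ) + j + 1) •
        (PHom.permAct ((Fin.cycleRange i)⁻¹ *
            Equiv.Perm.decomposeFin.symm (0, (Fin.cycleRange j)⁻¹)) ∘ₗ
          (PHom.compL (p := p) (Nat.add_comm 2 p)).flip β.toPHom)
      else 0

section Cohomology
variable (δ : ∀ p : ℕ, PHom k H p L M →ₗ[k] PHom k H (p + 1) L M)

/-- The differential on `C^0(L, M) = M`. -/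
def diffZero : M →ₗ[k] PHom k H 1 L M := δ 0 ∘ₗ PHom.ofElem k H L M

/-- The cocycles in `C^0(L, M) = M`. -/
def cocyclesZero : Submodule k M := LinearMap.ker (diffZero δ)

/-- The cocycles in `C^{p+1}(L, M)`. -/
def cocycles (p : ℕ) : Submodule k (PHom k H (p + 1) L M) :=
  Alt k H (p + 1) L M ⊓ LinearMap.ker (δ (p + 1))

/-- The coboundaries in `C^{p+1}(L, M)`. -/
def coboundaries : ∀ p : ℕ, Submodule k (PHom k H (p + 1) L M)
  | 0 => LinearMap.range (diffZero δ)
  | p + 1 => (Alt k H (p + 1) L M).map (δ (p + 1))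

/-- The cohomology in degree `p + 1`; the cohomology in degree `0` is `cocyclesZero`. -/
abbrev Cohomology (p : ℕ) : Type _ :=
  ↥(cocycles δ p) ⧸ (coboundaries δ p).submoduleOf (cocycles δ p)

end Cohomology

end Operations

section QuasiTwilled
variable (k H g h : Type*) [Field k] [Ring H] [HopfAlgebra k H] [Coalgebra.IsCocomm k H]
  [AddCommGroup g] [Module k g] [Module H g] [IsScalarTower k H g]
  [AddCommGroup h] [Module k h] [Module H h] [IsScalarTower k H h]

/-- A quasi-twilled Lie pseudoalgebra: a Lie pseudobracket `Ω` on the direct sum of two left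
`H`-modules `g` and `h`, of which `h` is a subpseudoalgebra. -/
structure QuasiTwilled where
  /-- The pseudobracket on the direct sum. -/
  Ω : PBil k H (g × h) (g × h) (g × h)
  isLie : IsLieBracket Ω
  sub : ∀ u v : h, Ω.1 (0, u) (0, v) ∈ LinearMap.range (PT.map (k := k) (n := 2)
    (LinearMap.inr H g h))

variable {k H g h}

namespace QuasiTwilled
variable (Q : QuasiTwilled k H g h)

/-- The component `g ⊗ g → H^{⊗ 2} ⊗_H g` of `Ω`. -/
def π : PBil k H g g g :=
  Q.Ω.comp (LinearMap.inl H g h) (LinearMap.inl H g h) (LinearMap.fst H g h)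

/-- The component `g ⊗ g → H^{⊗ 2} ⊗_H h` of `Ω`. -/
def θ : PBil k H g g h :=
  Q.Ω.comp (LinearMap.inl H g h) (LinearMap.inl H g h) (LinearMap.snd H g h)

/-- The component `g ⊗ h → H^{⊗ 2} ⊗_H g` of `Ω`. -/
def η : PBil k H g h g :=
  Q.Ω.comp (LinearMap.inl H g h) (LinearMap.inr H g h) (LinearMap.fst H g h)

/-- The component `g ⊗ h → H^{⊗ 2} ⊗_H h` of `Ω`. -/
def ρ : PBil k H g h h :=
  Q.Ω.comp (LinearMap.inl H g h) (LinearMap.inr H g h) (LinearMap.snd H g h)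

/-- The component `h ⊗ h → H^{⊗ 2} ⊗_H h` of `Ω`, which is the pseudobracket of `h`. -/
def μ : PBil k H h h h :=
  Q.Ω.comp (LinearMap.inr H g h) (LinearMap.inr H g h) (LinearMap.snd H g h)

/-- `D` is a deformation map of type I. -/
def IsDMap (D : g →ₗ[H] h) : Prop :=
  ∀ x y, PT.map D (Q.π.1 x y + Q.η.1 x (D y) - PT.perm (Equiv.swap 0 1) (Q.η.1 y (D x))) =
    Q.μ.1 (D x) (D y) + Q.ρ.1 x (D y) - PT.perm (Equiv.swap 0 1) (Q.ρ.1 y (D x)) + Q.θ.1 x y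

/-- `π^D(x, y) = π(x, y) + η(x, D y) - ((12) ⊗_H id) η(y, D x)`. -/
def piD (D : g →ₗ[H] h) : PBil k H g g g :=
  Q.π + Q.η.comp LinearMap.id D LinearMap.id - (Q.η.comp LinearMap.id D LinearMap.id).flip

/-- `ρ^D(x, v) = ρ(x, v) + μ(D x, v) - (id ⊗_H D) η(x, v)`. -/
def rhoD (D : g →ₗ[H] h) : PBil k H g h h :=
  Q.ρ + Q.μ.comp D LinearMap.id LinearMap.id - Q.η.comp LinearMap.id LinearMap.id D

/-- The lift of `π` to the direct sum. -/
def piHat : PHom k H 2 (g × h) (g × h) :=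
  (Q.π.comp (LinearMap.fst H g h) (LinearMap.fst H g h) (LinearMap.inl H g h)).toPHom

/-- The lift of `μ` to the direct sum. -/
def muHat : PHom k H 2 (g × h) (g × h) :=
  (Q.μ.comp (LinearMap.snd H g h) (LinearMap.snd H g h) (LinearMap.inr H g h)).toPHom

/-- The lift of `ρ`, `((x, u), (y, v)) ↦ (0, ρ(x, v) - ((12) ⊗_H id) ρ(y, u))`. -/
def rhoHat : PHom k H 2 (g × h) (g × h) :=
  (Q.ρ.comp (LinearMap.fst H g h) (LinearMap.snd H g h) (LinearMap.inr H g h) -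
    (Q.ρ.comp (LinearMap.fst H g h) (LinearMap.snd H g h) (LinearMap.inr H g h)).flip).toPHom

/-- The lift of `η`, `((x, u), (y, v)) ↦ (η(x, v) - ((12) ⊗_H id) η(y, u), 0)`. -/
def etaHat : PHom k H 2 (g × h) (g × h) :=
  (Q.η.comp (LinearMap.fst H g h) (LinearMap.snd H g h) (LinearMap.inl H g h) -
    (Q.η.comp (LinearMap.fst H g h) (LinearMap.snd H g h) (LinearMap.inl H g h)).flip).toPHom

end QuasiTwilled

variable (k H g h) in
/-- The lift `f̂((x₁, u₁), …, (x_p, u_p)) = (0, f(x₁, …, x_p))` of `f : g^{⊗ p} → H^{⊗ p} ⊗_H h`. -/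
def liftG (p : ℕ) : PHom k H p g h →ₗ[k] PHom k H p (g × h) (g × h) :=
  PHom.comp (LinearMap.fst H g h) (LinearMap.inr H g h)

variable (k H g h) in
/-- The projection of an operation on `g ⊞ h` to its component `g^{⊗ p} → H^{⊗ p} ⊗_H h`. -/
def projG (p : ℕ) : PHom k H p (g × h) (g × h) →ₗ[k] PHom k H p g h :=
  PHom.comp (LinearMap.inl H g h) (LinearMap.snd H g h)

namespace QuasiTwilled
variable (Q : QuasiTwilled k H g h)

/-- The Nijenhuis–Richardson bracket `[π + ρ, f]` on `g ⊞ h`. -/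
def bracketOne (p : ℕ) : PHom k H p g h →ₗ[k] PHom k H (p + 1) (g × h) (g × h) :=
  nr (p := 2) (q := p) (by omega) (Q.piHat + Q.rhoHat) ∘ₗ liftG k H g h p

/-- The iterated Nijenhuis–Richardson bracket `[[μ + η, f], f']` on `g ⊞ h`. -/
def bracketTwo {q p n : ℕ} (hn : n = q + p) : PHom k H q g h →ₗ[k] PHom k H p g h →ₗ[k]
    PHom k H n (g × h) (g × h) :=
  (nr (p := q + 1) (q := p) (by omega)).compl₁₂
    (nr (p := 2) (q := q) (by omega) (Q.muHat + Q.etaHat) ∘ₗ liftG k H g h q) (liftG k H g h p)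

/-- `l₁(f)`, the component of `[π + ρ, f]` in `C^*(g, h)`. -/
def l₁ (p : ℕ) : PHom k H p g h →ₗ[k] PHom k H (p + 1) g h :=
  projG k H g h (p + 1) ∘ₗ Q.bracketOne p

/-- `l₂(f, f')`, the component of `[[μ + η, f], f']` in `C^*(g, h)`. -/
def l₂ {q p n : ℕ} (hn : n = q + p) : PHom k H q g h →ₗ[k] PHom k H p g h →ₗ[k]
    PHom k H n g h :=
  (Q.bracketTwo hn).compr₂ (projG k H g h n)

/-- The twisted differential `l₁^D(f) = l₁(f) + l₂(D, f)`. -/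
def l₁D (D : g →ₗ[H] h) (p : ℕ) : PHom k H p g h →ₗ[k] PHom k H (p + 1) g h :=
  Q.l₁ p + Q.l₂ (Nat.add_comm p 1) (PHom.ofLinearMap D)

end QuasiTwilled
end QuasiTwilled

end LiePseudo
end

/-! The deformation equation says that the graph of `D` is a subpseudoalgebra of the direct sum. The
shear `(x, u) ↦ (x, u + D x)` carries `g` onto the graph and fixes `h`. So for the transported
bracket `twist D` the summand `g` is a subpseudoalgebra: its bracket is `π^D` (`piD_eq`), and its
action on the quotient by `g`, identified with `h`, is `ρ^D` (`rhoD_eq`). Part 1 is then the general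
fact that a subpseudoalgebra is a Lie pseudoalgebra and acts on the quotient
(`isLieBracket_component`, `isRep_component`).

For Part 2, let `β` and `ρ` be any two operations. In the Nijenhuis–Richardson bracket of
`semidirect β ρ` with a lifted cochain, the `(p, 1)`-shuffles choose the variable that acts through
`ρ`, and the `(2, p - 1)`-shuffles choose the pair that enters `β`. The bracket is therefore the
Chevalley–Eilenberg operator up to a sign (`nr_semidirect`), with no Jacobi identity involved. Now
`π + ρ` is such a semidirect product, and `[μ + η, D]` is the semidirect product of the differences
`π^D - π` and `ρ^D - ρ` (`nr_muHat_add_etaHat`). By additivity the twisted differential is the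
bracket with the semidirect product of `π^D` and `ρ^D` (`l₁D_eq`).

For Part 3, a Lie pseudobracket and a representation make the semidirect product a Lie pseudobracket
`B`, and `[B, [B, f]] = 0` for skew-symmetric `f` (`IsCyclicJacobi.nr_nr`). In characteristic `0`
the circle products of skew-symmetric operations are antisymmetrized compositions divided by
factorials. What is left to know is that nested insertions associate (`compL_assoc`), that
insertions in different slots commute (`compL_parallel`), and the Jacobi identity. The sign in Part
2 does not affect kernels or images.

The laws of composition rest on cocommutativity: it makes `H^{⊗ n}` a contravariant functor of the
set of positions (`delta`, `delta_delta`). Permuting factors, expanding by a coproduct and applying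
a counit are all values of this functor, so identities between coefficients reduce to identities
between maps of finite sets. -/

noncomputable section
set_option linter.unusedSectionVars false
namespace LiePseudo

/-! ### Iterated coproducts as a functor of the set of positions -/

section Spread
variable {k H : Type*} [Field k] [Ring H] [HopfAlgebra k H]

/-- Composition with an algebra map, on convolution algebras. -/
def cvHom {S S' : Type*} [Semiring S] [Algebra k S] [Semiring S'] [Algebra k S']
    (g : S →ₐ[k] S') : WithConv (H →ₗ[k] S) →* WithConv (H →ₗ[k] S') where
  toFun f := WithConv.toConv (g.toLinearMap ∘ₗ f.ofConv)
  map_one' := by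
    apply WithConv.ofConv_injective
    ext h
    simp [LinearMap.convOne_def]
  map_mul' f f' := congrArg WithConv.toConv (LinearMap.algHom_comp_convMul_distrib g f f')

lemma cvHom_cv {S S' : Type*} [Semiring S] [Algebra k S] [Semiring S'] [Algebra k S']
    (g : S →ₐ[k] S') (f : H →ₐ[k] S) : cvHom g (cv f) = cv (g.comp f) := rfl

lemma emb_emb {p q n : ℕ} (i : Fin p → Fin q) (hi : Function.Injective i) (j : Fin q → Fin n)
    (hj : Function.Injective j) (x : TPow k H p) :
    emb j hj (emb i hi x) = emb (j ∘ i) (hj.comp hi) x :=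
  DFunLike.congr_fun (f := (emb j hj).comp (emb i hi)) (g := emb (j ∘ i) (hj.comp hi))
    (hom_ext fun i a => by simp) x

lemma commute_emb_emb {p q n : ℕ} (i : Fin p → Fin n) (hi : Function.Injective i)
    (j : Fin q → Fin n) (hj : Function.Injective j) (hij : ∀ a b, i a ≠ j b)
    (x : TPow k H p) (y : TPow k H q) : Commute (emb i hi x) (emb j hj y) :=
  commute_of_single _ _ (fun a u => (commute_of_single _ _ (fun b v => by
    rw [emb_single, emb_single]; exact single_commute (hij a b).symm v u) y).symm) x

variable [Coalgebra.IsCocomm k H]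

/-- Commuting images turn `f(h₁) g(h₂)` into `g(h₂) f(h₁)`, and cocommutativity exchanges the two
legs. This is what allows convolution products over unordered sets of positions. -/
lemma commute_cv {S : Type*} [Semiring S] [Algebra k S] {f g : H →ₐ[k] S}
    (h : ∀ a b, Commute (f a) (g b)) : Commute (cv f) (cv g) := by
  apply WithConv.ofConv_injective
  ext x
  have aux : ∀ z : H ⊗[k] H, LinearMap.mul' k S
      (TensorProduct.map f.toLinearMap g.toLinearMap z) =
      LinearMap.mul' k S (TensorProduct.map g.toLinearMap f.toLinearMap
        (TensorProduct.comm k H H z)) := by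
    intro z
    induction z with
    | zero => simp
    | tmul a b => exact (h a b).eq
    | add z w hz hw => simp only [map_add, hz, hw]
  refine (aux _).trans ?_
  rw [Coalgebra.comm_comul]
  rfl

lemma commute_cv_single {n : ℕ} {i j : Fin n} (hij : i ≠ j) :
    Commute (cv (single (k := k) (H := H) i)) (cv (single j)) :=
  commute_cv (single_commute hij)

/-- The convolution product of the inclusions of `H` in the positions of `S`. -/
def convProd {n : ℕ} (S : Finset (Fin n)) : WithConv (H →ₗ[k] TPow k H n) :=
  S.noncommProd (fun i => cv (single i)) fun _ _ _ _ h => commute_cv_single h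

lemma convProd_empty (n : ℕ) : convProd (k := k) (H := H) (∅ : Finset (Fin n)) = 1 :=
  Finset.noncommProd_empty _ _

lemma convProd_insert {n : ℕ} {S : Finset (Fin n)} {i : Fin n} (hi : i ∉ S) :
    convProd (k := k) (H := H) (insert i S) = cv (single i) * convProd S :=
  Finset.noncommProd_insert_of_notMem _ _ _ _ hi

lemma convProd_union {n : ℕ} {S T : Finset (Fin n)} (h : Disjoint S T) :
    convProd (k := k) (H := H) (S ∪ T) = convProd S * convProd T :=
  Finset.noncommProd_union_of_disjoint h _ _

/-- The right side depends only on the image of `j`, so a coproduct placed along an injection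
forgets the order of the positions. The induction peels off the first factor. -/
lemma cv_emb_coprod {n : ℕ} : ∀ {q : ℕ} (j : Fin q → Fin n) (hj : Function.Injective j),
    cv ((emb j hj).comp (coprod q)) = convProd (k := k) (H := H) (Finset.univ.image j)
  | 0, j, hj => by
    have : ((emb j hj).comp (coprod 0) : H →ₐ[k] TPow k H n) =
        (Algebra.ofId k _).comp (Bialgebra.counitAlgHom k H) := by
      ext h; simp [coprod, Algebra.ofId_apply]
    rw [this, cv_ofId]
    simp [convProd]
  | q + 1, j, hj => by
    have h0 : j 0 ∉ Finset.univ.image (j ∘ Fin.succ) := by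
      simp [hj.eq_iff, Fin.succ_ne_zero]
    have hu : Finset.univ.image j = insert (j 0) (Finset.univ.image (j ∘ Fin.succ)) := by
      ext x; simp [Fin.exists_fin_succ, eq_comm]
    rw [hu, convProd_insert h0, cv_comp _ (cv_coprod_succ q),
      ← cv_emb_coprod (j ∘ Fin.succ) (hj.comp (Fin.succ_injective q))]
    refine congrArg₂ (· * ·) (congrArg cv ?_) (congrArg cv ?_)
    · ext a; simp
    · ext a; exact emb_emb _ (Fin.succ_injective q) _ hj _

/-- The iterated coproduct, spread over the positions of `S`. -/
def spread {n : ℕ} (S : Finset (Fin n)) : H →ₐ[k] TPow k H n :=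
  (emb (S.orderEmbOfFin rfl) (S.orderEmbOfFin rfl).injective).comp (coprod S.card)

lemma cv_spread {n : ℕ} (S : Finset (Fin n)) :
    cv (spread (k := k) (H := H) S) = convProd S := by
  rw [spread, cv_emb_coprod]
  congr 1
  apply Finset.coe_injective
  simp

lemma emb_coprod {q n : ℕ} (j : Fin q → Fin n) (hj : Function.Injective j) (a : H) :
    emb j hj (coprod (k := k) q a) = spread (Finset.univ.image j) a :=
  DFunLike.congr_fun (f := (emb j hj).comp (coprod q)) (g := spread (Finset.univ.image j))
    (cv_inj (by rw [cv_emb_coprod, cv_spread])) a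

lemma emb_id {n : ℕ} (h : Function.Injective (id : Fin n → Fin n)) :
    emb (k := k) (H := H) id h = AlgHom.id k _ :=
  hom_ext fun i a => by simp

lemma spread_univ (n : ℕ) : spread (k := k) (H := H) (Finset.univ : Finset (Fin n)) = coprod n := by
  ext a
  rw [← Finset.image_id (s := Finset.univ), ← emb_coprod _ Function.injective_id, emb_id]
  rfl

lemma spread_singleton {n : ℕ} (i : Fin n) : spread (k := k) (H := H) {i} = single i := by
  apply cv_inj
  rw [cv_spread]
  simp [convProd]

lemma emb_spread {q n : ℕ} (j : Fin q → Fin n) (hj : Function.Injective j) (S : Finset (Fin q))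
    (a : H) : emb j hj (spread (k := k) S a) = spread (S.image j) a := by
  rw [spread, AlgHom.comp_apply, emb_emb, emb_coprod]
  congr 2
  rw [← Finset.image_image]
  congr 1
  apply Finset.coe_injective
  simp

lemma spread_commute {n : ℕ} {S T : Finset (Fin n)} (h : Disjoint S T) (a b : H) :
    Commute (spread (k := k) S a) (spread T b) :=
  commute_emb_emb _ (S.orderEmbOfFin rfl).injective _ (T.orderEmbOfFin rfl).injective
    (fun i j hij => Finset.disjoint_left.1 h
    (Finset.orderEmbOfFin_mem S rfl i) (by
      have := Finset.orderEmbOfFin_mem T rfl j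
      rwa [← hij] at this)) _ _

/-- The algebra map `H^{⊗ n} → H^{⊗ n'}` that spreads the `i`-th factor, by the iterated coproduct,
over the positions that `φ` sends to `i`. -/
def delta {n n' : ℕ} (φ : Fin n' → Fin n) : TPow k H n →ₐ[k] TPow k H n' :=
  lift (fun i => spread {m | φ m = i}) fun i j hij a b => spread_commute (by
    rw [Finset.disjoint_left]
    intro m hm hm'
    simp only [Finset.mem_filter, Finset.mem_univ, true_and] at hm hm'
    exact hij (hm.symm.trans hm')) a b

lemma delta_single {n n' : ℕ} (φ : Fin n' → Fin n) (i : Fin n) (a : H) :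
    delta (k := k) φ (single i a) = spread {m | φ m = i} a := by
  simp only [delta, lift_single]

/-- In the convolution algebra `spread S` is a product over `S`, and composing with `delta φ` is
multiplicative. This reduces the claim to singletons, since the preimages of disjoint sets are
disjoint. -/
lemma delta_spread {n n' : ℕ} (φ : Fin n' → Fin n) (S : Finset (Fin n)) (a : H) :
    delta (k := k) φ (spread S a) = spread {m | φ m ∈ S} a := by
  have key : ∀ S : Finset (Fin n), cvHom (delta (k := k) (H := H) φ) (convProd S) =
      convProd {m | φ m ∈ S} := by
    intro S
    induction S using Finset.induction_on with
    | empty => simp [convProd_empty]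
    | insert i S hi ih =>
      have h1 : cv ((delta φ).comp (single i) : H →ₐ[k] TPow k H n') =
          convProd {m | φ m = i} := by
        rw [← cv_spread]
        congr 1
        ext a
        exact delta_single φ i a
      have h2 : ({m | φ m ∈ insert i S} : Finset (Fin n')) =
          ({m | φ m = i} : Finset (Fin n')) ∪ ({m | φ m ∈ S} : Finset (Fin n')) := by
        ext m; simp
      rw [convProd_insert hi, map_mul, ih, cvHom_cv, h1, h2, convProd_union]
      rw [Finset.disjoint_left]
      intro m hm hm'
      simp only [Finset.mem_filter, Finset.mem_univ, true_and] at hm hm'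
      exact hi (hm ▸ hm')
  refine DFunLike.congr_fun (f := (delta φ).comp (spread S))
    (g := spread ({m | φ m ∈ S} : Finset (Fin n'))) (cv_inj ?_) a
  rw [← cvHom_cv, cv_spread, cv_spread, key]

lemma delta_coprod {n n' : ℕ} (φ : Fin n' → Fin n) (a : H) :
    delta (k := k) φ (coprod n a) = coprod n' a := by
  rw [← spread_univ, delta_spread, ← spread_univ]
  simp

/-- Functoriality, contravariant in the positions; on a generator it is `delta_spread` for a fibre
of `φ`. -/
lemma delta_delta {n n' n'' : ℕ} (φ : Fin n' → Fin n) (ψ : Fin n'' → Fin n')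
    (x : TPow k H n) : delta (k := k) ψ (delta φ x) = delta (φ ∘ ψ) x :=
  DFunLike.congr_fun (f := (delta ψ).comp (delta φ)) (g := delta (φ ∘ ψ))
    (hom_ext fun i a => by
      rw [AlgHom.comp_apply, delta_single, delta_spread, delta_single]
      simp) x

/-- `delta` commutes with the insertions of `1`, for pullback squares of positions. -/
lemma delta_emb {q n q' n' : ℕ} (φ : Fin n' → Fin n) (j : Fin q → Fin n)
    (hj : Function.Injective j) (ψ : Fin q' → Fin q) (j' : Fin q' → Fin n')
    (hj' : Function.Injective j') (h : ∀ m i, φ m = j i ↔ ∃ m', j' m' = m ∧ ψ m' = i)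
    (x : TPow k H q) : delta (k := k) φ (emb j hj x) = emb j' hj' (delta ψ x) :=
  DFunLike.congr_fun (f := (delta φ).comp (emb j hj)) (g := (emb j' hj').comp (delta ψ))
    (hom_ext fun i a => by
      rw [AlgHom.comp_apply, AlgHom.comp_apply, emb_single, delta_single, delta_single, emb_spread]
      congr 2
      ext m
      simp only [Finset.mem_filter, Finset.mem_univ, true_and, Finset.mem_image, h, and_comm]) x

/-- The inverse appears because `delta` is indexed by the map from new positions to old ones, while
`permPow σ` sends old positions to new ones. -/
lemma permPow_eq_delta {n : ℕ} (σ : Equiv.Perm (Fin n)) :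
    permPow (k := k) (H := H) σ = delta σ.symm :=
  hom_ext fun i a => by
    rw [permPow_single, delta_single, ← spread_singleton]
    congr 2
    ext m
    simp [Equiv.symm_apply_eq]

/-- Position of the block in which the position `i` lies, the first block counting as one. -/
def collapseL (q : ℕ) {p n : ℕ} (hn : q + p = n) (i : Fin n) : Fin (p + 1) :=
  -- The truncated subtraction sends the whole first block to `0`. If `q = 0`, the value `0` is not
  -- attained, which corresponds to the counit in that factor.
  ⟨(i : ℕ) + 1 - q, by omega⟩

lemma expandL_eq_delta {q p n : ℕ} (hn : q + p = n) :
    expandL (k := k) (H := H) hn = delta (collapseL q hn) :=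
  hom_ext fun i a => by
    rw [delta_single, expandL, lift_single]
    induction i using Fin.cases with
    | zero =>
      simp only [Fin.cases_zero, AlgHom.comp_apply, emb_coprod]
      congr 2
      ext m
      simp only [Finset.mem_image, Finset.mem_univ, true_and, Finset.mem_filter, Fin.ext_iff,
        blockL, collapseL, Fin.val_zero]
      exact ⟨fun ⟨i, hi⟩ => by omega, fun h => ⟨⟨m, by omega⟩, rfl⟩⟩
    | succ i =>
      simp only [Fin.cases_succ, ← spread_singleton]
      congr 2
      ext m
      simp only [Finset.mem_singleton, Finset.mem_filter, Finset.mem_univ, true_and, Fin.ext_iff,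
        blockR, collapseL, Fin.val_succ]
      omega

lemma expandR_eq_delta (q : ℕ) :
    expandR (k := k) (H := H) q = delta (Fin.cases 0 fun _ => 1) :=
  hom_ext fun i a => by
    rw [delta_single, expandR, lift_single]
    induction i using Fin.cases with
    | zero =>
      simp only [Fin.cases_zero, ← spread_singleton]
      congr 2
      ext m
      induction m using Fin.cases with
      | zero => simp
      | succ m => simp [Fin.succ_ne_zero]
    | succ i =>
      obtain rfl : i = 0 := Subsingleton.elim _ _
      simp only [Fin.cases_succ, AlgHom.comp_apply, emb_coprod]
      congr 2
      ext m
      induction m using Fin.cases with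
      | zero => simp
      | succ m => simp

end Spread

/-! ### Blocks of positions and their permutations -/

section Positions

@[simp] lemma collapseL_blockL {q p n : ℕ} (hn : q + p = n) (i : Fin q) :
    collapseL q hn (blockL hn i) = 0 :=
  Fin.ext (by simp only [collapseL, blockL, Fin.val_zero]; omega)

@[simp] lemma collapseL_blockR {q p n : ℕ} (hn : q + p = n) (i : Fin p) :
    collapseL q hn (blockR hn i) = i.succ :=
  Fin.ext (by simp only [collapseL, blockR, Fin.val_succ]; omega)

lemma funext_block {q p n : ℕ} (hn : q + p = n) {X : Type*} {f g : Fin n → X}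
    (hL : ∀ i, f (blockL hn i) = g (blockL hn i)) (hR : ∀ i, f (blockR hn i) = g (blockR hn i)) :
    f = g := by
  funext i
  obtain ⟨j, rfl⟩ | ⟨j, rfl⟩ := PHom.block_cases hn i
  · exact hL j
  · exact hR j

/-- The permutation `τ × υ` of two consecutive blocks. -/
def blockPerm {q p n : ℕ} (hn : q + p = n) (τ : Equiv.Perm (Fin q)) (υ : Equiv.Perm (Fin p)) :
    Equiv.Perm (Fin n) :=
  (finSumFinEquiv.trans (finCongr hn)).permCongr (τ.sumCongr υ)

lemma blockL_eq {q p n : ℕ} (hn : q + p = n) (i : Fin q) :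
    blockL hn i = (finSumFinEquiv.trans (finCongr hn)) (Sum.inl i) :=
  Fin.ext (by simp [blockL])

lemma blockR_eq {q p n : ℕ} (hn : q + p = n) (i : Fin p) :
    blockR hn i = (finSumFinEquiv.trans (finCongr hn)) (Sum.inr i) :=
  Fin.ext (by simp [blockR])

@[simp] lemma blockPerm_blockL {q p n : ℕ} (hn : q + p = n) (τ : Equiv.Perm (Fin q))
    (υ : Equiv.Perm (Fin p)) (i : Fin q) :
    blockPerm hn τ υ (blockL hn i) = blockL hn (τ i) := by
  rw [blockPerm, blockL_eq, Equiv.permCongr_apply, Equiv.symm_apply_apply, blockL_eq]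
  rfl

@[simp] lemma blockPerm_blockR {q p n : ℕ} (hn : q + p = n) (τ : Equiv.Perm (Fin q))
    (υ : Equiv.Perm (Fin p)) (i : Fin p) :
    blockPerm hn τ υ (blockR hn i) = blockR hn (υ i) := by
  rw [blockPerm, blockR_eq, Equiv.permCongr_apply, Equiv.symm_apply_apply, blockR_eq]
  rfl

lemma sign_blockPerm {q p n : ℕ} (hn : q + p = n) (τ : Equiv.Perm (Fin q))
    (υ : Equiv.Perm (Fin p)) :
    Equiv.Perm.sign (blockPerm hn τ υ) = Equiv.Perm.sign τ * Equiv.Perm.sign υ := by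
  rw [blockPerm, Equiv.Perm.sign_permCongr, Equiv.Perm.sign_sumCongr]

/-- The permutation of `Fin (n + 1)` that fixes `0` and acts as `τ` on the other positions. -/
def consPerm {n : ℕ} (τ : Equiv.Perm (Fin n)) : Equiv.Perm (Fin (n + 1)) :=
  Equiv.Perm.decomposeFin.symm (0, τ)

@[simp] lemma consPerm_zero {n : ℕ} (τ : Equiv.Perm (Fin n)) : consPerm τ 0 = 0 :=
  Equiv.Perm.decomposeFin_symm_apply_zero _ _

@[simp] lemma consPerm_succ {n : ℕ} (τ : Equiv.Perm (Fin n)) (i : Fin n) :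
    consPerm τ i.succ = (τ i).succ := by
  rw [consPerm, Equiv.Perm.decomposeFin_symm_apply_succ, Equiv.swap_self, Equiv.refl_apply]

lemma sign_consPerm {n : ℕ} (τ : Equiv.Perm (Fin n)) :
    Equiv.Perm.sign (consPerm τ) = Equiv.Perm.sign τ := by
  rw [consPerm, Equiv.Perm.decomposeFin.symm_sign]
  simp

lemma consPerm_injective {n : ℕ} : Function.Injective (consPerm (n := n)) := fun σ τ h =>
  Equiv.ext fun i => Fin.succ_injective _ (by rw [← consPerm_succ, h, consPerm_succ])

/-- Cycles are written as case distinctions on natural numbers, so that identities between positions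
fall to linear arithmetic. -/
lemma val_cycleRange_symm {n : ℕ} (i j : Fin (n + 1)) :
    ((Fin.cycleRange i).symm j : ℕ) =
      if (j : ℕ) = 0 then (i : ℕ) else if (j : ℕ) ≤ i then (j : ℕ) - 1 else j := by
  induction j using Fin.cases with
  | zero => simp
  | succ j =>
    rw [Fin.cycleRange_symm_succ, Fin.succAbove]
    simp only [Fin.lt_def, Fin.val_castSucc, Fin.val_succ]
    split_ifs <;> simp only [Fin.val_castSucc, Fin.val_succ] at * <;> grind

lemma val_cycleRange {n : ℕ} (i j : Fin (n + 1)) :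
    (Fin.cycleRange i j : ℕ) =
      if (j : ℕ) < i then (j : ℕ) + 1 else if (j : ℕ) = i then 0 else j := by
  obtain ⟨m, rfl⟩ := (Fin.cycleRange i).symm.surjective j
  rw [Equiv.apply_symm_apply, val_cycleRange_symm]
  have := m.2
  split_ifs <;> omega

lemma val_swap_zero_one {n : ℕ} (j : Fin (n + 1 + 1)) : (Equiv.swap (0 : Fin (n + 1 + 1)) 1 j : ℕ) =
    if (j : ℕ) = 0 then 1 else if (j : ℕ) = 1 then 0 else (j : ℕ) := by
  rw [Equiv.swap_apply_def]
  have h0 : j = 0 ↔ (j : ℕ) = 0 := Fin.ext_iff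
  have h1 : j = 1 ↔ (j : ℕ) = 1 := Fin.ext_iff
  simp only [h0, h1]
  split_ifs <;> rfl

/-- Both sides name the slot of `f` from which a position of the result descends. On the left, a
block of `q` enters the first slot and then a block of `s` the second; on the right, the roles and
the order are exchanged, hence the transposition. There is one case for each of the two blocks and
one for the remaining positions. -/
lemma collapseL_parallel {p q s m m' n : ℕ} (h₁ : q + (p + 1) = m + 1) (h₂ : s + m = n)
    (h₃ : s + (p + 1) = m' + 1) (h₄ : q + m' = n) {i j : Fin n}
    (hσ : (j : ℕ) = if (i : ℕ) < q then s + i else if (i : ℕ) < q + s then i - q else i) :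
    collapseL q h₁ ((Fin.cycleRange ⟨q, by omega⟩).symm (collapseL s h₂ j)) =
      Equiv.swap 0 1 (collapseL s h₃ ((Fin.cycleRange ⟨s, by omega⟩).symm (collapseL q h₄ i))) := by
  refine Fin.ext ?_
  simp only [val_swap_zero_one, collapseL, val_cycleRange_symm]
  have := i.2
  generalize (j : ℕ) = j at *
  generalize (i : ℕ) = i at *
  subst hσ
  rcases lt_or_ge i q with h | h
  · have e1 : i + 1 - q = 0 := by omega
    simp only [h, e1, if_true]
    split_ifs <;> omega
  · rcases lt_or_ge i (q + s) with h' | h'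
    · simp only [h.not_gt, h', if_true, if_false]
      split_ifs <;> omega
    · simp only [h.not_gt, h'.not_gt, if_false]
      split_ifs <;> omega

end Positions

/-! ### The functor on pseudotensors -/

section Delta
variable {k H : Type*} [Field k] [Ring H] [HopfAlgebra k H] [Coalgebra.IsCocomm k H]
variable {M : Type*} [AddCommGroup M] [Module k M] [Module H M]

lemma emb_congr {q n : ℕ} {i j : Fin q → Fin n} {hi : Function.Injective i}
    {hj : Function.Injective j} (h : i = j) (x : TPow k H q) : emb i hi x = emb j hj x := by
  subst h; rfl

lemma delta_id {n : ℕ} (x : TPow k H n) : delta (k := k) (H := H) id x = x :=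
  DFunLike.congr_fun (f := delta id) (g := AlgHom.id k (TPow k H n))
    (hom_ext fun i a => by
      rw [delta_single, AlgHom.id_apply, ← spread_singleton]
      congr 2
      ext m
      simp) x

/-- The case of `delta_emb` in which `φ` is bijective over the image of `j`: no coproduct is applied
to the embedded factors. -/
lemma delta_emb_eq {q n n' : ℕ} (φ : Fin n' → Fin n) (j : Fin q → Fin n)
    (hj : Function.Injective j) (j' : Fin q → Fin n') (hj' : Function.Injective j')
    (h : ∀ m i, φ m = j i ↔ j' i = m) (x : TPow k H q) :
    delta (k := k) φ (emb j hj x) = emb j' hj' x := by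
  rw [delta_emb φ j hj id j' hj' (fun m i => by rw [h]; simp), delta_id]

namespace PT

/-- `delta φ ⊗_H id`. -/
def spread {n n' : ℕ} (φ : Fin n' → Fin n) : PT k H n M →ₗ[k] PT k H n' M :=
  pull (delta φ) (delta_coprod φ)

/-- Serves where two pseudotensors must be expanded simultaneously, as in `PHom.compL_parallel`;
elsewhere induction on one of them is enough. -/
lemma exists_sum {n : ℕ} (z : PT k H n M) :
    ∃ (N : ℕ) (a : Fin N → TPow k H n) (m : Fin N → M), z = ∑ i, mk (a i) (m i) := by
  induction z using induction with
  | hmk a m => exact ⟨1, fun _ => a, fun _ => m, by simp⟩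
  | hadd z w hz hw =>
    obtain ⟨N, a, m, rfl⟩ := hz
    obtain ⟨N', a', m', rfl⟩ := hw
    exact ⟨N + N', Fin.append a a', Fin.append m m', by simp [Fin.sum_univ_add]⟩

lemma spread_congr {n n' : ℕ} {φ ψ : Fin n' → Fin n} (h : φ = ψ) (z : PT k H n M) :
    spread φ z = spread ψ z := by rw [h]

lemma spread_smul {n n' : ℕ} (φ : Fin n' → Fin n) (b : TPow k H n) (z : PT k H n M) :
    spread φ (b • z) = delta φ b • spread φ z := pull_smul _ _ _ _

lemma spread_mk {n n' : ℕ} (φ : Fin n' → Fin n) (b : TPow k H n) (m : M) :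
    spread φ (mk b m) = mk (delta φ b) m := rfl

lemma spread_spread {n n' n'' : ℕ} (φ : Fin n' → Fin n) (ψ : Fin n'' → Fin n')
    (z : PT k H n M) : spread ψ (spread φ z) = spread (φ ∘ ψ) z := by
  induction z using induction with
  | hmk a m => simp only [spread_mk, delta_delta]
  | hadd z w hz hw => simp only [map_add, hz, hw]

/-- Once every change of coefficients is a `spread`, composites are compared through maps of finite
sets. -/
lemma pull_eq_spread {n n' : ℕ} {e : TPow k H n →ₐ[k] TPow k H n'}
    {he : ∀ h, e (coprod n h) = coprod n' h} {φ : Fin n' → Fin n} (h : e = delta φ)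
    (z : PT k H n M) : pull e he z = spread φ z := by
  subst h; rfl

lemma perm_eq_spread {n : ℕ} (σ : Equiv.Perm (Fin n)) (z : PT k H n M) :
    perm σ z = spread σ.symm z := pull_eq_spread (permPow_eq_delta σ) z

lemma perm_smul {n : ℕ} (σ : Equiv.Perm (Fin n)) (b : TPow k H n) (z : PT k H n M) :
    perm σ (b • z) = emb σ σ.injective b • perm σ z := pull_smul _ _ _ _

lemma perm_mk {n : ℕ} (σ : Equiv.Perm (Fin n)) (b : TPow k H n) (m : M) :
    perm σ (mk b m) = mk (emb σ σ.injective b) m := rfl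

lemma perm_perm {n : ℕ} (σ τ : Equiv.Perm (Fin n)) (z : PT k H n M) :
    perm σ (perm τ z) = perm (σ * τ) z := by
  rw [perm_eq_spread, perm_eq_spread, perm_eq_spread, spread_spread]
  rfl

lemma perm_one {n : ℕ} (z : PT k H n M) : perm (1 : Equiv.Perm (Fin n)) z = z := by
  induction z using induction with
  | hmk a m =>
    rw [perm_mk]
    exact congrArg (mk · m) (DFunLike.congr_fun (emb_id Function.injective_id) a)
  | hadd z w hz hw => simp only [map_add, hz, hw]

end PT
end Delta

/-! ### Equivariance, associativity and commutation of compositions -/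

section Composition
variable {k H : Type*} [Field k] [Ring H] [HopfAlgebra k H] [Coalgebra.IsCocomm k H]
variable {L M A B N : Type*} [AddCommGroup L] [Module k L] [Module H L] [IsScalarTower k H L]
  [AddCommGroup M] [Module k M] [Module H M] [IsScalarTower k H M]
  [AddCommGroup A] [Module k A] [Module H A] [IsScalarTower k H A]
  [AddCommGroup B] [Module k B] [Module H B] [IsScalarTower k H B]
  [AddCommGroup N] [Module k N] [Module H N] [IsScalarTower k H N]

namespace PHom

lemma permAct_apply {p : ℕ} (σ : Equiv.Perm (Fin p)) (f : PHom k H p L M) (x : Fin p → L) :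
    (permAct σ f).1 x = PT.perm σ (f.1 (x ∘ σ)) := rfl

lemma permAct_mul {p : ℕ} (σ τ : Equiv.Perm (Fin p)) (f : PHom k H p L M) :
    permAct (σ * τ) f = permAct σ (permAct τ f) :=
  PHom.ext (funext fun x => by
    rw [permAct_apply, permAct_apply, permAct_apply, PT.perm_perm]; rfl)

lemma permAct_one {p : ℕ} (f : PHom k H p L M) : permAct 1 f = f :=
  PHom.ext (funext fun _ => PT.perm_one _)

lemma compL_apply {q p n : ℕ} (hn : q + p = n) (f : PHom k H (p + 1) L M) (g : PHom k H q L L)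
    (x : Fin n → L) : (compL hn f g).1 x =
      f.insL hn (fun j => x (blockR hn j)) (g.1 fun j => x (blockL hn j)) := rfl

lemma insL_mk' {q p n : ℕ} (hn : q + p = n) (f : PHom k H (p + 1) L M) (x : Fin p → L)
    (a : TPow k H q) (y : L) : f.insL hn x (PT.mk a y) =
      emb (blockL hn) (blockL_injective hn) a •
        PT.spread (collapseL q hn) (f.1 (Fin.cons y x)) := by
  rw [insL_mk, PT.pull_eq_spread (expandL_eq_delta hn)]

/-- On `a ⊗_H y` both sides are an embedded copy of `a` times a `spread` of the same value of `f`.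
This leaves one identity between injections and one between maps of positions, both checked block by
block. The other equivariance lemmas follow this pattern. -/
lemma insL_perm {q p n : ℕ} (hn : q + p = n) (f : PHom k H (p + 1) L M) (x : Fin p → L)
    (τ : Equiv.Perm (Fin q)) (z : PT k H q L) :
    f.insL hn x (PT.perm τ z) = PT.perm (blockPerm hn τ 1) (f.insL hn x z) := by
  induction z using PT.induction with
  | hmk a y =>
    rw [PT.perm_mk, insL_mk', insL_mk', PT.perm_smul, PT.perm_eq_spread, PT.spread_spread, emb_emb,
      emb_emb]
    refine congrArg₂ (· • ·) (emb_congr (funext fun i => ?_) a) (PT.spread_congr ?_ _)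
    · simp
    · rw [Equiv.eq_comp_symm]
      exact funext_block hn (fun i => by simp) (fun i => by simp)
  | hadd z w hz hw => simp only [_root_.map_add, hz, hw]

lemma compL_permAct_right {q p n : ℕ} (hn : q + p = n) (f : PHom k H (p + 1) L M)
    (τ : Equiv.Perm (Fin q)) (g : PHom k H q L L) :
    compL hn f (permAct τ g) = permAct (blockPerm hn τ 1) (compL hn f g) :=
  PHom.ext (funext fun x => by
    simp only [compL_apply, permAct_apply, insL_perm, Function.comp_apply, blockPerm_blockL,
      blockPerm_blockR, Equiv.Perm.one_apply]
    rfl)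

/-- A permutation of the slots passes through an insertion when it fixes slot `0`, the slot that is
filled; it then acts on the second block. -/
lemma insL_permAct_consPerm {q p n : ℕ} (hn : q + p = n) (f : PHom k H (p + 1) L M)
    (x : Fin p → L) (τ : Equiv.Perm (Fin p)) (z : PT k H q L) :
    (permAct (consPerm τ) f).insL hn x z =
      PT.perm (blockPerm hn 1 τ) (f.insL hn (x ∘ τ) z) := by
  induction z using PT.induction with
  | hmk a y =>
    have hx : (Fin.cons y x : Fin (p + 1) → L) ∘ consPerm τ = Fin.cons y (x ∘ τ) := by
      funext i
      induction i using Fin.cases <;> simp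
    rw [insL_mk', insL_mk', permAct_apply, hx, PT.perm_smul, PT.perm_eq_spread, PT.perm_eq_spread,
      PT.spread_spread, PT.spread_spread, emb_emb]
    refine congrArg₂ (· • ·) (emb_congr (funext fun i => ?_) a) (PT.spread_congr ?_ _)
    · simp
    · rw [Equiv.eq_comp_symm]
      refine funext_block hn (fun i => ?_) (fun i => ?_)
      · simp [Equiv.symm_apply_eq]
      · simp [Equiv.symm_apply_eq]
  | hadd z w hz hw => simp only [_root_.map_add, hz, hw]

lemma compL_permAct_left {q p n : ℕ} (hn : q + p = n) (f : PHom k H (p + 1) L M)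
    (τ : Equiv.Perm (Fin p)) (g : PHom k H q L L) :
    compL hn (permAct (consPerm τ) f) g = permAct (blockPerm hn 1 τ) (compL hn f g) :=
  PHom.ext (funext fun x => by
    rw [compL_apply, permAct_apply, compL_apply, insL_permAct_consPerm]
    simp only [Function.comp_apply, blockPerm_blockL, blockPerm_blockR, Equiv.Perm.one_apply]
    rfl)

/-- With `z = a ⊗_H w` and `g(w, …) = b ⊗_H v`, three coefficients have to agree: that of `a`, that
of `b` after the expansion of its first factor, and that of `f` after two expansions instead of a
single larger one. -/
lemma insL_compL {p q s m t n : ℕ} (h₁ : q + 1 + p = m + 1) (h₂ : s + m = n) (h₃ : s + q = t)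
    (h₄ : t + p = n) (h₅ : q + p = m) (f : PHom k H (p + 1) L M) (g : PHom k H (q + 1) L L)
    (y : Fin m → L) (z : PT k H s L) :
    (compL h₁ f g).insL h₂ y z = f.insL h₄ (fun j => y (blockR h₅ j))
      (g.insL h₃ (fun j => y (blockL h₅ j)) z) := by
  induction z using PT.induction with
  | hmk a w =>
    have hL : (fun j => (Fin.cons w y : Fin (m + 1) → L) (blockL h₁ j)) =
        Fin.cons w fun j => y (blockL h₅ j) := by
      funext j
      induction j using Fin.cases <;> rfl
    have hR : (fun j => (Fin.cons w y : Fin (m + 1) → L) (blockR h₁ j)) =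
        fun j => y (blockR h₅ j) := by
      funext j
      have : blockR h₁ j = (blockR h₅ j).succ :=
        Fin.ext (by simp only [blockR, Fin.val_succ]; omega)
      rw [this, Fin.cons_succ]
    rw [insL_mk', insL_mk', compL_apply, hL, hR]
    generalize g.1 (Fin.cons w fun j => y (blockL h₅ j)) = v
    induction v using PT.induction with
    | hmk b v =>
      rw [PT.spread_mk, PT.smul_mk, insL_mk', insL_mk', PT.spread_smul, map_mul, mul_smul,
        PT.spread_spread, emb_emb]
      refine congrArg₂ (· • ·) (emb_congr rfl a) (congrArg₂ (· • ·) ?_ (PT.spread_congr ?_ _))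
      -- The expansion of slot `0` restricts to the first block, where the coefficients `b` live;
      -- this is the pullback square of `delta_emb`.
      · refine delta_emb _ _ _ _ _ _ (fun i j => ?_) b
        simp only [Fin.ext_iff, collapseL, blockL]
        exact ⟨fun h => ⟨⟨i, by omega⟩, rfl, h⟩, fun ⟨l, h, h'⟩ => by omega⟩
      · funext i
        simp only [Fin.ext_iff, collapseL, Function.comp_apply]
        omega
    | hadd v v' hv hv' => simp only [_root_.map_add, smul_add, hv, hv']
  | hadd z w hz hw => simp only [_root_.map_add, hz, hw]

/-- Sequential composition is associative. -/
lemma compL_assoc {p q s m t n : ℕ} (h₁ : q + 1 + p = m + 1) (h₂ : s + m = n) (h₃ : s + q = t)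
    (h₄ : t + p = n) (f : PHom k H (p + 1) L M) (g : PHom k H (q + 1) L L) (u : PHom k H s L L) :
    compL h₂ (compL h₁ f g) u = compL h₄ f (compL h₃ g u) := by
  refine PHom.ext (funext fun x => ?_)
  have h₅ : q + p = m := by omega
  rw [compL_apply, insL_compL h₁ h₂ h₃ h₄ h₅, compL_apply, compL_apply]
  have e₃ : (fun j => x (blockR h₄ j)) = fun j => x (blockR h₂ (blockR h₅ j)) :=
    funext fun j => congrArg x (Fin.ext (by simp only [blockR]; omega))
  rw [e₃]
  rfl

/-- After `g` has filled the first slot of `f`, the second variable of `f` stands in position `q`.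
The cycle brings it to the front, the only slot in which `insL` can insert. -/
lemma insL_parallel_mk {p q s m n : ℕ} (h₁ : q + (p + 1) = m + 1) (h₂ : s + m = n)
    (h₅ : q + p = m) (f : PHom k H (p + 1 + 1) L M) (g : PHom k H q L L) (y : Fin m → L)
    (a : TPow k H s) (w : L) :
    (permAct (Fin.cycleRange ⟨q, by omega⟩) (compL h₁ f g)).insL h₂ y (PT.mk a w) =
      emb (blockL h₂) (blockL_injective h₂) a • PT.spread (collapseL s h₂)
        (PT.perm (Fin.cycleRange ⟨q, by omega⟩)
          (f.insL h₁ (Fin.cons w fun j => y (blockR h₅ j)) (g.1 fun j => y (blockL h₅ j)))) := by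
  rw [insL_mk', permAct_apply, compL_apply]
  congr 5
  · funext j
    induction j using Fin.cases with
    | zero =>
      rw [Fin.cons_zero, Function.comp_apply]
      have : Fin.cycleRange (⟨q, by omega⟩ : Fin (m + 1)) (blockR h₁ 0) = 0 :=
        Fin.ext (by rw [val_cycleRange]; simp [blockR])
      rw [this, Fin.cons_zero]
    | succ j =>
      rw [Fin.cons_succ, Function.comp_apply]
      have : Fin.cycleRange (⟨q, by omega⟩ : Fin (m + 1)) (blockR h₁ j.succ) =
          (blockR h₅ j).succ :=
        Fin.ext (by
          rw [val_cycleRange]; simp only [blockR, Fin.val_succ]; grind)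
      rw [this, Fin.cons_succ]
  · funext j
    rw [Function.comp_apply]
    have : Fin.cycleRange (⟨q, by omega⟩ : Fin (m + 1)) (blockL h₁ j) = (blockL h₅ j).succ :=
      Fin.ext (by
        have := j.2
        rw [val_cycleRange]; simp only [blockL, Fin.val_succ]; grind)
    rw [this, Fin.cons_succ]

/-- In normal form both sides are the coefficients `a` and `b`, in disjoint blocks, times a `spread`
of one value of `f`. The two maps of positions agree by `collapseL_parallel`. -/
lemma parallel_mk_mk {p q s m m' n : ℕ} (h₁ : q + (p + 1) = m + 1) (h₂ : s + m = n)
    (h₃ : s + (p + 1) = m' + 1) (h₄ : q + m' = n) (σ : Equiv.Perm (Fin n))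
    (hσ : ∀ i, (σ i : ℕ) = if (i : ℕ) < q then s + i else if (i : ℕ) < q + s then i - q else i)
    (f : PHom k H (p + 1 + 1) L M) (y : Fin p → L) (a : TPow k H s) (w : L) (b : TPow k H q)
    (v : L) :
    emb (blockL h₂) (blockL_injective h₂) a • PT.spread (collapseL s h₂)
        (PT.perm (Fin.cycleRange ⟨q, by omega⟩) (f.insL h₁ (Fin.cons w y) (PT.mk b v))) =
      PT.perm σ (emb (blockL h₄) (blockL_injective h₄) b • PT.spread (collapseL q h₄)
        (PT.perm (Fin.cycleRange ⟨s, by omega⟩)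
          ((permAct (Equiv.swap 0 1) f).insL h₃ (Fin.cons v y) (PT.mk a w)))) := by
  have hx : (Fin.cons w (Fin.cons v y : Fin (p + 1) → L) : Fin (p + 1 + 1) → L) ∘
      Equiv.swap 0 1 = Fin.cons v (Fin.cons w y : Fin (p + 1) → L) := by
    funext i
    induction i using Fin.cases with
    | zero => rw [Function.comp_apply, Equiv.swap_apply_left]; rfl
    | succ i =>
      induction i using Fin.cases with
      | zero =>
        rw [Function.comp_apply, Fin.succ_zero_eq_one, Equiv.swap_apply_right]; rfl
      | succ i =>
        have h1 : i.succ.succ ≠ 1 := fun h => Fin.succ_ne_zero i (Fin.succ_injective _ h)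
        rw [Function.comp_apply, Equiv.swap_apply_of_ne_of_ne (Fin.succ_ne_zero _) h1]
        rfl
  rw [insL_mk', insL_mk', permAct_apply, hx]
  generalize f.1 (Fin.cons v (Fin.cons w y : Fin (p + 1) → L)) = F
  simp only [PT.perm_smul, PT.spread_smul, emb_emb]
  simp only [PT.perm_eq_spread, PT.spread_spread]
  have hinj : ∀ (c d : ℕ) (h : c + d ≤ n),
      Function.Injective fun i : Fin d => (⟨c + i, by omega⟩ : Fin n) :=
    fun c d h i j e => by simpa [Fin.ext_iff] using e
  rw [delta_emb_eq _ _ _ (fun i : Fin q => (⟨s + i, by omega⟩ : Fin n))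
      (hinj _ _ (by omega)),
    delta_emb_eq _ _ _ (fun i : Fin s => (⟨q + i, by omega⟩ : Fin n))
      (hinj _ _ (by omega)), ← mul_smul, emb_emb, ← mul_smul]
  · refine congrArg₂ (· • ·) ?_ (PT.spread_congr ?_ _)
    -- `H` need not be commutative, but `a` and `b` occupy disjoint sets of positions.
    · rw [(commute_emb_emb _ _ _ _ (fun i j h => ?_) _ _).eq]
      · refine congrArg₂ (· * ·) (emb_congr (funext fun i => Fin.ext ?_) _)
          (emb_congr (funext fun i => Fin.ext ?_) _)
        · have := i.2
          simp only [Function.comp_apply, hσ, blockL]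
          grind
        · have := i.2
          simp only [Function.comp_apply, hσ, blockL]
          grind
      · simp only [blockL, Fin.ext_iff] at h
        omega
    · rw [Equiv.eq_comp_symm]
      funext i
      rw [Equiv.symm_swap]
      exact collapseL_parallel h₁ h₂ h₃ h₄ (hσ i)
  · intro i j
    have := i.2
    have := j.2
    simp only [Fin.ext_iff, Function.comp_apply, collapseL, val_cycleRange, blockL]
    grind
  · intro i j
    have := i.2
    have := j.2
    simp only [Fin.ext_iff, Function.comp_apply, collapseL, val_cycleRange, blockL]
    grind

/-- Compositions in two different variables commute. -/
lemma compL_parallel {p q s m m' n : ℕ} (h₁ : q + (p + 1) = m + 1) (h₂ : s + m = n)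
    (h₃ : s + (p + 1) = m' + 1) (h₄ : q + m' = n) (σ : Equiv.Perm (Fin n))
    (hσ : ∀ i, (σ i : ℕ) = if (i : ℕ) < q then s + i else if (i : ℕ) < q + s then i - q else i)
    (f : PHom k H (p + 1 + 1) L M) (g : PHom k H q L L) (u : PHom k H s L L) :
    compL h₂ (permAct (Fin.cycleRange ⟨q, by omega⟩) (compL h₁ f g)) u =
      permAct σ (compL h₄ (permAct (Fin.cycleRange ⟨s, by omega⟩)
        (compL h₃ (permAct (Equiv.swap 0 1) f) u)) g) := by
  refine PHom.ext (funext fun x => ?_)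
  have h₅ : q + p = m := by omega
  have h₆ : s + p = m' := by omega
  rw [compL_apply, permAct_apply, compL_apply]
  obtain ⟨N, a, w, hz⟩ := PT.exists_sum (u.1 fun j => x (blockL h₂ j))
  obtain ⟨N', b, v, hv⟩ := PT.exists_sum (g.1 fun j => (x ∘ σ) (blockL h₄ j))
  have eg : (fun j => x (blockR h₂ (blockL h₅ j))) = fun j => (x ∘ σ) (blockL h₄ j) := by
    funext j
    refine congrArg x (Fin.ext ?_)
    have := j.2
    rw [hσ]
    simp only [blockL, blockR]
    grind
  have eu : (fun j => (x ∘ σ) (blockR h₄ (blockL h₆ j))) = fun j => x (blockL h₂ j) := by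
    funext j
    refine congrArg x (Fin.ext ?_)
    have := j.2
    rw [hσ]
    simp only [blockL, blockR]
    grind
  have ey : (fun j => (x ∘ σ) (blockR h₄ (blockR h₆ j))) =
      fun j => x (blockR h₂ (blockR h₅ j)) := by
    funext j
    refine congrArg x (Fin.ext ?_)
    rw [hσ]
    simp only [blockR]
    grind
  rw [hz, hv]
  simp only [map_sum, insL_parallel_mk h₁ h₂ h₅, insL_parallel_mk h₃ h₄ h₆, eg, eu, ey, hz, hv,
    Finset.smul_sum]
  rw [Finset.sum_comm]
  exact Finset.sum_congr rfl fun i _ => Finset.sum_congr rfl fun j _ =>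
    parallel_mk_mk h₁ h₂ h₃ h₄ σ hσ f _ _ _ _ _

end PHom

namespace PBil

lemma insR_mk' {q : ℕ} (β : PBil k H A B N) (x : A) (a : TPow k H q) (y : B) :
    β.insR x (PT.mk a y) = emb Fin.succ (Fin.succ_injective q) a •
      PT.spread (Fin.cases 0 fun _ => 1) (β.1 x y) := by
  rw [insR_mk, PT.pull_eq_spread (expandR_eq_delta q)]

lemma insL_mk' {q : ℕ} (β : PBil k H A B N) (y : B) (a : TPow k H q) (x : A) :
    β.insL y (PT.mk a x) = emb (blockL (p := 1) (n := q + 1) rfl) (blockL_injective rfl) a •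
      PT.spread (collapseL q rfl) (β.1 x y) := by
  rw [insL_mk, PT.pull_eq_spread (expandL_eq_delta _)]

/-- Converts insertion on the right into insertion on the left, which is the form in which `compL`
is defined. The cycle carries the last position, that of `x`, to the front. -/
lemma perm_insL_flip {q : ℕ} (β : PBil k H A B N) (x : A) (z : PT k H q B) :
    PT.perm (Fin.cycleRange (Fin.last q)) (β.flip.insL x z) = β.insR x z := by
  induction z using PT.induction with
  | hmk a y =>
    rw [insL_mk', insR_mk', PT.perm_smul, emb_emb]
    change _ • PT.perm _ (PT.spread _ (PT.perm _ (β.1 x y))) = _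
    rw [PT.perm_eq_spread, PT.perm_eq_spread, PT.spread_spread, PT.spread_spread]
    refine congrArg₂ (· • ·) (emb_congr (funext fun i => Fin.ext ?_) a) (PT.spread_congr ?_ _)
    · have := i.2
      simp only [Function.comp_apply, val_cycleRange, blockL, Fin.val_last, Fin.val_succ]
      grind
    · funext i
      induction i using Fin.cases with
      | zero =>
        have : collapseL q rfl (Fin.last q) = 1 := Fin.ext (by simp [collapseL])
        rw [Function.comp_apply, Function.comp_apply, Fin.cycleRange_symm_zero, this]
        simp
      | succ i =>
        have : collapseL q rfl ((Fin.cycleRange (Fin.last q)).symm i.succ) = 0 := by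
          refine Fin.ext ?_
          have := i.2
          simp only [collapseL, val_cycleRange_symm, Fin.val_succ, Fin.val_last, Fin.val_zero]
          grind
        rw [Function.comp_apply, Function.comp_apply, this]
        simp
  | hadd z w hz hw => simp only [map_add, hz, hw]

lemma insL_perm {q : ℕ} (β : PBil k H A B N) (y : B) (τ : Equiv.Perm (Fin q)) (z : PT k H q A) :
    β.insL y (PT.perm τ z) = PT.perm (blockPerm rfl τ 1) (β.insL y z) := by
  induction z using PT.induction with
  | hmk a x =>
    rw [PT.perm_mk, insL_mk', insL_mk', PT.perm_smul, PT.perm_eq_spread, PT.spread_spread, emb_emb,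
      emb_emb]
    refine congrArg₂ (· • ·) (emb_congr (funext fun i => ?_) a) (PT.spread_congr ?_ _)
    · simp
    · rw [Equiv.eq_comp_symm]
      exact funext_block rfl (fun i => by simp) (fun i => by simp)
  | hadd z w hz hw => simp only [map_add, hz, hw]

lemma insR_perm {q : ℕ} (β : PBil k H A B N) (x : A) (τ : Equiv.Perm (Fin q)) (z : PT k H q B) :
    β.insR x (PT.perm τ z) = PT.perm (consPerm τ) (β.insR x z) := by
  induction z using PT.induction with
  | hmk a y =>
    rw [PT.perm_mk, insR_mk', insR_mk', PT.perm_smul, PT.perm_eq_spread, PT.spread_spread, emb_emb,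
      emb_emb]
    refine congrArg₂ (· • ·) (emb_congr (funext fun i => ?_) a) (PT.spread_congr ?_ _)
    · simp
    · rw [Equiv.eq_comp_symm]
      funext i
      induction i using Fin.cases <;> simp
  | hadd z w hz hw => simp only [map_add, hz, hw]

lemma flip_flip (β : PBil k H A B N) : β.flip.flip = β :=
  PBil.ext (funext fun a => funext fun b => by
    change PT.perm _ (PT.perm _ _) = _
    rw [PT.perm_perm, Equiv.swap_mul_self, PT.perm_one])

lemma toPHom_insL {q : ℕ} (β : PBil k H L L M) (x : Fin 1 → L) (z : PT k H q L) :
    β.toPHom.insL rfl x z = β.insL (x 0) z := by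
  induction z using PT.induction with
  | hmk a y => rfl
  | hadd z w hz hw => simp only [map_add, hz, hw]

end PBil
end Composition

/-! ### Pseudotensors under linear maps and direct sums -/

section Naturality
variable {k H : Type*} [Field k] [Ring H] [HopfAlgebra k H]
variable {M N M' : Type*} [AddCommGroup M] [Module k M] [Module H M] [IsScalarTower k H M]
  [AddCommGroup N] [Module k N] [Module H N] [IsScalarTower k H N]
  [AddCommGroup M'] [Module k M'] [Module H M'] [IsScalarTower k H M']

namespace PT

lemma map_map {n : ℕ} (u : M →ₗ[H] N) (v : N →ₗ[H] M') (z : PT k H n M) :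
    map v (map u z) = map (v ∘ₗ u) z := by
  induction z using induction with
  | hmk a m => rfl
  | hadd z w hz hw => simp only [_root_.map_add, hz, hw]

lemma map_id {n : ℕ} (z : PT k H n M) : map (LinearMap.id : M →ₗ[H] M) z = z := by
  induction z using induction with
  | hmk a m => rfl
  | hadd z w hz hw => simp only [_root_.map_add, hz, hw]

lemma map_zero_left {n : ℕ} (z : PT k H n M) : map (0 : M →ₗ[H] N) z = 0 := by
  induction z using induction with
  | hmk a m => rw [map_mk, LinearMap.zero_apply, ← zero_smul k (0 : N), mk_smul_right, zero_smul]
  | hadd z w hz hw => simp only [_root_.map_add, hz, hw, add_zero]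

lemma map_add_left {n : ℕ} (u v : M →ₗ[H] N) (z : PT k H n M) :
    map (u + v) z = map u z + map v z := by
  induction z using induction with
  | hmk a m => simp only [map_mk, LinearMap.add_apply, mk_add_right]
  | hadd z w hz hw => simp only [_root_.map_add, hz, hw]; abel

lemma map_sub_left {n : ℕ} (u v : M →ₗ[H] N) (z : PT k H n M) :
    map (u - v) z = map u z - map v z := by
  rw [eq_sub_iff_add_eq, ← map_add_left, sub_add_cancel]

lemma pull_map {n n' : ℕ} (e : TPow k H n →ₐ[k] TPow k H n')
    (he : ∀ h, e (coprod n h) = coprod n' h) (u : M →ₗ[H] N) (z : PT k H n M) :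
    pull e he (map u z) = map u (pull e he z) := by
  induction z using induction with
  | hmk a m => rfl
  | hadd z w hz hw => simp only [_root_.map_add, hz, hw]

lemma perm_map [Coalgebra.IsCocomm k H] {n : ℕ} (σ : Equiv.Perm (Fin n)) (u : M →ₗ[H] N)
    (z : PT k H n M) : perm σ (map u z) = map u (perm σ z) := pull_map _ _ _ _

lemma map_inl_add_map_inr {n : ℕ} (z : PT k H n (M × N)) :
    map (LinearMap.inl H M N) (map (LinearMap.fst H M N) z) +
      map (LinearMap.inr H M N) (map (LinearMap.snd H M N) z) = z := by
  rw [map_map, map_map, ← map_add_left]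
  convert map_id z
  ext x <;> simp

lemma prod_ext {n : ℕ} {z w : PT k H n (M × N)}
    (h₁ : map (LinearMap.fst H M N) z = map (LinearMap.fst H M N) w)
    (h₂ : map (LinearMap.snd H M N) z = map (LinearMap.snd H M N) w) : z = w := by
  rw [← map_inl_add_map_inr z, h₁, h₂, map_inl_add_map_inr]

lemma map_fst_inl {n : ℕ} (z : PT k H n M) :
    map (LinearMap.fst H M N) (map (LinearMap.inl H M N) z) = z := by
  rw [map_map, LinearMap.fst_comp_inl, map_id]

lemma map_snd_inl {n : ℕ} (z : PT k H n M) :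
    map (LinearMap.snd H M N) (map (LinearMap.inl H M N) z) = 0 := by
  rw [map_map, LinearMap.snd_comp_inl, map_zero_left]

lemma map_fst_inr {n : ℕ} (z : PT k H n N) :
    map (LinearMap.fst H M N) (map (LinearMap.inr H M N) z) = 0 := by
  rw [map_map, LinearMap.fst_comp_inr, map_zero_left]

lemma map_snd_inr {n : ℕ} (z : PT k H n N) :
    map (LinearMap.snd H M N) (map (LinearMap.inr H M N) z) = z := by
  rw [map_map, LinearMap.snd_comp_inr, map_id]

end PT
end Naturality

/-! ### Insertions under linear maps and sums of operations -/

section Bilinear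
variable {k H : Type*} [Field k] [Ring H] [HopfAlgebra k H]
variable {A B N A' B' N' : Type*} [AddCommGroup A] [Module k A] [Module H A] [IsScalarTower k H A]
  [AddCommGroup B] [Module k B] [Module H B] [IsScalarTower k H B]
  [AddCommGroup N] [Module k N] [Module H N] [IsScalarTower k H N]
  [AddCommGroup A'] [Module k A'] [Module H A'] [IsScalarTower k H A']
  [AddCommGroup B'] [Module k B'] [Module H B'] [IsScalarTower k H B']
  [AddCommGroup N'] [Module k N'] [Module H N'] [IsScalarTower k H N']

namespace PBil

lemma comp_apply (β : PBil k H A B N) (u : A' →ₗ[H] A) (v : B' →ₗ[H] B) (w : N →ₗ[H] N') (a : A')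
    (b : B') : (β.comp u v w).1 a b = PT.map w (β.1 (u a) (v b)) := rfl

lemma flip_apply [Coalgebra.IsCocomm k H] (β : PBil k H A B N) (b : B) (a : A) :
    β.flip.1 b a = PT.perm (Equiv.swap 0 1) (β.1 a b) := rfl

lemma insR_comp {q : ℕ} (β : PBil k H A B N) (u : A' →ₗ[H] A) (v : B' →ₗ[H] B) (w : N →ₗ[H] N')
    (x : A') (z : PT k H q B') :
    (β.comp u v w).insR x z = PT.map w (β.insR (u x) (PT.map v z)) := by
  induction z using PT.induction with
  | hmk a y => rw [PT.map_mk, insR_mk, insR_mk, comp_apply, PT.pull_map, PT.map_smul']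
  | hadd z z' hz hz' => simp only [map_add, hz, hz']

lemma insL_comp {q : ℕ} (β : PBil k H A B N) (u : A' →ₗ[H] A) (v : B' →ₗ[H] B) (w : N →ₗ[H] N')
    (y : B') (z : PT k H q A') :
    (β.comp u v w).insL y z = PT.map w (β.insL (v y) (PT.map u z)) := by
  induction z using PT.induction with
  | hmk a x => rw [PT.map_mk, insL_mk, insL_mk, comp_apply, PT.pull_map, PT.map_smul']
  | hadd z z' hz hz' => simp only [map_add, hz, hz']

lemma add_insR {q : ℕ} (β γ : PBil k H A B N) (x : A) (z : PT k H q B) :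
    (β + γ).insR x z = β.insR x z + γ.insR x z := by
  induction z using PT.induction with
  | hmk a y => simp only [insR_mk, add_apply, map_add, smul_add]
  | hadd z z' hz hz' => simp only [map_add, hz, hz']; abel

lemma sub_insR {q : ℕ} (β γ : PBil k H A B N) (x : A) (z : PT k H q B) :
    (β - γ).insR x z = β.insR x z - γ.insR x z := by
  rw [eq_sub_iff_add_eq, ← add_insR, sub_add_cancel]

lemma neg_insR {q : ℕ} (β : PBil k H A B N) (x : A) (z : PT k H q B) :
    (-β).insR x z = -β.insR x z := by
  rw [eq_neg_iff_add_eq_zero, ← add_insR, neg_add_cancel, ← sub_self β, sub_insR, sub_self]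

lemma add_insL {q : ℕ} (β γ : PBil k H A B N) (y : B) (z : PT k H q A) :
    (β + γ).insL y z = β.insL y z + γ.insL y z := by
  induction z using PT.induction with
  | hmk a x => simp only [insL_mk, add_apply, map_add, smul_add]
  | hadd z z' hz hz' => simp only [map_add, hz, hz']; abel

lemma sub_insL {q : ℕ} (β γ : PBil k H A B N) (y : B) (z : PT k H q A) :
    (β - γ).insL y z = β.insL y z - γ.insL y z := by
  rw [eq_sub_iff_add_eq, ← add_insL, sub_add_cancel]

end PBil
end Bilinear

/-! ### Subpseudoalgebras, quotient representations and semidirect products -/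

section Lie
variable {k H : Type*} [Field k] [Ring H] [HopfAlgebra k H] [Coalgebra.IsCocomm k H]
variable {L L' g h : Type*} [AddCommGroup L] [Module k L] [Module H L] [IsScalarTower k H L]
  [AddCommGroup L'] [Module k L'] [Module H L'] [IsScalarTower k H L']
  [AddCommGroup g] [Module k g] [Module H g] [IsScalarTower k H g]
  [AddCommGroup h] [Module k h] [Module H h] [IsScalarTower k H h]

/-- Transport of a pseudobracket along an isomorphism. -/
lemma IsLieBracket.comp {β : PBil k H L L L} (hβ : IsLieBracket β) {u : L' →ₗ[H] L}
    {w : L →ₗ[H] L'} (huw : u ∘ₗ w = LinearMap.id) : IsLieBracket (β.comp u u w) where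
  skew x y := by rw [PBil.comp_apply, PBil.comp_apply, PT.perm_map, hβ.skew, map_neg]
  -- An inner bracket is mapped by `w` and then by `u`, so a one-sided inverse is enough.
  jacobi x y z := by
    simp only [PBil.insR_comp, PBil.insL_comp, PBil.comp_apply, PT.map_map, huw, PT.map_id,
      PT.perm_map]
    rw [hβ.jacobi, map_add]

section Components
variable {Ω : PBil k H (g × h) (g × h) (g × h)} (hΩ : IsLieBracket Ω)
  (hg : ∀ x y : g, PT.map (LinearMap.snd H g h) (Ω.1 (x, 0) (y, 0)) = 0)
include hΩ hg

lemma map_inl_map_fst (x y : g) : PT.map (LinearMap.inl H g h)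
    (PT.map (LinearMap.fst H g h) (Ω.1 (x, 0) (y, 0))) = Ω.1 (x, 0) (y, 0) := by
  conv_rhs => rw [← PT.map_inl_add_map_inr (Ω.1 (x, 0) (y, 0)), hg, map_zero, add_zero]

/-- A subpseudoalgebra is a Lie pseudoalgebra. -/
lemma isLieBracket_component : IsLieBracket
    (Ω.comp (LinearMap.inl H g h) (LinearMap.inl H g h) (LinearMap.fst H g h)) where
  skew x y := by rw [PBil.comp_apply, PBil.comp_apply, PT.perm_map, hΩ.skew, map_neg]
  jacobi x y z := by
    simp only [PBil.insR_comp, PBil.insL_comp, PBil.comp_apply, LinearMap.inl_apply,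
      map_inl_map_fst hΩ hg, PT.perm_map]
    rw [hΩ.jacobi, map_add]

/-- A pseudoalgebra modulo a subpseudoalgebra is a representation of the latter. -/
lemma isRep_component : IsRep
    (Ω.comp (LinearMap.inl H g h) (LinearMap.inl H g h) (LinearMap.fst H g h))
    (Ω.comp (LinearMap.inl H g h) (LinearMap.inr H g h) (LinearMap.snd H g h)) := by
  -- Replacing a value by its `h`-component changes it by an element of the `g`-part, which `(x, 0)`
  -- maps into the `g`-part again; modulo `g` nothing changes.
  have key : ∀ (x : g) (z : PT k H 2 (g × h)), PT.map (LinearMap.snd H g h)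
      (Ω.insR (x, 0) (PT.map (LinearMap.inr H g h) (PT.map (LinearMap.snd H g h) z))) =
      PT.map (LinearMap.snd H g h) (Ω.insR (x, 0) z) := by
    intro x z
    have h0 : Ω.comp (LinearMap.inl H g h) (LinearMap.inl H g h) (LinearMap.snd H g h) = 0 :=
      PBil.ext (funext fun a => funext fun b => hg a b)
    have h1 : PT.map (LinearMap.snd H g h) (Ω.insR (x, 0)
        (PT.map (LinearMap.inl H g h) (PT.map (LinearMap.fst H g h) z))) = 0 := by
      have := PBil.insR_comp Ω (LinearMap.inl H g h) (LinearMap.inl H g h) (LinearMap.snd H g h) x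
        (PT.map (LinearMap.fst H g h) z)
      -- Writing `0` as `0 - 0` shows that inserting into the zero operation gives zero.
      rw [h0, ← sub_self (0 : PBil k H g g h), PBil.sub_insR, sub_self] at this
      exact this.symm
    conv_rhs => rw [← PT.map_inl_add_map_inr z, map_add, map_add, h1, zero_add]
  intro x y v
  simp only [PBil.insR_comp, PBil.insL_comp, PBil.comp_apply, LinearMap.inl_apply,
    LinearMap.inr_apply, map_inl_map_fst hΩ hg, PT.perm_map, key]
  rw [hΩ.jacobi (x, 0), map_add, add_sub_cancel_right]

end Components

/-- The semidirect product of a pseudobracket and a representation. -/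
def semidirect (β : PBil k H g g g) (ρ : PBil k H g h h) : PBil k H (g × h) (g × h) (g × h) :=
  β.comp (LinearMap.fst H g h) (LinearMap.fst H g h) (LinearMap.inl H g h) +
    (ρ.comp (LinearMap.fst H g h) (LinearMap.snd H g h) (LinearMap.inr H g h) -
      (ρ.comp (LinearMap.fst H g h) (LinearMap.snd H g h) (LinearMap.inr H g h)).flip)

lemma map_fst_semidirect (β : PBil k H g g g) (ρ : PBil k H g h h) (x y : g × h) :
    PT.map (LinearMap.fst H g h) ((semidirect β ρ).1 x y) = β.1 x.1 y.1 := by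
  simp only [semidirect, PBil.add_apply, PBil.sub_apply, PBil.comp_apply, PBil.flip_apply,
    map_add, map_sub, PT.perm_map, PT.map_fst_inl, PT.map_fst_inr, sub_zero, add_zero]
  rfl

lemma map_snd_semidirect (β : PBil k H g g g) (ρ : PBil k H g h h) (x y : g × h) :
    PT.map (LinearMap.snd H g h) ((semidirect β ρ).1 x y) =
      ρ.1 x.1 y.2 - PT.perm (Equiv.swap 0 1) (ρ.1 y.1 x.2) := by
  simp only [semidirect, PBil.add_apply, PBil.sub_apply, PBil.comp_apply, PBil.flip_apply,
    map_add, map_sub, PT.perm_map, PT.map_snd_inl, PT.map_snd_inr, zero_add]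
  rfl

lemma map_flip_insR {q : ℕ} (ρ : PBil k H g h h) (x : g × h) (z : PT k H q (g × h)) :
    (ρ.comp (LinearMap.fst H g h) (LinearMap.snd H g h) (LinearMap.inr H g h)).flip.insR x z =
      PT.map (LinearMap.inr H g h) (PT.perm (Fin.cycleRange (Fin.last q))
        (ρ.insL x.2 (PT.map (LinearMap.fst H g h) z))) := by
  rw [← PBil.perm_insL_flip, PBil.flip_flip, PBil.insL_comp, PT.perm_map]
  rfl

lemma map_flip_insL {q : ℕ} (ρ : PBil k H g h h) (x : g × h) (z : PT k H q (g × h)) :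
    (ρ.comp (LinearMap.fst H g h) (LinearMap.snd H g h) (LinearMap.inr H g h)).flip.insL x z =
      PT.map (LinearMap.inr H g h) (PT.perm (Fin.cycleRange (Fin.last q))⁻¹
        (ρ.insR x.1 (PT.map (LinearMap.snd H g h) z))) := by
  have := PBil.perm_insL_flip (ρ.comp (LinearMap.fst H g h) (LinearMap.snd H g h)
    (LinearMap.inr H g h)) x z
  rw [PBil.insR_comp] at this
  rw [← PT.perm_map]
  refine Eq.trans ?_ (congrArg _ this)
  rw [PT.perm_perm, inv_mul_cancel, PT.perm_one]

/-- The `g`-component is the Jacobi identity of `β`. The `h`-component is a sum of parts linear in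
the `h`-entries of `X`, `Y` and `Z`, and each part is the representation identity for the two
remaining `g`-entries. -/
lemma IsLieBracket.semidirect {β : PBil k H g g g} {ρ : PBil k H g h h} (hβ : IsLieBracket β)
    (hρ : IsRep β ρ) : IsLieBracket (semidirect β ρ) where
  skew x y := by
    refine PT.prod_ext ?_ ?_
    · rw [map_fst_semidirect, map_neg, ← PT.perm_map, map_fst_semidirect, hβ.skew]
    · rw [map_snd_semidirect, map_neg, ← PT.perm_map, map_snd_semidirect, map_sub, PT.perm_perm,
        Equiv.swap_mul_self, PT.perm_one, neg_sub]
  jacobi X Y Z := by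
    refine PT.prod_ext ?_ ?_
    · have h1 : ∀ (X : g × h) (z : PT k H 2 (g × h)), PT.map (LinearMap.fst H g h)
          ((LiePseudo.semidirect β ρ).insR X z) =
          β.insR X.1 (PT.map (LinearMap.fst H g h) z) := by
        intro X z
        simp only [LiePseudo.semidirect, PBil.add_insR, PBil.sub_insR, map_flip_insR,
          PBil.insR_comp, map_add, map_sub, PT.map_fst_inl, PT.map_fst_inr, sub_zero, add_zero]
        rfl
      have h2 : ∀ (X : g × h) (z : PT k H 2 (g × h)), PT.map (LinearMap.fst H g h)
          ((LiePseudo.semidirect β ρ).insL X z) =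
          β.insL X.1 (PT.map (LinearMap.fst H g h) z) := by
        intro X z
        simp only [LiePseudo.semidirect, PBil.add_insL, PBil.sub_insL, map_flip_insL,
          PBil.insL_comp, map_add, map_sub, PT.map_fst_inl, PT.map_fst_inr, sub_zero, add_zero]
        rfl
      rw [map_add, ← PT.perm_map]
      simp only [h1, h2, map_fst_semidirect]
      exact hβ.jacobi _ _ _
    · have h1 : ∀ (X : g × h) (z : PT k H 2 (g × h)), PT.map (LinearMap.snd H g h)
          ((LiePseudo.semidirect β ρ).insR X z) =
          ρ.insR X.1 (PT.map (LinearMap.snd H g h) z) - PT.perm (Fin.cycleRange (Fin.last 2))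
            (ρ.insL X.2 (PT.map (LinearMap.fst H g h) z)) := by
        intro X z
        simp only [LiePseudo.semidirect, PBil.add_insR, PBil.sub_insR, map_flip_insR,
          PBil.insR_comp, map_add, map_sub, PT.map_snd_inl, PT.map_snd_inr, zero_add]
        rfl
      have h2 : ∀ (X : g × h) (z : PT k H 2 (g × h)), PT.map (LinearMap.snd H g h)
          ((LiePseudo.semidirect β ρ).insL X z) =
          ρ.insL X.2 (PT.map (LinearMap.fst H g h) z) - PT.perm (Fin.cycleRange (Fin.last 2))⁻¹
            (ρ.insR X.1 (PT.map (LinearMap.snd H g h) z)) := by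
        intro X z
        simp only [LiePseudo.semidirect, PBil.add_insL, PBil.sub_insL, map_flip_insL,
          PBil.insL_comp, map_add, map_sub, PT.map_snd_inl, PT.map_snd_inr, zero_add]
        rfl
      rw [map_add, ← PT.perm_map]
      simp only [h1, h2, map_fst_semidirect, map_snd_semidirect]
      obtain ⟨x, u⟩ := X
      obtain ⟨y, v⟩ := Y
      obtain ⟨z, w⟩ := Z
      have hw := hρ x y w
      have hv := hρ x z v
      have hu := hρ y z u
      simp only [map_sub, PBil.insR_perm, PT.perm_perm, hw, hv, hu]
      -- Only terms `ρ(·, ρ(·, ·))` remain; they cancel once their permutations in `S₃` are matched.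
      have e1 : Fin.cycleRange (Fin.last 2) * Equiv.swap (0 : Fin 3) 1 =
        (Fin.cycleRange (Fin.last 2))⁻¹ * consPerm (Equiv.swap 0 1) := by decide
      have e2 : Equiv.swap (0 : Fin 3) 1 * consPerm (Equiv.swap (0 : Fin 2) 1) =
        Fin.cycleRange (Fin.last 2) := by decide
      have e3 : Equiv.swap (0 : Fin 3) 1 * Fin.cycleRange (Fin.last 2) =
        consPerm (Equiv.swap 0 1) := by decide
      have e4 : Equiv.swap (0 : Fin 3) 1 * (Fin.cycleRange (Fin.last 2) * Equiv.swap 0 1) =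
        (Fin.cycleRange (Fin.last 2))⁻¹ := by decide
      rw [e4, e1, e2, e3]
      abel

end Lie

/-! ### The bracket transported along the graph of `D` -/

section Twist
variable {k H g h : Type*} [Field k] [Ring H] [HopfAlgebra k H] [Coalgebra.IsCocomm k H]
  [AddCommGroup g] [Module k g] [Module H g] [IsScalarTower k H g]
  [AddCommGroup h] [Module k h] [Module H h] [IsScalarTower k H h]

/-- The shear `(x, u) ↦ (x, u + D x)`. -/
def shear (D : g →ₗ[H] h) : g × h →ₗ[H] g × h :=
  (LinearMap.fst H g h).prod (LinearMap.snd H g h + D ∘ₗ LinearMap.fst H g h)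

lemma shear_comp_shear_neg (D : g →ₗ[H] h) : shear D ∘ₗ shear (-D) = LinearMap.id := by
  ext x <;> simp [shear]

namespace QuasiTwilled
variable (Q : QuasiTwilled k H g h)

lemma map_fst_Ω_inr_inr (u v : h) :
    PT.map (LinearMap.fst H g h) (Q.Ω.1 (0, u) (0, v)) = 0 := by
  obtain ⟨z, hz⟩ := Q.sub u v
  rw [← hz, PT.map_fst_inr]

/-- The pseudobracket on the direct sum, transported along the shear by `D`. -/
def twist (D : g →ₗ[H] h) : PBil k H (g × h) (g × h) (g × h) :=
  Q.Ω.comp (shear D) (shear D) (shear (-D))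

lemma isLieBracket_twist (D : g →ₗ[H] h) : IsLieBracket (Q.twist D) :=
  Q.isLie.comp (shear_comp_shear_neg D)

lemma map_fst_twist (D : g →ₗ[H] h) (x y : g × h) :
    PT.map (LinearMap.fst H g h) ((Q.twist D).1 x y) =
      PT.map (LinearMap.fst H g h) (Q.Ω.1 (shear D x) (shear D y)) := by
  rw [twist, PBil.comp_apply, PT.map_map]
  congr 2

lemma map_snd_twist (D : g →ₗ[H] h) (x y : g × h) :
    PT.map (LinearMap.snd H g h) ((Q.twist D).1 x y) =
      PT.map (LinearMap.snd H g h) (Q.Ω.1 (shear D x) (shear D y)) -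
        PT.map D (PT.map (LinearMap.fst H g h) (Q.Ω.1 (shear D x) (shear D y))) := by
  rw [twist, PBil.comp_apply, PT.map_map, PT.map_map, ← PT.map_sub_left]
  congr 2
  ext x <;> simp [shear]

/-- Skew-symmetry rewrites the mixed term with its `h`-entry first. For `u = D x` and `v = D y` the
components are the terms of `π^D` and of the deformation equation. -/
lemma Ω_graph (x y : g) (u v : h) : Q.Ω.1 (x, u) (y, v) =
    Q.Ω.1 (x, 0) (y, 0) + Q.Ω.1 (x, 0) (0, v) -
      PT.perm (Equiv.swap 0 1) (Q.Ω.1 (y, 0) (0, u)) + Q.Ω.1 (0, u) (0, v) := by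
  have h1 : ∀ (x : g) (u : h), ((x, u) : g × h) = (x, 0) + (0, u) := by simp
  rw [h1 x, h1 y, PBil.add_left, PBil.add_right, PBil.add_right, Q.isLie.skew (0, u) (y, 0)]
  abel

/-- The shear does not alter `g`-components, so this is the `g`-component of `Ω` on the graph of
`D`. The pair `(D x, D y)` contributes nothing because `h` is a subpseudoalgebra. -/
lemma piD_eq (D : g →ₗ[H] h) : Q.piD D =
    (Q.twist D).comp (LinearMap.inl H g h) (LinearMap.inl H g h) (LinearMap.fst H g h) := by
  refine PBil.ext (funext fun x => funext fun y => ?_)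
  have hs : ∀ x : g, shear D (x, 0) = (x, D x) := fun x => by simp [shear]
  rw [PBil.comp_apply, map_fst_twist, LinearMap.inl_apply, LinearMap.inl_apply, hs, hs, Ω_graph]
  simp only [map_add, map_sub, map_fst_Ω_inr_inr, add_zero, ← PT.perm_map]
  simp only [piD, PBil.add_apply, PBil.sub_apply, PBil.flip_apply, PBil.comp_apply, π, η,
    LinearMap.inl_apply, LinearMap.inr_apply, LinearMap.id_apply, PT.map_id]

/-- The terms `ρ` and `μ` come from `Ω((x, D x), (0, v))`, and undoing the shear subtracts `D` of
the `g`-component `η(x, v)`. -/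
lemma rhoD_eq (D : g →ₗ[H] h) : Q.rhoD D =
    (Q.twist D).comp (LinearMap.inl H g h) (LinearMap.inr H g h) (LinearMap.snd H g h) := by
  refine PBil.ext (funext fun x => funext fun v => ?_)
  have hs : shear D ((x, 0) : g × h) = (x, 0) + (0, D x) := by simp [shear]
  have hs' : shear D ((0, v) : g × h) = (0, v) := by simp [shear]
  rw [PBil.comp_apply, map_snd_twist, LinearMap.inl_apply, LinearMap.inr_apply, hs, hs',
    PBil.add_left]
  simp only [map_add, map_fst_Ω_inr_inr, add_zero]
  simp only [rhoD, PBil.add_apply, PBil.sub_apply, PBil.comp_apply, ρ, μ, η,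
    LinearMap.inl_apply, LinearMap.inr_apply, LinearMap.id_apply, PT.map_id]

/-- The deformation equation is the statement that the graph of `D` is closed under `Ω`; after the
shear, that `g` is. -/
lemma map_snd_twist_eq_zero {D : g →ₗ[H] h} (hD : Q.IsDMap D) (x y : g) :
    PT.map (LinearMap.snd H g h) ((Q.twist D).1 (x, 0) (y, 0)) = 0 := by
  have hs : ∀ x : g, shear D (x, 0) = (x, D x) := fun x => by simp [shear]
  have := hD x y
  rw [map_snd_twist, hs, hs, Ω_graph]
  simp only [map_add, map_sub, map_fst_Ω_inr_inr, add_zero, ← PT.perm_map]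
  simp only [π, η, ρ, μ, θ, PBil.comp_apply, LinearMap.inl_apply, LinearMap.inr_apply, map_add,
    map_sub, ← PT.perm_map] at this
  rw [this]
  abel

lemma isLieBracket_piD {D : g →ₗ[H] h} (hD : Q.IsDMap D) : IsLieBracket (Q.piD D) := by
  rw [piD_eq]
  exact isLieBracket_component (Q.isLieBracket_twist D) (Q.map_snd_twist_eq_zero hD)

lemma isRep_rhoD {D : g →ₗ[H] h} (hD : Q.IsDMap D) : IsRep (Q.piD D) (Q.rhoD D) := by
  rw [piD_eq, rhoD_eq]
  exact isRep_component (Q.isLieBracket_twist D) (Q.map_snd_twist_eq_zero hD)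

end QuasiTwilled
end Twist

/-! ### Coset representatives and shuffles -/

section Permutations

/-- Left cosets of the stabilizer of `0`, indexed by the image `i` of `0`. Injectivity suffices
because both sides have `(n + 1)!` elements. -/
lemma cycleRange_symm_mul_consPerm_bijective (n : ℕ) : Function.Bijective
    fun x : Fin (n + 1) × Equiv.Perm (Fin n) => (Fin.cycleRange x.1)⁻¹ * consPerm x.2 := by
  rw [Fintype.bijective_iff_injective_and_card]
  refine ⟨?_, by simp [Fintype.card_perm, Nat.factorial_succ]⟩
  rintro ⟨i, σ⟩ ⟨j, τ⟩ h
  have h0 : i = j := by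
    have := congrArg (fun e : Equiv.Perm (Fin (n + 1)) => e 0) h
    simpa [Equiv.Perm.inv_def] using this
  subst h0
  exact congrArg (Prod.mk i) (consPerm_injective (mul_left_cancel h))

lemma sum_perm_succ {X : Type*} [AddCommMonoid X] {n : ℕ} (s : Equiv.Perm (Fin (n + 1)) → X) :
    ∑ σ, s σ = ∑ i, ∑ τ, s ((Fin.cycleRange i)⁻¹ * consPerm τ) := by
  rw [← Fintype.sum_prod_type']
  exact (Function.Bijective.sum_comp (cycleRange_symm_mul_consPerm_bijective n) s).symm

/-- The other cosets, by inversion: here the factor that fixes `0` acts last, as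
`compL_permAct_left` requires. -/
lemma sum_perm_succ' {X : Type*} [AddCommMonoid X] {n : ℕ} (s : Equiv.Perm (Fin (n + 1)) → X) :
    ∑ σ, s σ = ∑ i, ∑ τ, s (consPerm τ * Fin.cycleRange i) := by
  have hinv : ∀ τ : Equiv.Perm (Fin n), (consPerm τ)⁻¹ = consPerm τ⁻¹ := by
    intro τ
    rw [inv_eq_iff_mul_eq_one]
    ext i
    induction i using Fin.cases <;> simp
  rw [← Equiv.sum_comp (Equiv.inv _) s, sum_perm_succ]
  refine Finset.sum_congr rfl fun i _ => ?_
  rw [← Equiv.sum_comp (Equiv.inv _)]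
  refine Finset.sum_congr rfl fun τ _ => congrArg s ?_
  simp [hinv]

/-- This product of cycles lists all positions but `i` in their order, and then `i`: it is the `(p,
1)`-shuffle with last value `i`. -/
lemma cycleRange_symm_mul_last_castSucc {p : ℕ} (i : Fin (p + 1)) (j : Fin p) :
    ((Fin.cycleRange i)⁻¹ * Fin.cycleRange (Fin.last p)) j.castSucc = i.succAbove j := by
  have : Fin.cycleRange (Fin.last p) j.castSucc = j.succ := by
    rw [Fin.cycleRange_last, finRotate_apply, Fin.coeSucc_eq_succ]
  rw [Equiv.Perm.mul_apply, this, Equiv.Perm.inv_def, Fin.cycleRange_symm_succ]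

lemma cycleRange_symm_mul_last_last {p : ℕ} (i : Fin (p + 1)) :
    ((Fin.cycleRange i)⁻¹ * Fin.cycleRange (Fin.last p)) (Fin.last p) = i := by
  rw [Equiv.Perm.mul_apply, Fin.cycleRange_self, Equiv.Perm.inv_def, Fin.cycleRange_symm_zero]

lemma strictMono_eq_of_range {n m : ℕ} {f f' : Fin n → Fin m} (hf : StrictMono f)
    (hf' : StrictMono f') (h : Set.range f = Set.range f') : f = f' :=
  (StrictMono.range_inj hf hf').1 h

/-- The `(p, 1)`-shuffles. -/
lemma sum_shuffle_one {X : Type*} [AddCommMonoid X] {p : ℕ} (s : Equiv.Perm (Fin (p + 1)) → X) :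
    ∑ σ : Equiv.Perm (Fin (p + 1)) with IsShuffle p σ, s σ =
      ∑ i, s ((Fin.cycleRange i)⁻¹ * Fin.cycleRange (Fin.last p)) := by
  symm
  refine Finset.sum_bij (fun i _ => (Fin.cycleRange i)⁻¹ * Fin.cycleRange (Fin.last p))
    ?_ ?_ ?_ (fun _ _ => rfl)
  · intro i _
    rw [Finset.mem_filter]
    refine ⟨Finset.mem_univ _, fun a b hab h => ?_⟩
    induction a using Fin.lastCases with
    | last => exact absurd hab (Fin.le_last b).not_gt
    | cast a =>
      induction b using Fin.lastCases with
      | last => simp at h; have := a.2; omega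
      | cast b =>
        rw [cycleRange_symm_mul_last_castSucc, cycleRange_symm_mul_last_castSucc]
        exact Fin.strictMono_succAbove i (by simpa using hab)
  · intro i _ j _ h
    rw [← cycleRange_symm_mul_last_last i, h, cycleRange_symm_mul_last_last]
  · intro σ hσ
    rw [Finset.mem_filter] at hσ
    -- A `(p, 1)`-shuffle is determined by its last value, since the others increase and fill the
    -- complement.
    refine ⟨σ (Fin.last p), Finset.mem_univ _, ?_⟩
    have hm : StrictMono fun j : Fin p => σ j.castSucc := fun a b hab =>
      hσ.2 _ _ (by simpa using hab) (Or.inl (by simp))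
    have := strictMono_eq_of_range hm (Fin.strictMono_succAbove (σ (Fin.last p))) (by
      rw [Fin.range_succAbove]
      ext x
      simp only [Set.mem_range, Set.mem_compl_iff, Set.mem_singleton_iff]
      constructor
      · rintro ⟨j, rfl⟩ h
        exact (Fin.castSucc_lt_last j).ne (σ.injective h)
      · intro hx
        obtain ⟨y, rfl⟩ := σ.surjective x
        induction y using Fin.lastCases with
        | last => exact absurd rfl hx
        | cast y => exact ⟨y, rfl⟩)
    ext j
    induction j using Fin.lastCases with
    | last => rw [cycleRange_symm_mul_last_last]
    | cast j => rw [cycleRange_symm_mul_last_castSucc, ← congrFun this j]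

/-- The permutation that lists the positions in the order `i, i.succAbove j, …`. -/
def pairPerm {r : ℕ} (i : Fin (r + 2)) (j : Fin (r + 1)) : Equiv.Perm (Fin (r + 2)) :=
  (Fin.cycleRange i)⁻¹ * consPerm (Fin.cycleRange j)⁻¹

lemma pairPerm_zero {r : ℕ} (i : Fin (r + 2)) (j : Fin (r + 1)) : pairPerm i j 0 = i := by
  simp [pairPerm, Equiv.Perm.inv_def]

lemma pairPerm_succ {r : ℕ} (i : Fin (r + 2)) (j : Fin (r + 1)) (l : Fin (r + 1)) :
    pairPerm i j l.succ = i.succAbove ((Fin.cycleRange j).symm l) := by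
  simp [pairPerm, Equiv.Perm.inv_def]

lemma pairPerm_one {r : ℕ} (i : Fin (r + 2)) (j : Fin (r + 1)) :
    pairPerm i j 1 = i.succAbove j := by
  rw [← Fin.succ_zero_eq_one, pairPerm_succ, Fin.cycleRange_symm_zero]

lemma pairPerm_succ_succ {r : ℕ} (i : Fin (r + 2)) (j : Fin (r + 1)) (l : Fin r) :
    pairPerm i j l.succ.succ = i.succAbove (j.succAbove l) := by
  rw [pairPerm_succ, Fin.cycleRange_symm_succ]

lemma lt_succAbove {r : ℕ} (i : Fin (r + 2)) (j : Fin (r + 1)) :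
    i < i.succAbove j ↔ i ≤ j.castSucc := Fin.lt_succAbove_iff_le_castSucc i j

/-- The `(2, r)`-shuffles. -/
lemma sum_shuffle_two {X : Type*} [AddCommMonoid X] {r : ℕ} (s : Equiv.Perm (Fin (r + 2)) → X) :
    ∑ σ : Equiv.Perm (Fin (r + 2)) with IsShuffle 2 σ, s σ =
      ∑ i : Fin (r + 2), ∑ j : Fin (r + 1), if i ≤ j.castSucc then s (pairPerm i j) else 0 := by
  rw [← Fintype.sum_prod_type', ← Finset.sum_filter]
  symm
  refine Finset.sum_bij (fun x _ => pairPerm x.1 x.2) ?_ ?_ ?_ (fun _ _ => rfl)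
  · rintro ⟨i, j⟩ h
    rw [Finset.mem_filter] at h ⊢
    refine ⟨Finset.mem_univ _, fun a b hab h' => ?_⟩
    induction a using Fin.cases with
    | zero =>
      have hb : b = 1 := by
        refine Fin.ext ?_
        simp only [Fin.lt_def, Fin.val_zero, Fin.val_one] at *
        omega
      rw [hb, pairPerm_zero, pairPerm_one, lt_succAbove]
      exact h.2
    | succ a =>
      induction b using Fin.cases with
      | zero => exact absurd hab (Fin.zero_le _).not_gt
      | succ b =>
        induction a using Fin.cases with
        | zero =>
          simp only [Fin.lt_def, Fin.val_zero, Fin.val_succ] at *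
          omega
        | succ a =>
          induction b using Fin.cases with
          | zero => simp [Fin.lt_def] at hab
          | succ b =>
            rw [pairPerm_succ_succ, pairPerm_succ_succ]
            exact Fin.strictMono_succAbove i (Fin.strictMono_succAbove j (by simpa using hab))
  · rintro ⟨i, j⟩ _ ⟨i', j'⟩ _ h
    have h0 : i = i' := by
      rw [← pairPerm_zero i j, h, pairPerm_zero]
    subst h0
    have h1 : i.succAbove j = i.succAbove j' := by
      rw [← pairPerm_one i j, h, pairPerm_one]
    rw [Fin.succAbove_right_injective h1]
  · intro σ hσ
    rw [Finset.mem_filter] at hσ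
    -- A `(2, r)`-shuffle is determined by its first two values, for the same reason.
    have h01 : σ 0 < σ 1 := hσ.2 0 1 (by simp) (Or.inl (by simp))
    obtain ⟨j, hj⟩ := Fin.exists_succAbove_eq h01.ne'
    refine ⟨(σ 0, j), ?_, ?_⟩
    · rw [Finset.mem_filter]
      refine ⟨Finset.mem_univ _, ?_⟩
      rw [← lt_succAbove, hj]
      exact h01
    · have hm : StrictMono fun l : Fin r => σ l.succ.succ := fun a b hab =>
        hσ.2 _ _ (by simpa using hab) (Or.inr (by simp))
      have hm' : StrictMono fun l : Fin r => (σ 0).succAbove (j.succAbove l) := fun a b hab =>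
        Fin.strictMono_succAbove _ (Fin.strictMono_succAbove j hab)
      have := strictMono_eq_of_range hm hm' (by
        ext x
        simp only [Set.mem_range]
        constructor
        · rintro ⟨l, rfl⟩
          have h0 : σ l.succ.succ ≠ σ 0 := fun h => Fin.succ_ne_zero _ (σ.injective h)
          obtain ⟨l', hl'⟩ := Fin.exists_succAbove_eq h0
          have h1 : l' ≠ j := by
            rintro rfl
            rw [hj] at hl'
            exact Fin.succ_ne_zero l (Fin.succ_injective _ (σ.injective hl').symm)
          obtain ⟨l'', rfl⟩ := Fin.exists_succAbove_eq h1
          exact ⟨l'', hl'⟩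
        · rintro ⟨l, rfl⟩
          obtain ⟨y, hy⟩ := σ.surjective ((σ 0).succAbove (j.succAbove l))
          rw [← hy]
          induction y using Fin.cases with
          | zero => exact absurd hy.symm (Fin.succAbove_ne _ _)
          | succ y =>
            induction y using Fin.cases with
            | zero =>
              rw [Fin.succ_zero_eq_one, ← hj] at hy
              exact absurd (Fin.succAbove_right_injective hy).symm (Fin.succAbove_ne _ _)
            | succ y => exact ⟨y, rfl⟩)
      ext l
      induction l using Fin.cases with
      | zero => rw [pairPerm_zero]
      | succ l =>
        induction l using Fin.cases with
        | zero => rw [Fin.succ_zero_eq_one, pairPerm_one, hj]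
        | succ l => rw [pairPerm_succ_succ, ← congrFun this l]

end Permutations

/-! ### Antisymmetrization and its reduction to cosets -/

section Antisymmetrization
variable {k H : Type*} [Field k] [Ring H] [HopfAlgebra k H] [Coalgebra.IsCocomm k H]
variable {L M : Type*} [AddCommGroup L] [Module k L] [Module H L] [IsScalarTower k H L]
  [AddCommGroup M] [Module k M] [Module H M] [IsScalarTower k H M]

lemma mem_Alt_iff {p : ℕ} {f : PHom k H p L M} : f ∈ Alt k H p L M ↔
    ∀ σ : Equiv.Perm (Fin p), PHom.permAct σ f = (Equiv.Perm.sign σ : ℤ) • f := by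
  refine forall_congr' fun σ => ⟨fun h => ?_, fun h => ?_⟩
  · conv_rhs => rw [h]
    rw [smul_smul, ← Units.val_mul, Int.units_mul_self, Units.val_one, one_smul]
  · rw [h, smul_smul, ← Units.val_mul, Int.units_mul_self, Units.val_one, one_smul]

/-- The antisymmetrization of an operation. -/
def antisym (n : ℕ) : PHom k H n L M →ₗ[k] PHom k H n L M :=
  ∑ σ : Equiv.Perm (Fin n), (Equiv.Perm.sign σ : ℤ) • PHom.permAct σ

lemma antisym_apply {n : ℕ} (f : PHom k H n L M) :
    antisym n f = ∑ σ : Equiv.Perm (Fin n), (Equiv.Perm.sign σ : ℤ) • PHom.permAct σ f := by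
  rw [antisym, LinearMap.sum_apply]
  rfl

lemma antisym_permAct {n : ℕ} (τ : Equiv.Perm (Fin n)) (f : PHom k H n L M) :
    antisym n (PHom.permAct τ f) = (Equiv.Perm.sign τ : ℤ) • antisym n f := by
  rw [antisym_apply, antisym_apply, Finset.smul_sum, ← Equiv.sum_comp (Equiv.mulRight τ)
    fun σ => (Equiv.Perm.sign τ : ℤ) • (Equiv.Perm.sign σ : ℤ) • PHom.permAct σ f]
  refine Finset.sum_congr rfl fun σ _ => ?_
  rw [Equiv.coe_mulRight, map_mul, PHom.permAct_mul, smul_smul, ← Units.val_mul, mul_comm,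
    mul_assoc, Int.units_mul_self, mul_one]

lemma permAct_antisym {n : ℕ} (τ : Equiv.Perm (Fin n)) (f : PHom k H n L M) :
    PHom.permAct τ (antisym n f) = (Equiv.Perm.sign τ : ℤ) • antisym n f := by
  rw [antisym_apply, map_sum, Finset.smul_sum, ← Equiv.sum_comp (Equiv.mulLeft τ)
    fun σ => (Equiv.Perm.sign τ : ℤ) • (Equiv.Perm.sign σ : ℤ) • PHom.permAct σ f]
  refine Finset.sum_congr rfl fun σ _ => ?_
  rw [Equiv.coe_mulLeft, map_mul, PHom.permAct_mul, smul_smul, ← Units.val_mul, ← mul_assoc,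
    Int.units_mul_self, one_mul, map_zsmul]

lemma antisym_mem_Alt {n : ℕ} (f : PHom k H n L M) : antisym n f ∈ Alt k H n L M :=
  mem_Alt_iff.2 fun τ => permAct_antisym τ f

lemma sign_cycleRange_inv {n : ℕ} (i : Fin n) :
    ((Equiv.Perm.sign (Fin.cycleRange i)⁻¹ : ℤˣ) : ℤ) = (-1) ^ (i : ℕ) := by
  rw [Equiv.Perm.sign_inv, Fin.sign_cycleRange]
  simp

lemma sign_pairPerm {r : ℕ} (i : Fin (r + 2)) (j : Fin (r + 1)) :
    ((Equiv.Perm.sign (pairPerm i j) : ℤˣ) : ℤ) = (-1) ^ ((i : ℕ) + j) := by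
  rw [pairPerm, map_mul, Units.val_mul, sign_cycleRange_inv, sign_consPerm, sign_cycleRange_inv,
    pow_add]

/-- If `f` is already skew in the positions after the first, the summands are constant on each coset
of the stabilizer of `0`, which has `n!` elements. -/
lemma antisym_eq_sum_cycleRange {n : ℕ} {f : PHom k H (n + 1) L M}
    (hf : ∀ τ : Equiv.Perm (Fin n),
      PHom.permAct (consPerm τ) f = (Equiv.Perm.sign τ : ℤ) • f) :
    antisym (n + 1) f = n.factorial • ∑ i : Fin (n + 1), (-1 : ℤ) ^ (i : ℕ) •
      PHom.permAct (Fin.cycleRange i)⁻¹ f := by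
  rw [antisym_apply, sum_perm_succ, Finset.smul_sum]
  refine Finset.sum_congr rfl fun i _ => ?_
  rw [Finset.sum_congr rfl fun τ _ => ?_, Finset.sum_const, Finset.card_univ, Fintype.card_perm,
    Fintype.card_fin]
  rw [map_mul, PHom.permAct_mul, hf, map_zsmul, smul_smul, ← Units.val_mul, sign_consPerm,
    mul_assoc, Int.units_mul_self, mul_one, sign_cycleRange_inv]

/-- Sorts the permutations by the position `i` that is brought to the front; no symmetry of `f` is
required. -/
lemma antisym_eq_sum_consPerm {n : ℕ} (f : PHom k H (n + 1) L M) :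
    antisym (n + 1) f = ∑ i : Fin (n + 1), (-1 : ℤ) ^ (i : ℕ) • ∑ τ : Equiv.Perm (Fin n),
      (Equiv.Perm.sign τ : ℤ) • PHom.permAct (consPerm τ) (PHom.permAct (Fin.cycleRange i) f) := by
  rw [antisym_apply, sum_perm_succ']
  refine Finset.sum_congr rfl fun i _ => ?_
  rw [Finset.smul_sum]
  refine Finset.sum_congr rfl fun τ _ => ?_
  rw [map_mul, PHom.permAct_mul, smul_smul, sign_consPerm, Fin.sign_cycleRange, mul_comm]
  simp

/-- The summands are constant on the cosets of `S₂ × S_r`, of order `2 r!`, which the `(2,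
r)`-shuffles represent. -/
lemma antisym_eq_sum_pairPerm {r : ℕ} {f : PHom k H (r + 2) L M}
    (hf : PHom.permAct (Equiv.swap 0 1) f = -f)
    (hf' : ∀ τ : Equiv.Perm (Fin r),
      PHom.permAct (consPerm (consPerm τ)) f = (Equiv.Perm.sign τ : ℤ) • f) :
    antisym (r + 2) f = (2 * r.factorial) • ∑ i : Fin (r + 2), ∑ j : Fin (r + 1),
      if i ≤ j.castSucc then (-1 : ℤ) ^ ((i : ℕ) + j) • PHom.permAct (pairPerm i j) f else 0 := by
  set s : Equiv.Perm (Fin (r + 2)) → PHom k H (r + 2) L M :=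
    fun σ => (Equiv.Perm.sign σ : ℤ) • PHom.permAct σ f with hs
  have hswap : ∀ σ, s (σ * Equiv.swap 0 1) = s σ := by
    intro σ
    have h01 : (0 : Fin (r + 2)) ≠ 1 := by simp
    simp only [hs, PHom.permAct_mul, hf, map_mul, Equiv.Perm.sign_swap h01]
    simp
  have hcons : ∀ σ τ, s (σ * consPerm (consPerm τ)) = s σ := by
    intro σ τ
    simp only [hs, PHom.permAct_mul, hf', map_mul, sign_consPerm, map_zsmul]
    rw [smul_smul, ← Units.val_mul, mul_assoc, Int.units_mul_self, mul_one]
  -- Pairing `σ` with `σ * (0 1)` leaves the permutations with `σ 0 < σ 1`; this condition becomes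
  -- `i ≤ j` below.
  have h1 : ∑ σ, s σ = 2 • ∑ σ with σ 0 < σ 1, s σ := by
    rw [two_nsmul]
    conv_lhs => rw [← Finset.sum_filter_add_sum_filter_not _ (fun σ => σ 0 < σ 1)]
    congr 1
    refine Finset.sum_bij (fun σ _ => σ * Equiv.swap 0 1) (fun σ hσ => ?_)
      (fun _ _ _ _ h => mul_right_cancel h) (fun σ hσ => ⟨σ * Equiv.swap 0 1, ?_, ?_⟩)
      (fun σ _ => (hswap σ).symm)
    · simp only [Finset.mem_filter, Finset.mem_univ, true_and, Equiv.Perm.mul_apply,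
        Equiv.swap_apply_left, Equiv.swap_apply_right, not_lt] at hσ ⊢
      exact lt_of_le_of_ne hσ (σ.injective.ne (by simp))
    · simp only [Finset.mem_filter, Finset.mem_univ, true_and, Equiv.Perm.mul_apply,
        Equiv.swap_apply_left, Equiv.swap_apply_right, not_lt] at hσ ⊢
      exact hσ.le
    · rw [mul_assoc, Equiv.swap_mul_self, mul_one]
  rw [antisym_apply]
  change ∑ σ, s σ = _
  rw [h1, mul_smul, Finset.sum_filter, sum_perm_succ]
  congr 1
  rw [Finset.smul_sum]
  refine Finset.sum_congr rfl fun i _ => ?_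
  rw [sum_perm_succ, Finset.smul_sum]
  refine Finset.sum_congr rfl fun j _ => ?_
  have hτ : ∀ τ : Equiv.Perm (Fin r), (Fin.cycleRange i)⁻¹ *
      consPerm ((Fin.cycleRange j)⁻¹ * consPerm τ) = pairPerm i j * consPerm (consPerm τ) := by
    intro τ
    rw [pairPerm, mul_assoc]
    congr 1
    ext l
    induction l using Fin.cases <;> simp
  simp only [hτ, hcons, Equiv.Perm.mul_apply, consPerm_zero]
  have h1 : ∀ τ : Equiv.Perm (Fin r), consPerm (consPerm τ) 1 = 1 := by
    intro τ
    rw [← Fin.succ_zero_eq_one, consPerm_succ, consPerm_zero]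
  simp only [h1, pairPerm_zero, pairPerm_one, lt_succAbove]
  rw [Finset.sum_const, Finset.card_univ, Fintype.card_perm, Fintype.card_fin, ← sign_pairPerm]

end Antisymmetrization

/-! ### Circle products with an operation of two variables -/

section Circ
variable {k H : Type*} [Field k] [Ring H] [HopfAlgebra k H] [Coalgebra.IsCocomm k H]
variable {L : Type*} [AddCommGroup L] [Module k L] [Module H L] [IsScalarTower k H L]

lemma circ_apply {p q n : ℕ} (hn : n + 1 = p + 1 + q) (hn' : q + p = n)
    (f : PHom k H (p + 1) L L) (u : PHom k H q L L) :
    circ hn f u = ∑ σ : Equiv.Perm (Fin n) with IsShuffle q σ,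
      (Equiv.Perm.sign σ : ℤ) • PHom.permAct σ (PHom.compL hn' f u) := by
  simp only [circ, LinearMap.sum_apply]
  rfl

/-- The shuffle with last value `i` is a product of two cycles, of signs `(-1)^i` and `(-1)^p`. -/
lemma circ_two_left {p : ℕ} (hn : p + 1 + 1 = 2 + p) (B : PHom k H 2 L L) (f : PHom k H p L L) :
    circ hn B f = (-1 : ℤ) ^ p • ∑ i : Fin (p + 1), (-1 : ℤ) ^ (i : ℕ) •
      PHom.permAct (Fin.cycleRange i)⁻¹
        (PHom.permAct (Fin.cycleRange (Fin.last p)) (PHom.compL (p := 1) rfl B f)) := by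
  rw [circ_apply (p := 1) hn rfl, sum_shuffle_one, Finset.smul_sum]
  refine Finset.sum_congr rfl fun i _ => ?_
  rw [map_mul, PHom.permAct_mul, smul_smul, Units.val_mul, sign_cycleRange_inv,
    Fin.sign_cycleRange, mul_comm]
  simp

lemma circ_two_right {r : ℕ} (hn : r + 2 + 1 = r + 1 + 2) (f : PHom k H (r + 1) L L)
    (B : PHom k H 2 L L) :
    circ hn f B = ∑ i : Fin (r + 2), ∑ j : Fin (r + 1), if i ≤ j.castSucc then
      (-1 : ℤ) ^ ((i : ℕ) + j) • PHom.permAct (pairPerm i j)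
        (PHom.compL (Nat.add_comm 2 r) f B) else 0 := by
  rw [circ_apply hn (Nat.add_comm 2 r), sum_shuffle_two]
  simp only [sign_pairPerm]

end Circ

/-! ### Brackets with a semidirect product and the Chevalley–Eilenberg operator -/

section Semidirect
variable {k H : Type*} [Field k] [Ring H] [HopfAlgebra k H] [Coalgebra.IsCocomm k H]
variable {L M L' M' g h : Type*} [AddCommGroup L] [Module k L] [Module H L] [IsScalarTower k H L]
  [AddCommGroup M] [Module k M] [Module H M] [IsScalarTower k H M]
  [AddCommGroup L'] [Module k L'] [Module H L'] [IsScalarTower k H L']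
  [AddCommGroup M'] [Module k M'] [Module H M'] [IsScalarTower k H M']
  [AddCommGroup g] [Module k g] [Module H g] [IsScalarTower k H g]
  [AddCommGroup h] [Module k h] [Module H h] [IsScalarTower k H h]

lemma PHom.comp_apply {p : ℕ} (u : L' →ₗ[H] L) (w : M →ₗ[H] M') (f : PHom k H p L M)
    (x : Fin p → L') : (PHom.comp u w f).1 x = PT.map w (f.1 fun i => u (x i)) := rfl

lemma PHom.comp_insL {q p n : ℕ} (hn : q + p = n) (u : L' →ₗ[H] L) (w : M →ₗ[H] M')
    (f : PHom k H (p + 1) L M) (x : Fin p → L') (z : PT k H q L') :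
    (PHom.comp u w f).insL hn x z =
      PT.map w (f.insL hn (fun i => u (x i)) (PT.map u z)) := by
  induction z using PT.induction with
  | hmk a y =>
    have : (fun i => u ((Fin.cons y x : Fin (p + 1) → L') i)) = Fin.cons (u y) fun i => u (x i) := by
      funext i
      induction i using Fin.cases <;> rfl
    rw [PT.map_mk, insL_mk, insL_mk, comp_apply, this, PT.pull_map, PT.map_smul']
  | hadd z z' hz hz' => simp only [_root_.map_add, hz, hz']

lemma PHom.comp_permAct {p : ℕ} (u : L' →ₗ[H] L) (w : M →ₗ[H] M') (σ : Equiv.Perm (Fin p))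
    (f : PHom k H p L M) : PHom.comp u w (permAct σ f) = permAct σ (PHom.comp u w f) :=
  PHom.ext (funext fun x => by
    rw [comp_apply, permAct_apply, permAct_apply, comp_apply, PT.perm_map]
    rfl)

lemma liftG_permAct {p : ℕ} (σ : Equiv.Perm (Fin p)) (f : PHom k H p g h) :
    liftG k H g h p (PHom.permAct σ f) = PHom.permAct σ (liftG k H g h p f) :=
  PHom.comp_permAct _ _ _ _

lemma projG_liftG {p : ℕ} (f : PHom k H p g h) : projG k H g h p (liftG k H g h p f) = f :=
  PHom.ext (funext fun _ => PT.map_snd_inr _)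

/-- The lift of `f` takes values in `h`, so only the flipped copy of `ρ` contributes, with its sign;
the cycle undoes the flip. -/
lemma permAct_compL_semidirect {p : ℕ} (β : PBil k H g g g) (ρ : PBil k H g h h)
    (f : PHom k H p g h) :
    PHom.permAct (Fin.cycleRange (Fin.last p))
        (PHom.compL (p := 1) rfl (semidirect β ρ).toPHom (liftG k H g h p f)) =
      -liftG k H g h (p + 1) (ρ.compR f) := by
  refine PHom.ext (funext fun x => ?_)
  have hR : ∀ j : Fin 1, Fin.cycleRange (Fin.last p) (blockR rfl j) = 0 := by
    intro j
    have : (blockR rfl j : Fin (p + 1)) = Fin.last p := Fin.ext (by simp [blockR])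
    rw [this, Fin.cycleRange_self]
  have hL : ∀ j : Fin p, Fin.cycleRange (Fin.last p) (blockL rfl j) = j.succ := by
    intro j
    change Fin.cycleRange (Fin.last p) j.castSucc = _
    rw [Fin.cycleRange_last, finRotate_apply, Fin.coeSucc_eq_succ]
  rw [PHom.permAct_apply, PHom.compL_apply, PBil.toPHom_insL, PHom.neg_apply]
  simp only [Function.comp_apply, hR, hL]
  change _ = -PT.map _ (ρ.insR (x 0).1 (f.1 fun i => (x i.succ).1))
  change PT.perm _ (PBil.insL _ _ (PT.map _ (f.1 fun i => (x i.succ).1))) = _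
  generalize (f.1 fun i => (x i.succ).1) = z
  simp only [semidirect, PBil.add_insL, PBil.sub_insL, map_flip_insL, PBil.insL_comp,
    PT.map_fst_inr, PT.map_snd_inr, map_zero, zero_add, zero_sub, map_neg, PT.perm_map,
    PT.perm_perm, mul_inv_cancel, PT.perm_one]

/-- A lifted cochain sees only the `g`-component of its entries, and that of the semidirect product
is `β`. -/
lemma compL_liftG {r : ℕ} (β : PBil k H g g g) (ρ : PBil k H g h h) (f : PHom k H (r + 1) g h) :
    PHom.compL (Nat.add_comm 2 r) (liftG k H g h (r + 1) f) (semidirect β ρ).toPHom =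
      liftG k H g h (r + 2) (PHom.compL (Nat.add_comm 2 r) f β.toPHom) := by
  refine PHom.ext (funext fun x => ?_)
  rw [PHom.compL_apply, liftG, PHom.comp_insL]
  change PT.map _ (f.insL _ _ (PT.map _ ((semidirect β ρ).1 _ _))) = _
  rw [map_fst_semidirect]
  rfl

/-- The bracket with a semidirect product is the Chevalley–Eilenberg operator up to sign. -/
lemma nr_semidirect (β : PBil k H g g g) (ρ : PBil k H g h h) {p : ℕ}
    (hn : p + 1 + 1 = 2 + p) (f : PHom k H p g h) :
    nr hn (semidirect β ρ).toPHom (liftG k H g h p f) =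
      (-1 : ℤ) ^ (p + 1) • liftG k H g h (p + 1) (ceDiff β ρ p f) := by
  have h1 : circ hn (semidirect β ρ).toPHom (liftG k H g h p f) = (-1 : ℤ) ^ (p + 1) •
      liftG k H g h (p + 1) (∑ i : Fin (p + 1), (-1 : ℤ) ^ (i : ℕ) •
        PHom.permAct (Fin.cycleRange i)⁻¹ (ρ.compR f)) := by
    rw [circ_two_left, permAct_compL_semidirect]
    simp only [map_sum, map_zsmul, liftG_permAct, map_neg, smul_neg, Finset.sum_neg_distrib,
      pow_succ, mul_neg, mul_one, neg_smul]
  have h2 : nr hn (semidirect β ρ).toPHom (liftG k H g h p f) =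
      circ hn (semidirect β ρ).toPHom (liftG k H g h p f) - (-1 : ℤ) ^ ((2 + 1) * (p + 1)) •
        circ (hn.trans (Nat.add_comm 2 p)) (liftG k H g h p f) (semidirect β ρ).toPHom := rfl
  rw [h2, h1]
  -- For `p = 0` the circle product with `f` on the left is zero by convention, and the operator has
  -- only its `ρ` term.
  cases p with
  | zero =>
    have h3 : circ (hn.trans (Nat.add_comm 2 0)) (liftG k H g h 0 f) (semidirect β ρ).toPHom =
      0 := rfl
    rw [h3, smul_zero, sub_zero]
    simp [ceDiff, PHom.permAct_one]
  | succ r =>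
    rw [circ_two_right, compL_liftG]
    -- The pair consists of the positions `i` and `j + 1`, so its sign `(-1)^(i + j + 1)` is
    -- opposite to that of the shuffle.
    have h3 : ceDiff β ρ (r + 1) f = ∑ i : Fin (r + 2), (-1 : ℤ) ^ (i : ℕ) •
        PHom.permAct (Fin.cycleRange i)⁻¹ (ρ.compR f) -
        ∑ i : Fin (r + 2), ∑ j : Fin (r + 1), if i ≤ j.castSucc then
          (-1 : ℤ) ^ ((i : ℕ) + j) • PHom.permAct (pairPerm i j)
            (PHom.compL (Nat.add_comm 2 r) f β.toPHom) else 0 := by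
      rw [ceDiff, LinearMap.add_apply, sub_eq_add_neg]
      simp only [LinearMap.sum_apply, ← Finset.sum_neg_distrib]
      congr 1
      refine Finset.sum_congr rfl fun i _ => Finset.sum_congr rfl fun j _ => ?_
      split_ifs
      · rw [pow_succ, mul_neg, mul_one, neg_smul]
        rfl
      · rw [neg_zero]; rfl
    rw [h3, map_sub, smul_sub]
    congr 1
    have h4 : (-1 : ℤ) ^ ((2 + 1) * (r + 1 + 1)) = (-1) ^ (r + 1 + 1) := by
      rw [pow_mul]; norm_num
    rw [h4]
    simp only [map_sum, apply_ite (liftG k H g h (r + 2)), map_zero, map_zsmul, liftG_permAct]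

end Semidirect

/-! ### Factorizations of block permutations -/

section Positions

lemma consPerm_mul_cycleRange_last {p : ℕ} (τ : Equiv.Perm (Fin p)) :
    consPerm τ * Fin.cycleRange (Fin.last p) =
      Fin.cycleRange (Fin.last p) * blockPerm rfl τ 1 := by
  have hL : ∀ j : Fin p, Fin.cycleRange (Fin.last p) (blockL rfl j) = j.succ := by
    intro j
    change Fin.cycleRange (Fin.last p) j.castSucc = _
    rw [Fin.cycleRange_last, finRotate_apply, Fin.coeSucc_eq_succ]
  have hR : ∀ j : Fin 1, Fin.cycleRange (Fin.last p) (blockR rfl j) = 0 := by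
    intro j
    have : (blockR rfl j : Fin (p + 1)) = Fin.last p := Fin.ext (by simp [blockR])
    rw [this, Fin.cycleRange_self]
  refine DFunLike.coe_injective (funext_block (p := 1) rfl (fun i => ?_) fun i => ?_)
  · rw [Equiv.Perm.mul_apply, Equiv.Perm.mul_apply, blockPerm_blockL, hL, hL, consPerm_succ]
  · rw [Equiv.Perm.mul_apply, Equiv.Perm.mul_apply, blockPerm_blockR, hR, hR, consPerm_zero]

lemma cycleRange_castSucc {p : ℕ} (j : Fin p) :
    Fin.cycleRange j.castSucc = blockPerm rfl (Fin.cycleRange j) 1 := by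
  cases p with
  | zero => exact j.elim0
  | succ p =>
    refine DFunLike.coe_injective (funext_block (p := 1) rfl (fun i => ?_) fun i => ?_)
    · rw [blockPerm_blockL]
      refine Fin.ext ?_
      simp only [val_cycleRange, blockL, Fin.val_castSucc]
    · rw [blockPerm_blockR]
      refine Fin.ext ?_
      have := j.2
      simp only [val_cycleRange, blockR, Fin.val_castSucc, Equiv.Perm.one_apply]
      split_ifs <;> omega

lemma swap_eq_blockPerm (r : ℕ) :
    Equiv.swap (0 : Fin (r + 2)) 1 = blockPerm (Nat.add_comm 2 r) (Equiv.swap 0 1) 1 := by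
  have h0 : (0 : Fin (r + 2)) = blockL (Nat.add_comm 2 r) 0 := rfl
  have h1 : (1 : Fin (r + 2)) = blockL (Nat.add_comm 2 r) 1 := Fin.ext (by simp [blockL])
  refine DFunLike.coe_injective (funext_block (Nat.add_comm 2 r) (fun i => ?_) fun i => ?_)
  · rw [blockPerm_blockL, h0, h1]
    exact ((blockL_injective (Nat.add_comm 2 r)).map_swap 0 1 i).symm
  · rw [blockPerm_blockR, h0, h1, Equiv.swap_apply_of_ne_of_ne
      (blockL_ne_blockR _ _ _).symm (blockL_ne_blockR _ _ _).symm]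
    rfl

lemma consPerm_consPerm_eq_blockPerm {r : ℕ} (τ : Equiv.Perm (Fin r)) :
    consPerm (consPerm τ) = blockPerm (Nat.add_comm 2 r) 1 τ := by
  refine DFunLike.coe_injective (funext_block (Nat.add_comm 2 r) (fun i => ?_) fun i => ?_)
  · rw [blockPerm_blockL]
    fin_cases i
    · exact consPerm_zero _
    · have : blockL (Nat.add_comm 2 r) 1 = Fin.succ (0 : Fin (r + 1)) :=
        Fin.ext (by simp [blockL])
      change consPerm (consPerm τ) (blockL _ 1) = blockL _ 1
      rw [this, consPerm_succ, consPerm_zero]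
  · have : ∀ i, blockR (Nat.add_comm 2 r) i = i.succ.succ := fun i =>
      Fin.ext (by simp only [blockR, Fin.val_succ]; omega)
    rw [blockPerm_blockR, this, this, consPerm_succ, consPerm_succ]

/-- A later entry is first brought to the head of the second block, then to the front. The first
move is absorbed by the skew-symmetry of the outer operation, so only position `2` needs study. -/
lemma cycleRange_succ_succ {r : ℕ} (j : Fin (r + 1)) :
    Fin.cycleRange j.succ.succ =
      Fin.cycleRange 2 * blockPerm (Nat.add_comm 2 (r + 1)) 1 (Fin.cycleRange j) := by
  have h2 : ((2 : Fin (r + 1 + 2)) : ℕ) = 2 := rfl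
  refine DFunLike.coe_injective (funext_block (Nat.add_comm 2 (r + 1)) (fun i => ?_) fun i => ?_)
  · rw [Equiv.Perm.mul_apply, blockPerm_blockL]
    refine Fin.ext ?_
    have := i.2
    simp only [val_cycleRange, h2, blockL, Fin.val_succ, Equiv.Perm.one_apply]
    split_ifs <;> omega
  · rw [Equiv.Perm.mul_apply, blockPerm_blockR]
    refine Fin.ext ?_
    simp only [val_cycleRange, h2, blockR, Fin.val_succ]
    split_ifs <;> omega

/-- The permutation that moves a block of `q` positions past the following two. -/
lemma exists_blockSwap {q p n : ℕ} (hn : q + 2 + p = n) : ∃ σ : Equiv.Perm (Fin n),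
    (∀ i, (σ i : ℕ) = if (i : ℕ) < q then 2 + (i : ℕ) else
      if (i : ℕ) < q + 2 then (i : ℕ) - q else (i : ℕ)) ∧
      Equiv.Perm.sign σ = 1 := by
  -- Moving `q` positions past two is the square of the cycle on the `q + 2` positions, hence even.
  refine ⟨blockPerm hn (Fin.cycleRange (Fin.last (q + 1)) * Fin.cycleRange (Fin.last (q + 1))) 1,
    fun i => ?_, ?_⟩
  · obtain ⟨j, rfl⟩ | ⟨j, rfl⟩ := PHom.block_cases hn i
    · rw [blockPerm_blockL]
      have := j.2
      simp only [blockL, Equiv.Perm.mul_apply, val_cycleRange, Fin.val_last]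
      grind
    · rw [blockPerm_blockR]
      simp only [blockR, Equiv.Perm.one_apply]
      grind
  · rw [sign_blockPerm, map_mul, Int.units_mul_self, map_one, one_mul]

end Positions

/-! ### The bracket as an antisymmetrization, and its vanishing square -/

section NijenhuisRichardson
variable {k H : Type*} [Field k] [CharZero k] [Ring H] [HopfAlgebra k H] [Coalgebra.IsCocomm k H]
variable {L M : Type*} [AddCommGroup L] [Module k L] [Module H L] [IsScalarTower k H L]
  [AddCommGroup M] [Module k M] [Module H M] [IsScalarTower k H M]

/-- A permutation of the inner variables extends to all variables with the same sign, and the outer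
antisymmetrization absorbs it. -/
lemma antisym_compL_antisym_right {q p n : ℕ} (hn : q + p = n) (f : PHom k H (p + 1) L M)
    (u : PHom k H q L L) : antisym n (PHom.compL hn f (antisym q u)) =
      q.factorial • antisym n (PHom.compL hn f u) := by
  have h : ∀ τ : Equiv.Perm (Fin q), antisym n (PHom.compL hn f
      ((Equiv.Perm.sign τ : ℤ) • PHom.permAct τ u)) = antisym n (PHom.compL hn f u) := by
    intro τ
    rw [map_zsmul, PHom.compL_permAct_right, map_zsmul, antisym_permAct, sign_blockPerm, map_one,
      mul_one, smul_smul, ← Units.val_mul, Int.units_mul_self, Units.val_one, one_smul]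
  rw [antisym_apply u, map_sum, map_sum]
  simp only [h, Finset.sum_const, Finset.card_univ, Fintype.card_perm, Fintype.card_fin]

/-- Only permutations that fix the filled slot pass to the outside. What remains is a sum over the
slots that can receive `u`. -/
lemma antisym_compL_antisym_left {s p n : ℕ} (hn : s + p = n) (f : PHom k H (p + 1) L M)
    (u : PHom k H s L L) : antisym n (PHom.compL hn (antisym (p + 1) f) u) =
      p.factorial • ∑ i : Fin (p + 1), (-1 : ℤ) ^ (i : ℕ) •
        antisym n (PHom.compL hn (PHom.permAct (Fin.cycleRange i) f) u) := by
  have h : ∀ (τ : Equiv.Perm (Fin p)) (f : PHom k H (p + 1) L M),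
      antisym n (PHom.compL hn ((Equiv.Perm.sign τ : ℤ) • PHom.permAct (consPerm τ) f) u) =
        antisym n (PHom.compL hn f u) := by
    intro τ f
    rw [map_zsmul, LinearMap.smul_apply, PHom.compL_permAct_left, map_zsmul, antisym_permAct,
      sign_blockPerm, map_one, one_mul, smul_smul, ← Units.val_mul, Int.units_mul_self,
      Units.val_one, one_smul]
  rw [antisym_eq_sum_consPerm, map_sum, LinearMap.sum_apply, map_sum, Finset.smul_sum]
  refine Finset.sum_congr rfl fun i _ => ?_
  rw [map_zsmul, LinearMap.smul_apply, map_zsmul, smul_comm p.factorial, map_sum,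
    LinearMap.sum_apply, map_sum]
  simp only [h, Finset.sum_const, Finset.card_univ, Fintype.card_perm, Fintype.card_fin]

lemma eq_inv_smul_iff {n N : ℕ} (hN : N ≠ 0) {f f' : PHom k H n L M} :
    f = (N : k)⁻¹ • f' ↔ N • f = f' := by
  rw [eq_inv_smul_iff₀ (Nat.cast_ne_zero.2 hN), Nat.cast_smul_eq_nsmul]

variable {B : PHom k H 2 L L} (hB : B ∈ Alt k H 2 L L)

/-- For skew-symmetric `f` the shuffles represent the cosets on which the summands are constant;
characteristic `0` permits division by the order `p!` of the subgroup. -/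
lemma circ_two_left_of_mem_Alt {p : ℕ} (hn : p + 1 + 1 = 2 + p) (B : PHom k H 2 L L)
    {f : PHom k H p L L} (hf : f ∈ Alt k H p L L) :
    circ hn B f = (p.factorial : k)⁻¹ • antisym (p + 1) (PHom.compL (p := 1) rfl B f) := by
  rw [eq_inv_smul_iff p.factorial_ne_zero, circ_two_left, smul_comm,
    ← antisym_eq_sum_cycleRange, antisym_permAct, Fin.sign_cycleRange, Fin.val_last, smul_smul]
  · simp [← mul_pow]
  · intro τ
    rw [← PHom.permAct_mul, consPerm_mul_cycleRange_last, PHom.permAct_mul,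
      ← PHom.compL_permAct_right, mem_Alt_iff.1 hf, map_zsmul, map_zsmul]

include hB in
lemma permAct_swap_compL {r : ℕ} (f : PHom k H (r + 1) L L) :
    PHom.permAct (Equiv.swap 0 1) (PHom.compL (Nat.add_comm 2 r) f B) =
      -PHom.compL (Nat.add_comm 2 r) f B := by
  rw [swap_eq_blockPerm, ← PHom.compL_permAct_right, mem_Alt_iff.1 hB,
    Equiv.Perm.sign_swap (by simp)]
  simp

lemma permAct_blockPerm_compL {s p n : ℕ} (hn : s + p = n) {f : PHom k H (p + 1) L L}
    (hf : f ∈ Alt k H (p + 1) L L) (u : PHom k H s L L) (τ : Equiv.Perm (Fin p)) :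
    PHom.permAct (blockPerm hn 1 τ) (PHom.compL hn f u) =
      (Equiv.Perm.sign τ : ℤ) • PHom.compL hn f u := by
  rw [← PHom.compL_permAct_left, mem_Alt_iff.1 hf, sign_consPerm, map_zsmul, LinearMap.smul_apply]

include hB in
lemma circ_two_right_of_mem_Alt {r : ℕ} (hn : r + 2 + 1 = r + 1 + 2) {f : PHom k H (r + 1) L L}
    (hf : f ∈ Alt k H (r + 1) L L) :
    circ hn f B = ((2 * r.factorial : ℕ) : k)⁻¹ •
      antisym (r + 2) (PHom.compL (Nat.add_comm 2 r) f B) := by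
  rw [eq_inv_smul_iff (mul_ne_zero two_ne_zero r.factorial_ne_zero), circ_two_right,
    ← antisym_eq_sum_pairPerm (permAct_swap_compL hB f)]
  intro τ
  rw [consPerm_consPerm_eq_blockPerm, permAct_blockPerm_compL _ hf]

lemma nr_two_zero (hn : 0 + 1 + 1 = 2 + 0) (B : PHom k H 2 L L) {f : PHom k H 0 L L}
    (hf : f ∈ Alt k H 0 L L) : nr hn B f = antisym 1 (PHom.compL (p := 1) rfl B f) := by
  have h : nr hn B f = circ hn B f - (-1 : ℤ) ^ ((2 + 1) * (0 + 1)) • (0 : PHom k H 1 L L) := rfl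
  rw [h, smul_zero, sub_zero, circ_two_left_of_mem_Alt hn B hf]
  simp

include hB in
lemma nr_two_succ {r : ℕ} (hn : r + 1 + 1 + 1 = 2 + (r + 1)) {f : PHom k H (r + 1) L L}
    (hf : f ∈ Alt k H (r + 1) L L) : nr hn B f =
      ((r + 1).factorial : k)⁻¹ • antisym (r + 2) (PHom.compL (p := 1) rfl B f) -
        (-1 : k) ^ r • ((2 * r.factorial : ℕ) : k)⁻¹ •
          antisym (r + 2) (PHom.compL (Nat.add_comm 2 r) f B) := by
  have h : nr hn B f = circ hn B f - (-1 : ℤ) ^ ((2 + 1) * (r + 1 + 1)) •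
    circ (hn.trans (Nat.add_comm 2 (r + 1))) f B := rfl
  have h4 : (-1 : ℤ) ^ ((2 + 1) * (r + 1 + 1)) = (-1) ^ r := by
    rw [pow_mul, pow_succ, pow_succ]; norm_num
  rw [h, h4, circ_two_left_of_mem_Alt hn B hf, circ_two_right_of_mem_Alt hB _ hf,
    ← Int.cast_smul_eq_zsmul k]
  simp

include hB in
lemma nr_two_mem_Alt {p : ℕ} (hn : p + 1 + 1 = 2 + p) {f : PHom k H p L L}
    (hf : f ∈ Alt k H p L L) : nr hn B f ∈ Alt k H (p + 1) L L := by
  cases p with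
  | zero => rw [nr_two_zero hn B hf]; exact antisym_mem_Alt _
  | succ r =>
    rw [nr_two_succ hB hn hf]
    exact sub_mem (Submodule.smul_mem _ _ (antisym_mem_Alt _))
      (Submodule.smul_mem _ _ (Submodule.smul_mem _ _ (antisym_mem_Alt _)))

lemma antisym_compL_antisym_compL {p : ℕ} {f : PHom k H p L L} (hf : f ∈ Alt k H p L L) :
    antisym (p + 2) (PHom.compL (Nat.add_comm 2 p)
      (antisym (p + 1) (PHom.compL (p := 1) rfl B f)) B) =
    p.factorial • (p • antisym (p + 2) (PHom.compL (Nat.add_comm 2 p)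
        (PHom.compL (p := 1) rfl B f) B) +
      (-1 : ℤ) ^ p • antisym (p + 2) (PHom.compL (Nat.add_comm 2 p)
        (PHom.permAct (Fin.cycleRange (Fin.last p)) (PHom.compL (p := 1) rfl B f)) B)) := by
  -- The first `p` slots belong to `f` and contribute equally by its skew-symmetry; the last slot is
  -- the free variable of the outer `B`.
  rw [antisym_compL_antisym_left, Fin.sum_univ_castSucc]
  congr 2
  rw [Finset.sum_congr rfl fun j _ => ?_, Finset.sum_const, Finset.card_univ, Fintype.card_fin]
  rw [cycleRange_castSucc, ← PHom.compL_permAct_right, mem_Alt_iff.1 hf, map_zsmul, map_zsmul,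
    LinearMap.smul_apply, map_zsmul, Fin.sign_cycleRange, smul_smul]
  simp [← mul_pow]

lemma antisym_eq_zero_of_eq_neg_permAct {n : ℕ} {X : PHom k H n L M} {σ : Equiv.Perm (Fin n)}
    (hσ : Equiv.Perm.sign σ = 1) (h : X = -PHom.permAct σ X) : antisym n X = 0 := by
  have h' := congrArg (antisym n) h
  rw [map_neg, antisym_permAct, hσ, Units.val_one, one_smul] at h'
  have : (2 : k) • antisym n X = 0 := by rw [two_smul]; nth_rw 2 [h']; exact add_neg_cancel _
  exact (smul_eq_zero.1 this).resolve_left two_ne_zero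

lemma permAct_swap_of_mem_Alt {n : ℕ} {f : PHom k H (n + 2) L M} (hf : f ∈ Alt k H (n + 2) L M) :
    PHom.permAct (Equiv.swap 0 1) f = -f := by
  rw [mem_Alt_iff.1 hf, Equiv.Perm.sign_swap (by simp)]
  simp

/-- Exchanging the two copies of `B` permutes blocks of length two, which is even, while exchanging
the two slots of `f` changes the sign. The term is therefore its own negative. -/
lemma antisym_compL_parallel {r : ℕ} {f : PHom k H (r + 2) L L} (hf : f ∈ Alt k H (r + 2) L L)
    (B : PHom k H 2 L L) :
    antisym (r + 4) (PHom.compL (Nat.add_comm 2 (r + 2))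
      (PHom.permAct (Fin.cycleRange 2) (PHom.compL (Nat.add_comm 2 (r + 1)) f B)) B) = 0 := by
  obtain ⟨σ, hσ, hs⟩ := exists_blockSwap (q := 2) (p := r) (n := r + 4) (by omega)
  have hp := PHom.compL_parallel (q := 2) (s := 2) (p := r) (Nat.add_comm 2 (r + 1))
    (Nat.add_comm 2 (r + 2)) (Nat.add_comm 2 (r + 1)) (Nat.add_comm 2 (r + 2)) σ
    (fun i => by have := hσ i; grind) f B B
  rw [permAct_swap_of_mem_Alt hf, map_neg, LinearMap.neg_apply, map_neg, map_neg,
    LinearMap.neg_apply, map_neg] at hp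
  exact antisym_eq_zero_of_eq_neg_permAct hs hp

include hB in
-- The new copy of `B` enters a variable of the first copy, in two ways that agree by the
-- skew-symmetry of `B`, or another variable of `f`, where `antisym_compL_parallel` applies.
lemma antisym_compL_antisym_compL_right {r : ℕ} {f : PHom k H (r + 1) L L}
    (hf : f ∈ Alt k H (r + 1) L L) :
    antisym (r + 3) (PHom.compL (Nat.add_comm 2 (r + 1))
      (antisym (r + 2) (PHom.compL (Nat.add_comm 2 r) f B)) B) =
    (r + 1).factorial • 2 • antisym (r + 3) (PHom.compL (Nat.add_comm 2 (r + 1))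
      (PHom.compL (Nat.add_comm 2 r) f B) B) := by
  rw [antisym_compL_antisym_left, Fin.sum_univ_succ, Fin.sum_univ_succ, two_smul ℕ]
  congr 1
  rw [Finset.sum_eq_zero, add_zero]
  · congr 1
    · rw [Fin.cycleRange_zero, PHom.permAct_one]; simp
    · have h1 : Fin.cycleRange (Fin.succ (0 : Fin (r + 1))) = Equiv.swap 0 1 := by
        refine Equiv.ext fun i => Fin.ext ?_
        rw [val_cycleRange, val_swap_zero_one]
        simp only [Fin.val_succ, Fin.val_zero]
        grind
      rw [h1, permAct_swap_compL hB]
      simp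
  · intro j _
    cases r with
    | zero => exact j.elim0
    | succ r =>
      rw [cycleRange_succ_succ, PHom.permAct_mul, permAct_blockPerm_compL _ hf, map_zsmul,
        map_zsmul, LinearMap.smul_apply, map_zsmul, antisym_compL_parallel hf, smul_zero, smul_zero]

/-- The Jacobi identity in cyclic form. -/
def IsCyclicJacobi (B : PHom k H 2 L L) : Prop :=
  PHom.compL (Nat.add_comm 2 1) B B +
    PHom.permAct (Fin.cycleRange 2) (PHom.compL (Nat.add_comm 2 1) B B) +
    PHom.permAct (Fin.cycleRange 2) (PHom.permAct (Fin.cycleRange 2)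
      (PHom.compL (Nat.add_comm 2 1) B B)) = 0

variable (hJ : IsCyclicJacobi B)

include hJ in
-- The 3-cycles are even, so the three cyclic terms have equal antisymmetrizations, and `3` is
-- invertible.
lemma IsCyclicJacobi.antisym_eq_zero : antisym 3 (PHom.compL (Nat.add_comm 2 1) B B) = 0 := by
  have h := congrArg (antisym 3) hJ
  have hs : Equiv.Perm.sign (Fin.cycleRange (2 : Fin 3)) = 1 := by
    rw [Fin.sign_cycleRange]; rfl
  simp only [map_add, antisym_permAct, hs, Units.val_one, one_smul, map_zero] at h
  have h3 : (3 : k) • antisym 3 (PHom.compL (Nat.add_comm 2 1) B B) = 0 := by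
    rw [← h]; module
  exact (smul_eq_zero.1 h3).resolve_left three_ne_zero

include hJ in
-- By associativity `B ∘ B` stands inside `f`. It may be antisymmetrized there at the cost of a
-- factor `3!`, and then it vanishes.
lemma IsCyclicJacobi.antisym_compL_compL {r : ℕ} (f : PHom k H (r + 1) L L) :
    antisym (r + 3) (PHom.compL (Nat.add_comm 2 (r + 1))
      (PHom.compL (Nat.add_comm 2 r) f B) B) = 0 := by
  rw [PHom.compL_assoc (q := 1) (p := r) (Nat.add_comm 2 r) (Nat.add_comm 2 (r + 1))
    (Nat.add_comm 2 1) (Nat.add_comm 3 r) f B B]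
  have h := antisym_compL_antisym_right (Nat.add_comm 3 r) f
    (PHom.compL (Nat.add_comm 2 1) B B)
  rw [hJ.antisym_eq_zero, map_zero, map_zero, ← Nat.cast_smul_eq_nsmul k] at h
  exact (smul_eq_zero.1 h.symm).resolve_left (Nat.cast_ne_zero.2 (Nat.factorial_ne_zero 3))

include hB hJ in
-- Let `a₀`, `a₁`, `a₂` be the antisymmetrized insertions of `f` into `W = B ∘ B` and its two
-- rotations. The left side is `-a₁` by `compL_parallel`, and the right side is `2 a₀`. The Jacobi
-- identity gives `a₀ + a₁ + a₂ = 0`, and `a₂ = a₀`.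
lemma IsCyclicJacobi.antisym_compL_cycleRange {p : ℕ} (f : PHom k H p L L) :
    antisym (p + 2) (PHom.compL (Nat.add_comm 2 p)
        (PHom.permAct (Fin.cycleRange (Fin.last p)) (PHom.compL (p := 1) rfl B f)) B) =
      (2 : k) • antisym (p + 2) (PHom.compL (p := 1) rfl B (PHom.compL (p := 1) rfl B f)) := by
  set W := PHom.compL (Nat.add_comm 2 1) B B with hW
  have h1 : PHom.compL (p := 1) rfl B (PHom.compL (p := 1) rfl B f) =
      PHom.compL (p := 2) (rfl : p + 2 = p + 2) W f :=
    (PHom.compL_assoc (q := 1) (p := 1) (m := 2) (Nat.add_comm 2 1) rfl rfl rfl B B f).symm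
  obtain ⟨σ, hσ, hs⟩ := exists_blockSwap (q := p) (p := 0) (n := p + 2) rfl
  have hp := PHom.compL_parallel (q := p) (s := 2) (p := 0) (m' := 2) rfl (Nat.add_comm 2 p)
    (Nat.add_comm 2 1) rfl σ (fun i => by have := hσ i; grind) B f B
  rw [permAct_swap_of_mem_Alt (n := 0) hB, map_neg, LinearMap.neg_apply, map_neg, map_neg,
    LinearMap.neg_apply, map_neg] at hp
  have h4 := congrArg (antisym (p + 2)) hp
  rw [map_neg, antisym_permAct, hs, Units.val_one, one_smul] at h4
  -- This is `a₂ = a₀`: the inner `B` is skew, so `W` changes sign when its first two variables are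
  -- exchanged.
  have h2 : antisym (p + 2) (PHom.compL (p := 2) rfl (PHom.permAct (Fin.cycleRange 2)
      (PHom.permAct (Fin.cycleRange 2) W)) f) = antisym (p + 2) (PHom.compL (p := 2) rfl W f) := by
    have hc : consPerm (Equiv.swap (0 : Fin 2) 1) =
        Fin.cycleRange 2 * (Fin.cycleRange 2 * Equiv.swap 0 1) := by decide
    have h := congrArg (antisym (p + 2)) (PHom.compL_permAct_left (p := 2)
      (rfl : p + 2 = p + 2) (τ := Equiv.swap 0 1) (f := W) (g := f))
    rw [hc, PHom.permAct_mul, PHom.permAct_mul, hW, permAct_swap_compL hB, ← hW, antisym_permAct,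
      sign_blockPerm, Equiv.Perm.sign_swap (by simp)] at h
    simpa using h
  have h := congrArg (fun X => antisym (p + 2) (PHom.compL (p := 2) rfl X f)) hJ
  simp only [← hW, map_add, LinearMap.add_apply, h2, map_zero, LinearMap.zero_apply] at h
  rw [h1]
  refine h4.trans ?_
  rw [two_smul, neg_eq_iff_add_eq_zero, ← h]
  exact (add_left_comm _ _ _).trans (add_assoc _ _ _).symm

include hB hJ in
-- The terms with `B ∘ B` inside `f` vanish. Up to antisymmetrization, all others are multiples of
-- `B ∘ (B ∘ f)` or of `(B ∘ f) ∘ B`, and for each of these two the coefficients cancel.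
theorem IsCyclicJacobi.nr_nr {p : ℕ} (h₁ : p + 1 + 1 = 2 + p) (h₂ : p + 1 + 1 + 1 = 2 + (p + 1))
    {f : PHom k H p L L} (hf : f ∈ Alt k H p L L) : nr h₂ B (nr h₁ B f) = 0 := by
  rw [nr_two_succ hB h₂ (nr_two_mem_Alt hB h₁ hf)]
  cases p with
  | zero =>
    rw [nr_two_zero h₁ B hf, antisym_compL_antisym_right,
      antisym_compL_antisym_compL hf, hJ.antisym_compL_cycleRange hB]
    simp
  | succ r =>
    have h23 : antisym (r + 3) (PHom.compL (p := 1) rfl B (PHom.compL (Nat.add_comm 2 r) f B)) =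
        antisym (r + 3) (PHom.compL (Nat.add_comm 2 (r + 1)) (PHom.compL (p := 1) rfl B f) B) := by
      rw [PHom.compL_assoc (q := r) (p := 1) rfl (Nat.add_comm 2 (r + 1)) (Nat.add_comm 2 r) rfl
        B f B]
    rw [nr_two_succ hB h₁ hf]
    simp only [map_sub, map_smul, LinearMap.sub_apply, LinearMap.smul_apply]
    rw [antisym_compL_antisym_right, antisym_compL_antisym_right, antisym_compL_antisym_compL hf,
      hJ.antisym_compL_cycleRange hB, antisym_compL_antisym_compL_right hB hf,
      hJ.antisym_compL_compL, h23]
    have hr : (r.factorial : k) ≠ 0 := Nat.cast_ne_zero.2 r.factorial_ne_zero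
    have hr1 : (r + 1 : k) ≠ 0 := Nat.cast_add_one_ne_zero r
    have hr2 : (r + 1 + 1 : k) ≠ 0 := by exact_mod_cast Nat.cast_add_one_ne_zero (R := k) (r + 1)
    have hs : ((-1 : k) ^ r) * (-1) ^ r = 1 := by rw [← mul_pow]; simp
    simp only [← Nat.cast_smul_eq_nsmul k, ← Int.cast_smul_eq_zsmul k, Nat.factorial_succ,
      smul_zero, sub_zero]
    push_cast
    match_scalars
    · field_simp
      rw [pow_succ]
      linear_combination -hs
    · field_simp
      ring

lemma IsLieBracket.toPHom_mem_Alt {b : PBil k H L L L} (hb : IsLieBracket b) :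
    b.toPHom ∈ Alt k H 2 L L := by
  intro σ
  obtain rfl | rfl : σ = 1 ∨ σ = Equiv.swap 0 1 := by revert σ; decide
  · rw [PHom.permAct_one]; simp
  · rw [Equiv.Perm.sign_swap (by simp)]
    refine PHom.ext (funext fun x => (hb.skew (x 0) (x 1)).trans ?_)
    simp only [Units.val_neg, Units.val_one, neg_smul, one_smul]
    rfl

lemma IsLieBracket.perm_cycleRange_insL {b : PBil k H L L L} (hb : IsLieBracket b) {q : ℕ} (x : L)
    (z : PT k H q L) : PT.perm (Fin.cycleRange (Fin.last q)) (b.insL x z) = -b.insR x z := by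
  have hf : b.flip = -b := PBil.ext (funext fun a => funext fun c => by
    change PT.perm _ (b.1 c a) = -b.1 a c
    rw [hb.skew a c, neg_neg])
  rw [← PBil.flip_flip b, PBil.perm_insL_flip, PBil.flip_flip, hf, PBil.neg_insR]

/-- By skew-symmetry the rotations of `[[x * y] * z]` are `-[x * [y * z]]` and `((12) ⊗_H id)[y * [x
* z]]`, the other terms of the Jacobi identity. -/
lemma IsLieBracket.isCyclicJacobi {b : PBil k H L L L} (hb : IsLieBracket b) :
    IsCyclicJacobi b.toPHom := by
  refine PHom.ext (funext fun x => ?_)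
  have hW : ∀ y : Fin 3 → L, (PHom.compL (p := 1) (Nat.add_comm 2 1) b.toPHom b.toPHom).1 y =
      b.insL (y 2) (b.1 (y 0) (y 1)) := fun y => PBil.toPHom_insL b _ _
  have hκ : Fin.cycleRange (2 : Fin 3) = Fin.cycleRange (Fin.last 2) := rfl
  have h1 : (PHom.permAct (Fin.cycleRange 2) (PHom.compL (p := 1) (Nat.add_comm 2 1)
      b.toPHom b.toPHom)).1 x = -b.insR (x 0) (b.1 (x 1) (x 2)) := by
    rw [PHom.permAct_apply, hW, hκ, ← hb.perm_cycleRange_insL]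
    rfl
  have h2 : (PHom.permAct (Fin.cycleRange 2) (PHom.permAct (Fin.cycleRange 2)
      (PHom.compL (p := 1) (Nat.add_comm 2 1) b.toPHom b.toPHom))).1 x =
      PT.perm (Equiv.swap (0 : Fin 3) 1) (b.insR (x 1) (b.1 (x 0) (x 2))) := by
    have hc : Fin.cycleRange (Fin.last 2) * Fin.cycleRange (Fin.last 2) *
        blockPerm rfl (Equiv.swap 0 1) 1 = Equiv.swap 0 1 * Fin.cycleRange (Fin.last 2) := by
      decide
    have hx : b.insL (x 1) (b.1 (x 2) (x 0)) =
        -PT.perm (blockPerm rfl (Equiv.swap 0 1) 1) (b.insL (x 1) (b.1 (x 0) (x 2))) := by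
      rw [hb.skew, map_neg, PBil.insL_perm]
    rw [PHom.permAct_apply, PHom.permAct_apply, hW, hκ]
    change PT.perm _ (PT.perm _ (b.insL (x 1) (b.1 (x 2) (x 0)))) = _
    rw [hx, map_neg, map_neg, PT.perm_perm, PT.perm_perm, hc, ← PT.perm_perm,
      hb.perm_cycleRange_insL, map_neg, neg_neg]
  have h : b.insL (x 2) (b.1 (x 0) (x 1)) + -b.insR (x 0) (b.1 (x 1) (x 2)) +
      PT.perm (Equiv.swap (0 : Fin 3) 1) (b.insR (x 1) (b.1 (x 0) (x 2))) = 0 := by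
    rw [hb.jacobi (x 0) (x 1) (x 2)]
    abel
  rw [← hW x, ← h1, ← h2] at h
  exact h

end NijenhuisRichardson

/-! ### Linear maps as operations of one variable -/

section LinearMaps
variable {k H : Type*} [Field k] [Ring H] [HopfAlgebra k H]
variable {L M A B N : Type*} [AddCommGroup L] [Module k L] [Module H L] [IsScalarTower k H L]
  [AddCommGroup M] [Module k M] [Module H M] [IsScalarTower k H M]
  [AddCommGroup A] [Module k A] [Module H A] [IsScalarTower k H A]
  [AddCommGroup B] [Module k B] [Module H B] [IsScalarTower k H B]
  [AddCommGroup N] [Module k N] [Module H N] [IsScalarTower k H N]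

lemma PHom.insL_ofLinearMap {q : ℕ} (u : L →ₗ[H] M) (x : Fin 0 → L) (z : PT k H q L) :
    (PHom.ofLinearMap u).insL (Nat.add_zero q) x z = PT.map u z := by
  induction z using PT.induction with
  | hmk a y =>
    have h : emb (k := k) (H := H) (blockL (Nat.add_zero q)) (blockL_injective _) =
        AlgHom.id k _ := hom_ext fun i a => emb_single _ _ _ _
    rw [insL_mk, PT.map_mk, h]
    change a • PT.pull _ _ (PT.mk 1 (u y)) = _
    rw [PT.pull_mk, PT.smul_mk, map_one, mul_one]
  | hadd z w hz hw => simp only [_root_.map_add, hz, hw]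

lemma PBil.insL_mk_one (β : PBil k H A B N) (x : A) (y : B) :
    β.insL (q := 1) y (PT.mk 1 x) = β.1 x y := by
  have h : expandL (k := k) (H := H) (q := 1) (p := 1) rfl = AlgHom.id k _ := by
    refine hom_ext fun i a => ?_
    induction i using Fin.cases with
    | zero => simp [expandL, coprod_one]; rfl
    | succ i => simp [expandL]; obtain rfl := Subsingleton.elim i 0; rfl
  rw [insL_mk, map_one, one_smul]
  generalize β.1 x y = z
  induction z using PT.induction with
  | hmk a y => rw [PT.pull_mk, h]; rfl
  | hadd z w hz hw => simp only [_root_.map_add, hz, hw]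

lemma PBil.zero_left (β : PBil k H A B N) (y : B) : β.1 0 y = 0 := by
  have := β.add_left 0 0 y
  rwa [add_zero, left_eq_add] at this

end LinearMaps

/-! ### The twisted differential as a bracket with a semidirect product -/

section TwistedDifferential
variable {k H g h L : Type*} [Field k] [Ring H] [HopfAlgebra k H] [Coalgebra.IsCocomm k H]
  [AddCommGroup L] [Module k L] [Module H L] [IsScalarTower k H L]
  [AddCommGroup g] [Module k g] [Module H g] [IsScalarTower k H g]
  [AddCommGroup h] [Module k h] [Module H h] [IsScalarTower k H h]

lemma liftG_ofLinearMap (D : g →ₗ[H] h) : liftG k H g h 1 (PHom.ofLinearMap D) =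
    PHom.ofLinearMap (LinearMap.inr H g h ∘ₗ D ∘ₗ LinearMap.fst H g h) :=
  PHom.ext (funext fun _ => PT.map_mk _ _ _)

/-- For skew-symmetric `b` this is the failure of `u` to be a derivation of `b`. -/
lemma nr_ofLinearMap_apply (hn : 2 + 1 = 2 + 1) (b : PBil k H L L L) (u : L →ₗ[H] L)
    (x : Fin 2 → L) : (nr hn b.toPHom (PHom.ofLinearMap u)).1 x =
      b.1 (u (x 0)) (x 1) - PT.perm (Equiv.swap 0 1) (b.1 (u (x 1)) (x 0)) -
        PT.map u (b.1 (x 0) (x 1)) := by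
  have h1 : nr hn b.toPHom (PHom.ofLinearMap u) = circ hn b.toPHom (PHom.ofLinearMap u) -
      (-1 : ℤ) ^ ((2 + 1) * (1 + 1)) • circ (hn.trans (Nat.add_comm 2 1))
        (PHom.ofLinearMap u) b.toPHom := rfl
  have hl : circ hn b.toPHom (PHom.ofLinearMap u) =
      PHom.compL (p := 1) (q := 1) rfl b.toPHom (PHom.ofLinearMap u) - PHom.permAct (Equiv.swap 0 1)
        (PHom.compL (p := 1) (q := 1) rfl b.toPHom (PHom.ofLinearMap u)) := by
    have hc1 : Fin.cycleRange (1 : Fin 2) = Equiv.swap 0 1 := by decide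
    have hcl : Fin.cycleRange (Fin.last 1) = Equiv.swap 0 1 := by decide
    rw [circ_two_left, hcl]
    generalize PHom.compL (p := 1) (q := 1) rfl b.toPHom (PHom.ofLinearMap u) = X
    change (-1 : ℤ) ^ 1 • ∑ i : Fin 2, (-1 : ℤ) ^ (i : ℕ) • PHom.permAct (Fin.cycleRange i)⁻¹
      (PHom.permAct (Equiv.swap 0 1) X) = _
    rw [Fin.sum_univ_two, Fin.cycleRange_zero, hc1, Equiv.swap_inv, inv_one, PHom.permAct_one,
      ← PHom.permAct_mul, Equiv.swap_mul_self, PHom.permAct_one]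
    simp only [Fin.val_zero, Fin.val_one, pow_zero, pow_one, one_smul, neg_smul]
    abel
  have hr : circ (hn.trans (Nat.add_comm 2 1)) (PHom.ofLinearMap u) b.toPHom =
      PHom.compL (Nat.add_zero 2) (PHom.ofLinearMap u) b.toPHom := by
    have hp : pairPerm (0 : Fin 2) (0 : Fin 1) = 1 := by decide
    rw [circ_two_right (r := 0)]
    generalize PHom.compL _ (PHom.ofLinearMap u) b.toPHom = X
    change ∑ i : Fin 2, ∑ j : Fin 1, (if i ≤ j.castSucc then
      (-1 : ℤ) ^ ((i : ℕ) + (j : ℕ)) • PHom.permAct (pairPerm i j) X else 0) = X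
    rw [Fin.sum_univ_two, Fin.sum_univ_one, Fin.sum_univ_one, if_pos (Fin.zero_le _),
      if_neg (by decide), hp, PHom.permAct_one, add_zero]
    exact one_smul _ _
  have hX : ∀ y : Fin 2 → L, (PHom.compL (p := 1) (q := 1) rfl b.toPHom
      (PHom.ofLinearMap u)).1 y = b.1 (u (y 0)) (y 1) := fun y =>
    (PBil.toPHom_insL b _ _).trans (PBil.insL_mk_one b _ _)
  have hY : (PHom.compL (Nat.add_zero 2) (PHom.ofLinearMap u) b.toPHom).1 x =
      PT.map u (b.1 (x 0) (x 1)) := PHom.insL_ofLinearMap u _ _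
  rw [h1, hl, hr, show (-1 : ℤ) ^ ((2 + 1) * (1 + 1)) = 1 by norm_num, one_smul, ← hY, ← hX]
  have h2 := hX (x ∘ Equiv.swap 0 1)
  simp only [Function.comp_apply, Equiv.swap_apply_left, Equiv.swap_apply_right] at h2
  rw [← h2]
  rfl

namespace QuasiTwilled
variable (Q : QuasiTwilled k H g h)

/-- The operations `π^D` and `ρ^D` are affine in `D`, and the bracket with `D` is their linear part:
`η(x, D y)` and its flip enter `π^D`, while `μ(D x, v)` and `-D η(x, v)` enter `ρ^D`. -/
lemma nr_muHat_add_etaHat (hn : 2 + 1 = 2 + 1) (D : g →ₗ[H] h) :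
    nr hn (Q.muHat + Q.etaHat) (liftG k H g h 1 (PHom.ofLinearMap D)) =
      (semidirect (Q.piD D - Q.π) (Q.rhoD D - Q.ρ)).toPHom := by
  have hb : Q.muHat + Q.etaHat =
      (Q.μ.comp (LinearMap.snd H g h) (LinearMap.snd H g h) (LinearMap.inr H g h) +
      (Q.η.comp (LinearMap.fst H g h) (LinearMap.snd H g h) (LinearMap.inl H g h) -
        (Q.η.comp (LinearMap.fst H g h) (LinearMap.snd H g h)
          (LinearMap.inl H g h)).flip)).toPHom := rfl
  refine PHom.ext (funext fun x => ?_)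
  rw [hb, liftG_ofLinearMap, nr_ofLinearMap_apply]
  change _ = (semidirect (Q.piD D - Q.π) (Q.rhoD D - Q.ρ)).1 (x 0) (x 1)
  have hD : ∀ z : PT k H 2 (g × h), PT.map (LinearMap.inr H g h ∘ₗ D ∘ₗ LinearMap.fst H g h) z =
      PT.map (LinearMap.inr H g h) (PT.map D (PT.map (LinearMap.fst H g h) z)) := fun z => by
    rw [PT.map_map, PT.map_map, LinearMap.comp_assoc]
  refine PT.prod_ext ?_ ?_
  · rw [map_fst_semidirect]
    simp only [PBil.add_apply, PBil.sub_apply, PBil.comp_apply, PBil.flip_apply, map_add, map_sub,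
      PT.perm_map, PT.map_fst_inl, PT.map_fst_inr, hD, piD, LinearMap.comp_apply,
      LinearMap.fst_apply, LinearMap.snd_apply, LinearMap.inr_apply, PBil.zero_left,
      LinearMap.id_apply, PT.map_id, map_zero, PT.perm_perm, Equiv.swap_mul_self, PT.perm_one]
    abel
  · rw [map_snd_semidirect]
    simp only [PBil.add_apply, PBil.sub_apply, PBil.comp_apply, PBil.flip_apply, map_add, map_sub,
      PT.perm_map, PT.map_fst_inl, PT.map_fst_inr, PT.map_snd_inl, PT.map_snd_inr, hD, rhoD,
      LinearMap.comp_apply, LinearMap.fst_apply, LinearMap.snd_apply, LinearMap.inr_apply,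
      PBil.zero_left, LinearMap.id_apply, PT.map_id, map_zero]
    abel

lemma bracketOne_apply (p : ℕ) (f : PHom k H p g h) : Q.bracketOne p f =
    (-1 : ℤ) ^ (p + 1) • liftG k H g h (p + 1) (ceDiff Q.π Q.ρ p f) :=
  nr_semidirect Q.π Q.ρ _ f

/-- The differences need not form a Lie pseudobracket with a representation, but `nr_semidirect`
asks for neither. -/
lemma bracketTwo_apply (D : g →ₗ[H] h) (p : ℕ) (f : PHom k H p g h) :
    Q.bracketTwo (Nat.add_comm p 1) (PHom.ofLinearMap D) f = (-1 : ℤ) ^ (p + 1) •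
      liftG k H g h (p + 1) (ceDiff (Q.piD D - Q.π) (Q.rhoD D - Q.ρ) p f) := by
  rw [← nr_semidirect _ _ (by omega), ← nr_muHat_add_etaHat Q rfl]
  rfl

lemma semidirect_sub_add (β β' : PBil k H g g g) (ρ ρ' : PBil k H g h h) :
    (semidirect β ρ).toPHom + (semidirect (β' - β) (ρ' - ρ)).toPHom =
      (semidirect β' ρ').toPHom := by
  refine PHom.ext (funext fun x => ?_)
  change (semidirect β ρ).1 (x 0) (x 1) + (semidirect (β' - β) (ρ' - ρ)).1 (x 0) (x 1) =
    (semidirect β' ρ').1 (x 0) (x 1)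
  refine PT.prod_ext ?_ ?_
  · rw [map_add, map_fst_semidirect, map_fst_semidirect, map_fst_semidirect, PBil.sub_apply]
    abel
  · rw [map_add, map_snd_semidirect, map_snd_semidirect, map_snd_semidirect, PBil.sub_apply,
      PBil.sub_apply, map_sub]
    abel

/-- Both brackets are taken with semidirect products, whose sum is that of `π^D` and `ρ^D`. The
exponent `p + 1` has the parity of `p - 1` and makes sense for `p = 0`. -/
lemma l₁D_eq (D : g →ₗ[H] h) (p : ℕ) :
    Q.l₁D D p = (-1 : ℤ) ^ (p + 1) • ceDiff (Q.piD D) (Q.rhoD D) p := by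
  have hn : p + 1 + 1 = 2 + p := by omega
  refine LinearMap.ext fun f => ?_
  have h1 : Q.l₁D D p f = projG k H g h (p + 1) (Q.bracketOne p f +
      Q.bracketTwo (Nat.add_comm p 1) (PHom.ofLinearMap D) f) := by
    rw [map_add]
    rfl
  rw [h1, bracketOne_apply, bracketTwo_apply, ← nr_semidirect _ _ hn, ← nr_semidirect _ _ hn,
    ← LinearMap.add_apply, ← map_add, semidirect_sub_add, nr_semidirect, map_zsmul, projG_liftG]
  rfl

end QuasiTwilled
end TwistedDifferential

/-! ### The Chevalley–Eilenberg operator is a differential -/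

section ChevalleyEilenberg
variable {k H g h : Type*} [Field k] [CharZero k] [Ring H] [HopfAlgebra k H]
  [Coalgebra.IsCocomm k H]
  [AddCommGroup g] [Module k g] [Module H g] [IsScalarTower k H g]
  [AddCommGroup h] [Module k h] [Module H h] [IsScalarTower k H h]
  {β : PBil k H g g g} {ρ : PBil k H g h h}

lemma liftG_injective (p : ℕ) : Function.Injective (liftG k H g h p) :=
  Function.LeftInverse.injective projG_liftG

lemma liftG_mem_Alt {p : ℕ} {f : PHom k H p g h} :
    liftG k H g h p f ∈ Alt k H p (g × h) (g × h) ↔ f ∈ Alt k H p g h := by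
  simp only [mem_Alt_iff, ← liftG_permAct, ← map_zsmul, (liftG_injective p).eq_iff]

lemma neg_one_pow_smul_eq_zero_iff {X : Type*} [AddCommGroup X] {n : ℕ} {x : X} :
    (-1 : ℤ) ^ n • x = 0 ↔ x = 0 := by
  rcases neg_one_pow_eq_or ℤ n with h | h <;> simp [h]

lemma neg_one_pow_smul_mem_iff {X : Type*} [AddCommGroup X] [Module k X] {S : Submodule k X}
    {n : ℕ} {x : X} : (-1 : ℤ) ^ n • x ∈ S ↔ x ∈ S := by
  rcases neg_one_pow_eq_or ℤ n with h | h <;> simp [h]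

lemma ceDiff_mem_Alt (hβ : IsLieBracket β) (hρ : IsRep β ρ) {p : ℕ} {f : PHom k H p g h}
    (hf : f ∈ Alt k H p g h) : ceDiff β ρ p f ∈ Alt k H (p + 1) g h := by
  rw [← liftG_mem_Alt, ← neg_one_pow_smul_mem_iff (n := p + 1),
    ← nr_semidirect β ρ (by omega)]
  exact nr_two_mem_Alt (hβ.semidirect hρ).toPHom_mem_Alt _ (liftG_mem_Alt.2 hf)

/-- The lift is injective and turns the operator, up to sign, into the bracket with a Lie
pseudobracket, so `nr_nr` applies. -/
lemma ceDiff_ceDiff (hβ : IsLieBracket β) (hρ : IsRep β ρ) {p : ℕ} {f : PHom k H p g h}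
    (hf : f ∈ Alt k H p g h) : ceDiff β ρ (p + 1) (ceDiff β ρ p f) = 0 := by
  have h := (hβ.semidirect hρ).isCyclicJacobi.nr_nr (hβ.semidirect hρ).toPHom_mem_Alt
    (by omega) (by omega) (liftG_mem_Alt.2 hf)
  rw [nr_semidirect, map_zsmul, nr_semidirect, neg_one_pow_smul_eq_zero_iff,
    neg_one_pow_smul_eq_zero_iff] at h
  exact liftG_injective _ (h.trans (map_zero _).symm)

lemma ofElem_mem_Alt (u : h) : PHom.ofElem k H g h u ∈ Alt k H 0 g h := fun σ => by
  rw [Subsingleton.elim σ 1, PHom.permAct_one]; simp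

end ChevalleyEilenberg

/-! ### Cohomology is insensitive to signs of the differential -/

section Cohomology
variable {k H L M : Type*} [Field k] [Ring H] [HopfAlgebra k H] [Coalgebra.IsCocomm k H]
  [AddCommGroup L] [Module k L] [Module H L] [IsScalarTower k H L]
  [AddCommGroup M] [Module k M] [Module H M] [IsScalarTower k H M]
  {δ δ' : ∀ p : ℕ, PHom k H p L M →ₗ[k] PHom k H (p + 1) L M}
  (hδ : ∀ p, δ' p = (-1 : ℤ) ^ (p + 1) • δ p)

include hδ in
lemma diffZero_eq_neg : diffZero δ' = -diffZero δ := by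
  refine LinearMap.ext fun u => ?_
  rw [diffZero, hδ 0]
  simp [diffZero]

include hδ in
lemma cocyclesZero_eq : cocyclesZero δ' = cocyclesZero δ := by
  rw [cocyclesZero, cocyclesZero, diffZero_eq_neg hδ, LinearMap.ker_neg]

include hδ in
lemma cocycles_eq (p : ℕ) : cocycles δ' p = cocycles δ p := by
  rw [cocycles, cocycles, hδ]
  congr 1
  rcases neg_one_pow_eq_or ℤ (p + 1 + 1) with h | h <;> simp [h]

include hδ in
lemma coboundaries_eq (p : ℕ) : coboundaries δ' p = coboundaries δ p := by
  cases p with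
  | zero => rw [coboundaries, coboundaries, diffZero_eq_neg hδ, LinearMap.range_neg]
  | succ p =>
    rw [coboundaries, coboundaries, hδ]
    rcases neg_one_pow_eq_or ℤ (p + 1 + 1) with h | h <;> simp [h, Submodule.map_neg]

lemma coboundaries_le_cocycles
    (hA : ∀ p, ∀ f ∈ Alt k H p L M, δ p f ∈ Alt k H (p + 1) L M ∧ δ (p + 1) (δ p f) = 0)
    (hu : ∀ u, PHom.ofElem k H L M u ∈ Alt k H 0 L M)
    (p : ℕ) : coboundaries δ p ≤ cocycles δ p := by
  cases p with
  | zero => rintro _ ⟨u, rfl⟩; exact hA 0 _ (hu u)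
  | succ p => rintro _ ⟨f, hf, rfl⟩; exact hA (p + 1) f hf

lemma nonempty_cohomology_equiv {p : ℕ} (h₁ : cocycles δ' p = cocycles δ p)
    (h₂ : coboundaries δ' p = coboundaries δ p) :
    Nonempty (Cohomology δ' p ≃ₗ[k] Cohomology δ p) := by
  unfold Cohomology
  rw [h₁, h₂]
  exact ⟨LinearEquiv.refl _ _⟩

end Cohomology

end LiePseudo
end

theorem proposition3 {k H g h : Type*} [Field k] [CharZero k] [Ring H] [HopfAlgebra k H]
    [Coalgebra.IsCocomm k H]
    [AddCommGroup g] [Module k g] [Module H g] [IsScalarTower k H g]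
    [AddCommGroup h] [Module k h] [Module H h] [IsScalarTower k H h]
    (Q : LiePseudo.QuasiTwilled k H g h) (D : g →ₗ[H] h) (hD : Q.IsDMap D) :
    -- `(g, π^D)` is a Lie pseudoalgebra, with the representation `ρ^D` on `h`
    LiePseudo.IsLieBracket (Q.piD D) ∧
    LiePseudo.IsRep (Q.piD D) (Q.rhoD D) ∧
    -- the brackets that define `l₁` and `l₂(D, ·)` lie in `C^*(g, h)`
    (∀ p : ℕ, ∀ f ∈ LiePseudo.Alt k H p g h,
      Q.bracketOne p f = LiePseudo.liftG k H g h (p + 1) (Q.l₁ p f) ∧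
      Q.bracketTwo (Nat.add_comm p 1) (LiePseudo.PHom.ofLinearMap D) f =
        LiePseudo.liftG k H g h (p + 1)
          (Q.l₂ (Nat.add_comm p 1) (LiePseudo.PHom.ofLinearMap D) f)) ∧
    -- the twisted differential is the Chevalley–Eilenberg differential up to sign
    (∀ p : ℕ, ∀ f ∈ LiePseudo.Alt k H p g h,
      Q.l₁D D p f = (-1 : ℤ) ^ (p + 1) • LiePseudo.ceDiff (Q.piD D) (Q.rhoD D) p f) ∧
    -- the Chevalley–Eilenberg operator is a differential on skew-symmetric cochains
    (∀ p : ℕ, ∀ f ∈ LiePseudo.Alt k H p g h,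
      LiePseudo.ceDiff (Q.piD D) (Q.rhoD D) p f ∈ LiePseudo.Alt k H (p + 1) g h ∧
      LiePseudo.ceDiff (Q.piD D) (Q.rhoD D) (p + 1)
        (LiePseudo.ceDiff (Q.piD D) (Q.rhoD D) p f) = 0) ∧
    -- the cohomology of the twisted differential is the Chevalley–Eilenberg cohomology
    LiePseudo.cocyclesZero (Q.l₁D D) =
      LiePseudo.cocyclesZero (LiePseudo.ceDiff (Q.piD D) (Q.rhoD D)) ∧
    (∀ p : ℕ,
      LiePseudo.cocycles (Q.l₁D D) p =
        LiePseudo.cocycles (LiePseudo.ceDiff (Q.piD D) (Q.rhoD D)) p ∧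
      LiePseudo.coboundaries (Q.l₁D D) p =
        LiePseudo.coboundaries (LiePseudo.ceDiff (Q.piD D) (Q.rhoD D)) p ∧
      LiePseudo.coboundaries (LiePseudo.ceDiff (Q.piD D) (Q.rhoD D)) p ≤
        LiePseudo.cocycles (LiePseudo.ceDiff (Q.piD D) (Q.rhoD D)) p ∧
      Nonempty (LiePseudo.Cohomology (Q.l₁D D) p ≃ₗ[k]
        LiePseudo.Cohomology (LiePseudo.ceDiff (Q.piD D) (Q.rhoD D)) p)) := by
  have hβ := Q.isLieBracket_piD hD
  have hρ := Q.isRep_rhoD hD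
  have hd := Q.l₁D_eq D
  have hA : ∀ p : ℕ, ∀ f ∈ LiePseudo.Alt k H p g h,
      LiePseudo.ceDiff (Q.piD D) (Q.rhoD D) p f ∈ LiePseudo.Alt k H (p + 1) g h ∧
      LiePseudo.ceDiff (Q.piD D) (Q.rhoD D) (p + 1)
        (LiePseudo.ceDiff (Q.piD D) (Q.rhoD D) p f) = 0 := fun p f hf =>
    ⟨LiePseudo.ceDiff_mem_Alt hβ hρ hf, LiePseudo.ceDiff_ceDiff hβ hρ hf⟩
  refine ⟨hβ, hρ, fun p f _ => ⟨?_, ?_⟩, fun p f _ => by rw [hd]; rfl, hA,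
    LiePseudo.cocyclesZero_eq hd, fun p => ⟨LiePseudo.cocycles_eq hd p,
      LiePseudo.coboundaries_eq hd p,
      LiePseudo.coboundaries_le_cocycles hA LiePseudo.ofElem_mem_Alt p,
      LiePseudo.nonempty_cohomology_equiv (LiePseudo.cocycles_eq hd p)
        (LiePseudo.coboundaries_eq hd p)⟩⟩
  -- The bracket is a multiple of a lift, and projecting a lift and lifting again changes nothing.
  · rw [LiePseudo.QuasiTwilled.l₁, LinearMap.comp_apply, Q.bracketOne_apply, map_zsmul,
      LiePseudo.projG_liftG, map_zsmul]
  · rw [LiePseudo.QuasiTwilled.l₂, LinearMap.compr₂_apply, Q.bracketTwo_apply, map_zsmul,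
      LiePseudo.projG_liftG, map_zsmul]
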